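/- **Setting.** Let $M$ be a time-oriented globally hyperbolic Lorentzian manifold of dimension $m\ge 2$, with volume measure $\mathrm{vol}_M$. For $n=0,1$ let $F_n\to M$ be a finite-rank smooth real vector bundle with a fiber metric $h_n$ (a smooth, symmetric, fiberwise nondegenerate bilinear form). Write $\mathfrak F_n(M)=\Gamma^\infty(M,F_n)$, and $\mathfrak F_{n,\mathrm c}(M)$, $\mathfrak F_{n,\mathrm{pc}}(M)$, $\mathfrak F_{n,\mathrm{fc}}(M)$ for the subspaces of sections with compact, past compact and future compact support, where $s$ has past (future) compact support if $\mathrm{supp}(s)\subseteq J^{+}_M(\Sigma)$ (resp. $J^-_M(\Sigma)$) for some Cauchy surface $\Sigma\subset M$. Let $\langle s,s'\rangle=\int_M h_n(s,s')\,\mathrm{vol}_M$ for sections with compactly overlapping supports. Let $Q:\mathfrak F_1(M)\to\mathfrak F_0(M)$ and $P:\mathfrak F_0(M)\to\mathfrak F_0(M)$ be linear differential operators such that $P$ is formally self-adjoint and $PQ=0$, and let $Q^*:\mathfrak F_0(M)\to\mathfrak F_1(M)$ be the formal adjoint of $Q$, so that $Q^*P=0$ as well. **Complexes.** Chain complexes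 are homologically graded. The solution complex is $$\mathfrak{Sol}(M)=\Big(\overset{(-2)}{\mathfrak F_1(M)}\xleftarrow{\;Q^*\;}\overset{(-1)}{\mathfrak F_0(M)}\xleftarrow{\;P\;}\overset{(0)}{\mathfrak F_0(M)}\xleftarrow{\;Q\;}\overset{(1)}{\mathfrak F_1(M)}\Big),$$ and for $k\in\{\mathrm c,\mathrm{pc},\mathrm{fc}\}$ let $$\mathfrak L_k(M)=\Big(\overset{(-1)}{\mathfrak F_{1,k}(M)}\xleftarrow{-Q^*}\overset{(0)}{\mathfrak F_{0,k}(M)}\xleftarrow{\;P\;}\overset{(1)}{\mathfrak F_{0,k}(M)}\xleftarrow{-Q}\overset{(2)}{\mathfrak F_{1,k}(M)}\Big).$$ The complex of linear observables is $\mathfrak L(M)=\mathfrak L_{\mathrm c}(M)$. Let $\iota:\mathfrak L(M)\to\mathfrak L_{\mathrm{pc}/\mathrm{fc}}(M)$ be the inclusions. Let $\mathfrak{Sol}(M)[1]_n=\mathfrak{Sol}(M)_{n-1}$ with differential $-d$, and let $j_k:\mathfrak L_k(M)\to\mathfrak{Sol}(M)[1]$ be the chain map that is the inclusion of sections in degrees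 $-1,0$ and minus the inclusion in degrees $1,2$. The integration pairings of $\mathfrak L(M)_p$ with $\mathfrak{Sol}(M)_{-p}$ define a chain map $\langle\cdot,\cdot\rangle:\mathfrak L(M)\otimes\mathfrak{Sol}(M)\to\mathbb R$, and $\langle\cdot,\cdot\rangle:\mathfrak{Sol}(M)\otimes\mathfrak L(M)\to\mathbb R$ is obtained from it by the symmetric braiding $a\otimes b\mapsto(-1)^{|a||b|}b\otimes a$. **Trivializations.** A retarded (advanced) trivialization is a contracting homotopy $\Lambda^+$ of $\mathfrak L_{\mathrm{pc}}(M)$ (resp. $\Lambda^-$ of $\mathfrak L_{\mathrm{fc}}(M)$), i.e. a family of linear maps of degree $1$ with $d\Lambda^\pm+\Lambda^\pm d=\mathrm{id}$. A pair $\Lambda^\pm$ defines $\Lambda=j_{\mathrm{pc}}\Lambda^+\iota-j_{\mathrm{fc}}\Lambda^-\iota$, regarded as a chain map $\mathfrak L(M)\to\mathfrak{Sol}(M)$ (using $\mathfrak{Sol}(M)[1]_{n+1}=\mathfrak{Sol}(M)_n$). The pair is *compatible* if $\langle a,\Lambda b\rangle=-\langle\Lambda a,b\rangle$ for all homogeneous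 $a,b\in\mathfrak L(M)$. A compatible pair defines the unshifted Poisson structure $\tau(a,b)=\langle a,\Lambda b\rangle$ on $\mathfrak L(M)$, which is graded antisymmetric. **Quantization.** A dg $*$-algebra is a differential graded unital associative algebra over $\mathbb C$ with an antilinear involution $*$ that preserves degrees, commutes with the differential and satisfies $(ab)^*=(-1)^{|a||b|}b^*a^*$. For a real chain complex $V$ with a graded antisymmetric chain map $\tau:V\otimes V\to\mathbb R$, let $T^\otimes_{\mathbb C}V=\bigoplus_{n\ge0}V_{\mathbb C}^{\otimes n}$, with $V_{\mathbb C}=V\otimes\mathbb C$, be the free dg $*$-algebra on $V$ (with $v^*=v$ for $v\in V$), and let $$\mathfrak{CCR}(V,\tau)=T^\otimes_{\mathbb C}V/\mathcal I_{(V,\tau)},$$ where $\mathcal I_{(V,\tau)}$ is the two-sided dg $*$-ideal generated by the elements $v_1\otimes v_2-(-1)^{|v_1||v_2|}v_2\otimes v_1-i\,\tau(v_1,v_2)\mathbb 1$ for homogeneous $v_1,v_2\in V$. A weak equivalence of dg $*$-algebras is a morphism of dg $*$-algebras (a unital multiplicative chain map compatible with $*$) whose underlying chain map is a quasi-isomorphism.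 **Statement.** Let $(\Lambda^+,\Lambda^-)$ and $(\widetilde\Lambda^+,\widetilde\Lambda^-)$ be two compatible pairs of retarded/advanced trivializations, with corresponding unshifted Poisson structures $\tau$ and $\widetilde\tau$ on $\mathfrak L(M)$. Then $\mathfrak{CCR}(\mathfrak L(M),\tau)$ and $\mathfrak{CCR}(\mathfrak L(M),\widetilde\tau)$ are connected by a finite zig-zag of weak equivalences of dg $*$-algebras. -/

import Mathlib

open Bundle Manifold MeasureTheory
open scoped ContDiff

universe u v w w'

namespace LinGauge

section Geometry

variable {m : ℕ} {M : Type u} [TopologicalSpace M] [ChartedSpace (EuclideanSpace ℝ (Fin m)) M]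
  [IsManifold (𝓡 m) ∞ M]

/-- A fiber metric on a smooth real vector bundle: a smooth section of the bundle of bilinear
forms which is symmetric and nondegenerate (not necessarily definite) in every fiber. -/
structure FiberMetric {M : Type u} [TopologicalSpace M]
    [ChartedSpace (EuclideanSpace ℝ (Fin m)) M]
    (F : Type w) [NormedAddCommGroup F] [NormedSpace ℝ F]
    (V : M → Type v) [TopologicalSpace (TotalSpace F V)] [∀ x, TopologicalSpace (V x)]
    [∀ x, AddCommGroup (V x)] [∀ x, Module ℝ (V x)] [∀ x, IsTopologicalAddGroup (V x)]
    [∀ x, ContinuousSMul ℝ (V x)] [FiberBundle F V] [VectorBundle ℝ F V] where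
  form : ∀ x, V x →L[ℝ] V x →L[ℝ] ℝ
  symm : ∀ x a b, form x a b = form x b a
  nondeg : ∀ x a, (∀ b, form x a b = 0) → a = 0
  contMDiff : ContMDiff (𝓡 m) ((𝓡 m).prod 𝓘(ℝ, F →L[ℝ] F →L[ℝ] ℝ)) ∞
    (fun x ↦ TotalSpace.mk' (F →L[ℝ] F →L[ℝ] ℝ) x (form x))

variable (m M) in
/-- A time-oriented Lorentzian manifold of dimension `m`; the signature is `(+,-,…,-)` and
the time-orientation is the class of the future-pointing timelike vector field `time`. -/
structure Spacetime where
  metric : FiberMetric (m := m) (M := M) (EuclideanSpace ℝ (Fin m)) (fun x ↦ TangentSpace (𝓡 m) x)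
  lorentzian : ∀ x, ∃ a, 0 < metric.form x a a ∧
    ∀ b, metric.form x a b = 0 → b ≠ 0 → metric.form x b b < 0
  time : Cₛ^∞⟮𝓡 m; EuclideanSpace ℝ (Fin m), fun x : M ↦ TangentSpace (𝓡 m) x⟯
  time_timelike : ∀ x, 0 < metric.form x (time x) (time x)

namespace Spacetime

variable (S : Spacetime m M)

/-- Future-directed causal (timelike or lightlike, nonzero) tangent vectors. -/
def FutureCausal {x : M} (a : TangentSpace (𝓡 m) x) : Prop :=
  0 ≤ S.metric.form x a a ∧ 0 < S.metric.form x a (S.time x)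

/-- Future-directed timelike tangent vectors. -/
def FutureTimelike {x : M} (a : TangentSpace (𝓡 m) x) : Prop :=
  0 < S.metric.form x a a ∧ 0 < S.metric.form x a (S.time x)

/-- The velocity of the curve `γ`, restricted to `[a, b]`, at the time `t`. -/
noncomputable def velocity (m : ℕ) {M : Type u} [TopologicalSpace M]
    [ChartedSpace (EuclideanSpace ℝ (Fin m)) M] (γ : ℝ → M) (a b t : ℝ) :
    TangentSpace (𝓡 m) (γ t) :=
  mfderivWithin 𝓘(ℝ, ℝ) (𝓡 m) γ (Set.Icc a b) t (1 : ℝ)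

/-- `γ` restricts to a future-directed causal curve of class `C¹` on `[a, b]`. -/
def IsCausalOn (γ : ℝ → M) (a b : ℝ) : Prop :=
  ContMDiffOn 𝓘(ℝ, ℝ) (𝓡 m) 1 γ (Set.Icc a b) ∧
    ∀ t ∈ Set.Icc a b, S.FutureCausal (velocity m γ a b t)

/-- `γ` restricts to a future-directed timelike curve of class `C¹` on `[a, b]`. -/
def IsTimelikeOn (γ : ℝ → M) (a b : ℝ) : Prop :=
  ContMDiffOn 𝓘(ℝ, ℝ) (𝓡 m) 1 γ (Set.Icc a b) ∧
    ∀ t ∈ Set.Icc a b, S.FutureTimelike (velocity m γ a b t)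

/-- `x ≤ y`: there is a piecewise `C¹` future-directed causal curve from `x` to `y`, or `x = y`. -/
def CausalLE : M → M → Prop :=
  Relation.ReflTransGen fun x y ↦ ∃ (γ : ℝ → M) (a b : ℝ), a < b ∧
    S.IsCausalOn γ a b ∧ γ a = x ∧ γ b = y

/-- The causal future of a set. -/
def causalFuture (A : Set M) : Set M := {y | ∃ x ∈ A, S.CausalLE x y}

/-- The causal past of a set. -/
def causalPast (A : Set M) : Set M := {y | ∃ x ∈ A, S.CausalLE y x}

/-- An inextendible piecewise `C¹` timelike curve, parametrized by `ℝ` and future-directed: away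
from a locally finite set `B` of break points it is `C¹` with timelike velocity (one-sided at the
break points), and it has no endpoint. -/
def IsInextendibleTimelike (γ : ℝ → M) : Prop :=
  (∃ B : Set ℝ, (∀ a b, (B ∩ Set.Icc a b).Finite) ∧
    ∀ a b, a < b → B ∩ Set.Ioo a b = ∅ → S.IsTimelikeOn γ a b) ∧
  (∀ x, ¬ Filter.Tendsto γ Filter.atTop (nhds x)) ∧
  (∀ x, ¬ Filter.Tendsto γ Filter.atBot (nhds x))

/-- A Cauchy surface: a subset that is met exactly once by every inextendible timelike curve. -/
def IsCauchySurface (A : Set M) : Prop :=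
  ∀ γ : ℝ → M, S.IsInextendibleTimelike γ → ∃! t, γ t ∈ A

/-- A spacetime is globally hyperbolic if it admits a Cauchy surface. -/
def IsGloballyHyperbolic : Prop := ∃ A : Set M, S.IsCauchySurface A

/-- The density `√|det (g (∂ᵢ, ∂ⱼ))|` in the coordinates of the chart at `c`. -/
noncomputable def density (c x : M) : ℝ :=
  √|(Matrix.of fun i j : Fin m ↦ S.metric.form x
    ((trivializationAt (EuclideanSpace ℝ (Fin m)) (fun y : M ↦ TangentSpace (𝓡 m) y) c).localFrame
      (EuclideanSpace.basisFun (Fin m) ℝ).toBasis i x)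
    ((trivializationAt (EuclideanSpace ℝ (Fin m)) (fun y : M ↦ TangentSpace (𝓡 m) y) c).localFrame
      (EuclideanSpace.basisFun (Fin m) ℝ).toBasis j x)).det|


theorem density_continuousOn (c : M) :
    ContinuousOn (S.density c) (chartAt (EuclideanSpace ℝ (Fin m)) c).source := by
  unfold density
  refine (continuous_abs.comp_continuousOn ?_).sqrt
  refine (Continuous.matrix_det continuous_id).comp_continuousOn
    (continuousOn_pi.2 fun i ↦ continuousOn_pi.2 fun j ↦ ?_)
  have hfr (i : Fin m) := (trivializationAt (EuclideanSpace ℝ (Fin m))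
    (fun y : M ↦ TangentSpace (𝓡 m) y) c).contMDiffOn_localFrame_baseSet (I := 𝓡 m) (n := 0)
      (EuclideanSpace.basisFun (Fin m) ℝ).toBasis i
  rw [TangentBundle.trivializationAt_baseSet] at hfr
  have := ContMDiffOn.clm_bundle_apply₂ (IB := 𝓡 m) (IM := 𝓡 m)
    (F₁ := EuclideanSpace ℝ (Fin m)) (F₂ := EuclideanSpace ℝ (Fin m))
    (E₃ := Bundle.Trivial M ℝ) (F₃ := ℝ) (b := id)
    ((S.metric.contMDiff.of_le zero_le).contMDiffOn) (hfr i) (hfr j)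
  intro x hx
  have h2 := this x hx
  simp only [contMDiffWithinAt_totalSpace] at h2
  exact h2.2.continuousWithinAt

theorem density_pos {c x : M} (hx : x ∈ (chartAt (EuclideanSpace ℝ (Fin m)) c).source) :
    0 < S.density c x := by
  rw [← TangentBundle.trivializationAt_baseSet (I := 𝓡 m)] at hx
  unfold density
  refine Real.sqrt_pos.2 (abs_pos.2 fun h0 ↦ ?_)
  obtain ⟨v, hv, hv0⟩ := Matrix.exists_mulVec_eq_zero_iff.2 h0
  have hbas := fun i ↦ Trivialization.localFrame_apply_of_mem_baseSet
    (trivializationAt (EuclideanSpace ℝ (Fin m)) (fun y : M ↦ TangentSpace (𝓡 m) y) c)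
    (EuclideanSpace.basisFun (Fin m) ℝ).toBasis (i := i) hx
  simp only [hbas] at hv0
  set bs := (trivializationAt (EuclideanSpace ℝ (Fin m))
    (fun y : M ↦ TangentSpace (𝓡 m) y) c).basisAt
    (EuclideanSpace.basisFun (Fin m) ℝ).toBasis hx
  have hw : ∑ j, v j • bs j = 0 := by
    have key : ∀ i, S.metric.form x (bs i) (∑ j, v j • bs j) = 0 := by
      intro i
      have := congrFun hv0 i
      simp only [Matrix.mulVec, dotProduct, Matrix.of_apply, Pi.zero_apply] at this
      rw [map_sum, ← this]
      exact Finset.sum_congr rfl fun j _ ↦ by rw [map_smul, smul_eq_mul, mul_comm]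
    apply S.metric.nondeg x
    intro b
    rw [S.metric.symm]
    generalize ∑ j, v j • bs j = y at key
    rw [S.metric.symm]
    have : (S.metric.form x y).toLinearMap = 0 :=
      bs.ext fun i ↦ by simpa [S.metric.symm x y] using key i
    exact LinearMap.congr_fun this b
  exact hv (funext fun i ↦ Fintype.linearIndependent_iff.1 bs.linearIndependent v hw i)

variable [T2Space M] [SigmaCompactSpace M] [MeasurableSpace M] [BorelSpace M]

variable (m M) in
/-- A smooth partition of unity subordinate to the cover by chart domains. -/
noncomputable def chartPartition : SmoothPartitionOfUnity M (𝓡 m) M Set.univ :=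
  Classical.choose (SmoothPartitionOfUnity.exists_isSubordinate_chartAt_source (𝓡 m) M)

/-- The part `ρ_c √|det g| dx¹ ⋯ dxᵐ` of the volume measure supported in the chart at `c`. -/
noncomputable def volPart (c : M) : Measure M :=
  (Measure.map (chartAt (EuclideanSpace ℝ (Fin m)) c).symm
    ((volume : Measure (EuclideanSpace ℝ (Fin m))).restrict
      (chartAt (EuclideanSpace ℝ (Fin m)) c).target)).withDensity
    fun x ↦ ENNReal.ofReal (chartPartition m M c x * S.density c x)

/-- The volume measure of the metric, glued from the coordinate expressions `√|det g| dx¹ ⋯ dxᵐ`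
by a partition of unity (by the change of variables formula the result depends neither on the
charts nor on the partition). -/
noncomputable def vol : Measure M := Measure.sum S.volPart


theorem vol_finiteOnCompacts : IsFiniteMeasureOnCompacts S.vol := by
  refine ⟨fun K hK ↦ ?_⟩
  have hsub := Classical.choose_spec
    (SmoothPartitionOfUnity.exists_isSubordinate_chartAt_source (𝓡 m) M)
  change (chartPartition m M).IsSubordinate _ at hsub
  rw [vol, Measure.sum_apply _ hK.measurableSet]
  have hfin := (chartPartition m M).locallyFinite.finite_nonempty_inter_compact hK
  have hz : ∀ c ∉ hfin.toFinset, S.volPart c K = 0 := by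
    intro c hc
    rw [volPart, withDensity_apply _ hK.measurableSet]
    rw [setLIntegral_congr_fun (g := fun _ ↦ 0) hK.measurableSet, lintegral_zero]
    intro x hx
    have : chartPartition m M c x = 0 := by
      by_contra h
      exact hc (by simpa using ⟨x, h, hx⟩)
    simp [this]
  rw [tsum_eq_sum hz]
  refine (ENNReal.sum_lt_top).2 fun c _ ↦ ?_
  set φ := chartAt (EuclideanSpace ℝ (Fin m)) c
  set K' := K ∩ tsupport (chartPartition m M c)
  have hK' : IsCompact K' := hK.inter_right (isClosed_tsupport _)
  have hK's : K' ⊆ φ.source := fun x hx ↦ hsub c hx.2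
  have hcont : ContinuousOn (fun x ↦ chartPartition m M c x * S.density c x) K' :=
    (chartPartition m M c).2.continuous.continuousOn.mul ((S.density_continuousOn c).mono hK's)
  obtain ⟨C, hC⟩ := hK'.exists_bound_of_continuousOn hcont
  rw [volPart, withDensity_apply _ hK.measurableSet]
  calc _ ≤ ∫⁻ x in K, K'.indicator (fun _ ↦ ENNReal.ofReal C) x
        ∂(Measure.map φ.symm (volume.restrict φ.target)) := by
        refine setLIntegral_mono' hK.measurableSet fun x hx ↦ ?_
        by_cases hxK : x ∈ K'
        · rw [Set.indicator_of_mem hxK]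
          exact ENNReal.ofReal_le_ofReal ((le_abs_self _).trans (hC x hxK))
        · have : chartPartition m M c x = 0 := by
            by_contra h
            exact hxK ⟨hx, subset_tsupport _ h⟩
          simp [this]
    _ ≤ ∫⁻ x, K'.indicator (fun _ ↦ ENNReal.ofReal C) x
        ∂(Measure.map φ.symm (volume.restrict φ.target)) := setLIntegral_le_lintegral _ _
    _ = ENNReal.ofReal C * Measure.map φ.symm (volume.restrict φ.target) K' := by
        rw [lintegral_indicator_const hK'.measurableSet]
    _ < ⊤ := by
        refine ENNReal.mul_lt_top ENNReal.ofReal_lt_top ?_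
        rw [Measure.map_apply_of_aemeasurable
          (φ.continuousOn_symm.aemeasurable φ.open_target.measurableSet) hK'.measurableSet]
        refine lt_of_le_of_lt ?_ ((hK'.image_of_continuousOn (φ.continuousOn.mono hK's)).measure_lt_top
          (μ := (volume : Measure (EuclideanSpace ℝ (Fin m)))))
        rw [Measure.restrict_apply' φ.open_target.measurableSet]
        refine measure_mono fun y hy ↦ ⟨φ.symm y, hy.1, φ.right_inv hy.2⟩

theorem vol_openPos : Measure.IsOpenPosMeasure S.vol := by
  refine ⟨fun U hU ⟨x, hx⟩ h0 ↦ ?_⟩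
  obtain ⟨c, hc⟩ := (chartPartition m M).exists_pos_of_mem (Set.mem_univ x)
  have hsub := Classical.choose_spec
    (SmoothPartitionOfUnity.exists_isSubordinate_chartAt_source (𝓡 m) M)
  change (chartPartition m M).IsSubordinate _ at hsub
  set φ := chartAt (EuclideanSpace ℝ (Fin m)) c
  have hW : IsOpen (U ∩ (chartPartition m M c) ⁻¹' (Set.Ioi 0)) :=
    hU.inter (isOpen_Ioi.preimage (chartPartition m M c).2.continuous)
  set W := U ∩ (chartPartition m M c) ⁻¹' (Set.Ioi 0)
  have hWs : W ⊆ φ.source := fun y hy ↦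
    hsub c (subset_tsupport _ (Function.mem_support.2 (ne_of_gt hy.2)))
  have h1 : S.volPart c W = 0 := by
    refine le_antisymm ?_ zero_le
    calc S.volPart c W ≤ S.volPart c U := measure_mono Set.inter_subset_left
      _ ≤ S.vol U := by rw [vol]; exact Measure.le_sum _ c U
      _ = 0 := h0
  have hm : AEMeasurable φ.symm ((volume : Measure (EuclideanSpace ℝ (Fin m))).restrict φ.target) :=
    φ.continuousOn_symm.aemeasurable φ.open_target.measurableSet
  rw [volPart, withDensity_apply _ hW.measurableSet, lintegral_eq_zero_iff'] at h1
  · have h2 : Measure.map φ.symm (volume.restrict φ.target) W = 0 := by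
      rw [Filter.EventuallyEq, ae_restrict_iff' hW.measurableSet] at h1
      refine measure_mono_null (fun y hy ↦ ?_) h1
      simpa [hy] using mul_pos hy.2 (S.density_pos (hWs hy))
    rw [Measure.map_apply_of_aemeasurable hm hW.measurableSet,
      Measure.restrict_apply' φ.open_target.measurableSet, Set.inter_comm] at h2
    refine (φ.continuousOn_symm.isOpen_inter_preimage φ.open_target hW).measure_ne_zero volume
      ⟨φ x, φ.map_source (hWs ⟨hx, hc⟩), ?_⟩ h2
    rw [Set.mem_preimage, φ.left_inv (hWs ⟨hx, hc⟩)]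
    exact ⟨hx, hc⟩
  · refine ContinuousOn.aemeasurable (ENNReal.continuous_ofReal.comp_continuousOn ?_)
      hW.measurableSet
    exact (chartPartition m M c).2.continuous.continuousOn.mul
      ((S.density_continuousOn c).mono hWs)

end Spacetime

end Geometry

section Operators

variable {m : ℕ} {M : Type u} [TopologicalSpace M] [ChartedSpace (EuclideanSpace ℝ (Fin m)) M]
  {F : Type w} [NormedAddCommGroup F] [NormedSpace ℝ F]
  {V : M → Type v} [TopologicalSpace (TotalSpace F V)] [∀ x, TopologicalSpace (V x)]
  [∀ x, AddCommGroup (V x)] [∀ x, Module ℝ (V x)]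
  [FiberBundle F V] [VectorBundle ℝ F V]
  {F' : Type w'} [NormedAddCommGroup F'] [NormedSpace ℝ F']
  {V' : M → Type v} [TopologicalSpace (TotalSpace F' V')] [∀ x, TopologicalSpace (V' x)]
  [∀ x, AddCommGroup (V' x)] [∀ x, Module ℝ (V' x)]
  [FiberBundle F' V'] [VectorBundle ℝ F' V']

/-- The support of a section. -/
def supp (s : Cₛ^∞⟮𝓡 m; F, V⟯) : Set M := closure {x | s x ≠ 0}

/-- Multiplication of sections by a smooth function. -/
noncomputable def funMul (f : C^∞⟮𝓡 m, M; 𝓘(ℝ, ℝ), ℝ⟯) : Cₛ^∞⟮𝓡 m; F, V⟯ →ₗ[ℝ] Cₛ^∞⟮𝓡 m; F, V⟯ where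
  toFun s := ⟨fun x ↦ f x • s x, f.contMDiff.smul_section s.contMDiff⟩
  map_add' s t := by ext x; exact smul_add _ _ _
  map_smul' c s := by ext x; exact smul_comm _ _ _

/-- The commutator `[P, f]` of an operator on sections with multiplication by `f`. -/
noncomputable def commutator (P : Cₛ^∞⟮𝓡 m; F, V⟯ →ₗ[ℝ] Cₛ^∞⟮𝓡 m; F', V'⟯)
    (f : C^∞⟮𝓡 m, M; 𝓘(ℝ, ℝ), ℝ⟯) : Cₛ^∞⟮𝓡 m; F, V⟯ →ₗ[ℝ] Cₛ^∞⟮𝓡 m; F', V'⟯ :=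
  P ∘ₗ funMul f - funMul f ∘ₗ P

/-- Linear differential operators of order `≤ k`, in the algebraic (Grothendieck) form: all
`(k+1)`-fold commutators `[…[[P, f₀], f₁], …, f_k]` with smooth functions vanish. On smooth sections
of finite-rank bundles these are the operators `∑_{|α| ≤ k} A_α ∂^α` in local coordinates. -/
def IsDiffOpOfOrder : ℕ → (Cₛ^∞⟮𝓡 m; F, V⟯ →ₗ[ℝ] Cₛ^∞⟮𝓡 m; F', V'⟯) → Prop
  | 0, P => ∀ f, commutator P f = 0
  | k + 1, P => ∀ f, IsDiffOpOfOrder k (commutator P f)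

/-- Linear differential operators between sections of vector bundles. -/
def IsDiffOp (P : Cₛ^∞⟮𝓡 m; F, V⟯ →ₗ[ℝ] Cₛ^∞⟮𝓡 m; F', V'⟯) : Prop := ∃ k, IsDiffOpOfOrder k P

theorem IsDiffOpOfOrder.apply_eq_zero [IsManifold (𝓡 m) ∞ M] [T2Space M] [SigmaCompactSpace M]
    (k : ℕ) (P : Cₛ^∞⟮𝓡 m; F, V⟯ →ₗ[ℝ] Cₛ^∞⟮𝓡 m; F', V'⟯) (hP : IsDiffOpOfOrder k P)
    (s : Cₛ^∞⟮𝓡 m; F, V⟯) {x : M} (hx : x ∉ supp s) : P s x = 0 := by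
  obtain ⟨f, hf0, hf1, -⟩ := exists_contMDiffMap_zero_one_of_isClosed (n := ⊤) (𝓡 m)
    (isClosed_closure : IsClosed (supp s)) (isClosed_singleton (x := x))
    (Set.disjoint_singleton_right.2 hx)
  have hfs : funMul f s = 0 := by
    ext y
    by_cases hy : s y = 0
    · change f y • s y = 0
      rw [hy, smul_zero]
    · change f y • s y = 0
      rw [hf0 (subset_closure hy), Pi.zero_apply, zero_smul]
  have hc : commutator P f s x = - P s x := by
    change (P (funMul f s) - funMul f (P s)) x = _
    rw [hfs, map_zero, zero_sub, ContMDiffSection.coe_neg, Pi.neg_apply]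
    change -(f x • P s x) = _
    rw [hf1 rfl, Pi.one_apply, one_smul]
  suffices commutator P f s x = 0 by rwa [hc, neg_eq_zero] at this
  cases k with
  | zero => rw [hP f]; rfl
  | succ k => exact IsDiffOpOfOrder.apply_eq_zero k _ (hP f) s hx

theorem IsDiffOp.supp_subset [IsManifold (𝓡 m) ∞ M] [T2Space M] [SigmaCompactSpace M]
    {P : Cₛ^∞⟮𝓡 m; F, V⟯ →ₗ[ℝ] Cₛ^∞⟮𝓡 m; F', V'⟯} (hP : IsDiffOp P)
    (s : Cₛ^∞⟮𝓡 m; F, V⟯) : supp (P s) ⊆ supp s := by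
  obtain ⟨k, hk⟩ := hP
  refine closure_minimal (fun x hx ↦ ?_) isClosed_closure
  by_contra h
  exact hx (hk.apply_eq_zero k P s h)

theorem supp_add (s t : Cₛ^∞⟮𝓡 m; F, V⟯) : supp (s + t) ⊆ supp s ∪ supp t := by
  refine closure_minimal (fun x hx ↦ ?_) (isClosed_closure.union isClosed_closure)
  by_contra h
  rw [Set.mem_union, not_or] at h
  have h1 : s x = 0 := by by_contra h'; exact h.1 (subset_closure h')
  have h2 : t x = 0 := by by_contra h'; exact h.2 (subset_closure h')
  apply hx
  rw [ContMDiffSection.coe_add, Pi.add_apply, h1, h2, add_zero]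

theorem supp_smul (c : ℝ) (s : Cₛ^∞⟮𝓡 m; F, V⟯) : supp (c • s) ⊆ supp s := by
  refine closure_mono fun x hx h ↦ hx ?_
  rw [ContMDiffSection.coe_smul, Pi.smul_apply, h, smul_zero]

theorem supp_zero : supp (0 : Cₛ^∞⟮𝓡 m; F, V⟯) = ∅ := by
  simp [supp]

variable (F V) in
/-- Sections with compact support. -/
def secC : Submodule ℝ Cₛ^∞⟮𝓡 m; F, V⟯ where
  carrier := {s | IsCompact (supp s)}
  zero_mem' := by
    change IsCompact _
    rw [supp_zero]
    exact isCompact_empty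
  add_mem' hs ht := (hs.union ht).of_isClosed_subset isClosed_closure (supp_add _ _)
  smul_mem' c _ hs := hs.of_isClosed_subset isClosed_closure (supp_smul c _)

variable [IsManifold (𝓡 m) ∞ M] (S : Spacetime m M)

/-- The three support conditions: compact, past compact, future compact. -/
inductive SuppKind | c | pc | fc

variable (F V) in
/-- The vector space of sections with compact, past compact or future compact support. A section
is past/future compact if its support lies in `J^±(A)` for a Cauchy surface `A`. On a globally
hyperbolic spacetime these sections form a vector space that contains the compactly supported
sections; it is given here as the subspace which they and the compactly supported ones span. -/
noncomputable def sec : SuppKind → Submodule ℝ Cₛ^∞⟮𝓡 m; F, V⟯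
  | .c => secC F V
  | .pc => secC F V ⊔
      Submodule.span ℝ {s | ∃ A, S.IsCauchySurface A ∧ supp s ⊆ S.causalFuture A}
  | .fc => secC F V ⊔
      Submodule.span ℝ {s | ∃ A, S.IsCauchySurface A ∧ supp s ⊆ S.causalPast A}

theorem secC_le_sec (k : SuppKind) : secC F V ≤ sec F V S k := by
  cases k
  exacts [le_rfl, le_sup_left, le_sup_left]

variable [T2Space M] [SigmaCompactSpace M]

theorem IsDiffOp.mem_secC {P : Cₛ^∞⟮𝓡 m; F, V⟯ →ₗ[ℝ] Cₛ^∞⟮𝓡 m; F', V'⟯} (hP : IsDiffOp P)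
    {s : Cₛ^∞⟮𝓡 m; F, V⟯} (hs : s ∈ secC F V) : P s ∈ secC F' V' :=
  IsCompact.of_isClosed_subset hs isClosed_closure (hP.supp_subset s)

theorem IsDiffOp.mem_sec {P : Cₛ^∞⟮𝓡 m; F, V⟯ →ₗ[ℝ] Cₛ^∞⟮𝓡 m; F', V'⟯} (hP : IsDiffOp P)
    {k : SuppKind} : ∀ s ∈ sec F V S k, P s ∈ sec F' V' S k := by
  suffices sec F V S k ≤ (sec F' V' S k).comap P from this
  cases k
  · exact fun s hs ↦ hP.mem_secC hs
  · refine sup_le (fun s hs ↦ Submodule.mem_sup_left (hP.mem_secC hs))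
      (Submodule.span_le.2 ?_)
    rintro s ⟨A, hA, hs⟩
    exact Submodule.mem_sup_right
      (Submodule.subset_span ⟨A, hA, (hP.supp_subset s).trans hs⟩)
  · refine sup_le (fun s hs ↦ Submodule.mem_sup_left (hP.mem_secC hs))
      (Submodule.span_le.2 ?_)
    rintro s ⟨A, hA, hs⟩
    exact Submodule.mem_sup_right
      (Submodule.subset_span ⟨A, hA, (hP.supp_subset s).trans hs⟩)


section Pairing

set_option linter.unusedSectionVars false

variable [∀ x, IsTopologicalAddGroup (V x)] [∀ x, ContinuousSMul ℝ (V x)]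
  [∀ x, IsTopologicalAddGroup (V' x)] [∀ x, ContinuousSMul ℝ (V' x)]
  [MeasurableSpace M] [BorelSpace M]
  (h : FiberMetric (m := m) F V) (h' : FiberMetric (m := m) F' V')

theorem FiberMetric.contMDiffOn_form {U : Set M} {s t : ∀ x, V x}
    (hs : ContMDiffOn (𝓡 m) ((𝓡 m).prod 𝓘(ℝ, F)) ∞ (fun x ↦ TotalSpace.mk' F x (s x)) U)
    (ht : ContMDiffOn (𝓡 m) ((𝓡 m).prod 𝓘(ℝ, F)) ∞ (fun x ↦ TotalSpace.mk' F x (t x)) U) :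
    ContMDiffOn (𝓡 m) 𝓘(ℝ, ℝ) ∞ (fun x ↦ h.form x (s x) (t x)) U := by
  have := ContMDiffOn.clm_bundle_apply₂ (IB := 𝓡 m) (IM := 𝓡 m) (F₁ := F) (F₂ := F)
    (E₃ := Bundle.Trivial M ℝ) (F₃ := ℝ) (b := id) h.contMDiff.contMDiffOn hs ht
  intro x hx
  have h2 := this x hx
  simp only [contMDiffWithinAt_totalSpace] at h2
  exact h2.2

theorem FiberMetric.continuous_form (s t : Cₛ^∞⟮𝓡 m; F, V⟯) :
    Continuous fun x ↦ h.form x (s x) (t x) := by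
  have := h.contMDiffOn_form (U := Set.univ) s.contMDiff.contMDiffOn t.contMDiff.contMDiffOn
  exact (contMDiffOn_univ.1 this).continuous

/-- The integration pairing `⟨s, t⟩ = ∫ h(s, t) vol`. -/
noncomputable def pairing (s t : Cₛ^∞⟮𝓡 m; F, V⟯) : ℝ := ∫ x, h.form x (s x) (t x) ∂S.vol

/-- `Q'` is the formal adjoint `Q^*` of `Q`: the differential operator determined by
`⟨t, Q s⟩ = ⟨Q' t, s⟩` for all `s`, `t` with compactly overlapping supports. -/
def IsFormalAdjoint (Q : Cₛ^∞⟮𝓡 m; F, V⟯ →ₗ[ℝ] Cₛ^∞⟮𝓡 m; F', V'⟯)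
    (Q' : Cₛ^∞⟮𝓡 m; F', V'⟯ →ₗ[ℝ] Cₛ^∞⟮𝓡 m; F, V⟯) : Prop :=
  IsDiffOp Q' ∧ ∀ (s : Cₛ^∞⟮𝓡 m; F, V⟯) (t : Cₛ^∞⟮𝓡 m; F', V'⟯),
    IsCompact (supp t ∩ supp s) → pairing S h' t (Q s) = pairing S h (Q' t) s

theorem integrable_form {s : Cₛ^∞⟮𝓡 m; F, V⟯} (hs : s ∈ secC F V) (t : Cₛ^∞⟮𝓡 m; F, V⟯) :
    Integrable (fun x ↦ h.form x (s x) (t x)) S.vol := by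
  have := S.vol_finiteOnCompacts
  refine (h.continuous_form s t).integrable_of_hasCompactSupport ?_
  refine IsCompact.of_isClosed_subset hs (isClosed_tsupport _) (closure_mono fun x hx hx0 ↦ hx ?_)
  simp [hx0]

/-- The integration pairing of compactly supported sections with arbitrary ones. -/
noncomputable def pairingC : secC (m := m) F V →ₗ[ℝ] Cₛ^∞⟮𝓡 m; F, V⟯ →ₗ[ℝ] ℝ :=
  LinearMap.mk₂ ℝ (fun s t ↦ pairing S h s t)
    (fun s s' t ↦ by
      simpa [pairing] using integral_add (integrable_form S h s.2 t) (integrable_form S h s'.2 t))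
    (fun c s t ↦ by simp [pairing, integral_const_mul])
    (fun s t t' ↦ by
      simpa [pairing] using integral_add (integrable_form S h s.2 t) (integrable_form S h s.2 t'))
    (fun c s t ↦ by simp [pairing, integral_const_mul])

theorem pairing_comm (s t : Cₛ^∞⟮𝓡 m; F, V⟯) : pairing S h s t = pairing S h t s := by
  simp only [pairing, h.symm _ (s _)]

variable [FiniteDimensional ℝ F] [ContMDiffVectorBundle ∞ F V (𝓡 m)]

theorem eq_zero_of_pairing (u : Cₛ^∞⟮𝓡 m; F, V⟯)
    (hu : ∀ t ∈ secC F V, pairing S h u t = 0) : u = 0 := by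
  have := S.vol_finiteOnCompacts
  have := S.vol_openPos
  ext x
  by_contra hx
  set e := trivializationAt F V x
  have hxe : x ∈ e.baseSet := FiberBundle.mem_baseSet_trivializationAt' x
  set bs := Module.finBasis ℝ F
  obtain ⟨i, hi⟩ : ∃ i, h.form x (u x) (e.localFrame bs i x) ≠ 0 := by
    by_contra! hcon
    refine hx (h.nondeg x _ fun b ↦ ?_)
    have : (h.form x (u x)).toLinearMap = 0 :=
      (e.basisAt bs hxe).ext fun i ↦ by
        simpa [e.localFrame_apply_of_mem_baseSet bs hxe] using hcon i
    exact LinearMap.congr_fun this b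
  have hfr := e.contMDiffOn_localFrame_baseSet (I := 𝓡 m) ∞ bs i
  have hg := h.contMDiffOn_form u.contMDiff.contMDiffOn hfr
  obtain ⟨ψ, -, hψ⟩ := (SmoothBumpFunction.nhds_basis_tsupport (I := 𝓡 m) x).mem_iff.1
    (e.open_baseSet.mem_nhds hxe)
  set g : M → ℝ := fun y ↦ ψ y * h.form y (u y) (e.localFrame bs i y)
  have hsub : tsupport g ⊆ tsupport ψ := closure_mono (Function.support_mul_subset_left _ _)
  have hgs : ContMDiffOn (𝓡 m) 𝓘(ℝ, ℝ) ∞ g e.baseSet := ψ.contMDiff.contMDiffOn.mul hg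
  let t : Cₛ^∞⟮𝓡 m; F, V⟯ := ⟨g • e.localFrame bs i,
    hgs.smul_section_of_tsupport e.open_baseSet (hsub.trans hψ) hfr⟩
  have htc : t ∈ secC F V := by
    refine ψ.hasCompactSupport.of_isClosed_subset isClosed_closure
      (closure_minimal (fun y hy ↦ hsub (subset_closure fun h0 ↦ hy ?_)) (isClosed_tsupport _))
    change g y • e.localFrame bs i y = 0
    rw [h0, zero_smul]
  have h0 := hu t htc
  have hval : ∀ y, h.form y (u y) (t y) = ψ y * h.form y (u y) (e.localFrame bs i y) ^ 2 := by
    intro y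
    change h.form y (u y) (g y • e.localFrame bs i y) = _
    rw [map_smul, smul_eq_mul]
    ring
  refine ne_of_gt ?_ h0
  refine (h.continuous_form u t).integral_pos_of_hasCompactSupport_nonneg_nonzero (x := x)
    ?_ (fun y ↦ ?_) ?_
  · refine IsCompact.of_isClosed_subset htc (isClosed_tsupport _)
      (closure_mono fun y hy hy0 ↦ hy ?_)
    simp [hy0]
  · rw [hval]
    exact mul_nonneg ψ.nonneg (sq_nonneg _)
  · rw [hval, ψ.eq_one, one_mul]
    exact pow_ne_zero 2 hi

end Pairing
end Operators

section FourTerm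

open CategoryTheory

/-- The positions in a four-term complex `d ⟵ c ⟵ b ⟵ a`; `z` stands for all other degrees. -/
inductive Slot | a | b | c | d | z

/-- The position with distance `n` from the leftmost position `a`. -/
def slot (n : ℤ) : Slot :=
  if n = 0 then .a else if n = 1 then .b else if n = 2 then .c else if n = 3 then .d else .z

variable {A B C D : Type v} [AddCommGroup A] [Module ℝ A] [AddCommGroup B] [Module ℝ B]
  [AddCommGroup C] [Module ℝ C] [AddCommGroup D] [Module ℝ D]

variable (A B C D) in
def slotX : Slot → ModuleCat.{v} ℝ
  | .a => ModuleCat.of ℝ A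
  | .b => ModuleCat.of ℝ B
  | .c => ModuleCat.of ℝ C
  | .d => ModuleCat.of ℝ D
  | .z => ModuleCat.of ℝ PUnit

def slotD (f : A →ₗ[ℝ] B) (g : B →ₗ[ℝ] C) (h : C →ₗ[ℝ] D) :
    ∀ i j, slotX A B C D i ⟶ slotX A B C D j
  | .a, .b => ModuleCat.ofHom f
  | .b, .c => ModuleCat.ofHom g
  | .c, .d => ModuleCat.ofHom h
  | _, _ => 0

/-- The four-term chain complex `D ⟵ C ⟵ B ⟵ A` with differentials `h`, `g`, `f`, where `A` sits in
degree `top` (and `D` in degree `top - 3`). -/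
def fourTerm (top : ℤ) (f : A →ₗ[ℝ] B) (g : B →ₗ[ℝ] C) (h : C →ₗ[ℝ] D)
    (hfg : ∀ x, g (f x) = 0) (hgh : ∀ x, h (g x) = 0) : ChainComplex (ModuleCat.{v} ℝ) ℤ where
  X i := slotX A B C D (slot (top - i))
  d i j := slotD f g h (slot (top - i)) (slot (top - j))
  shape i j hij := by
    have hne : j + 1 ≠ i := hij
    have key : ∀ p q : Slot, ¬ (p = .a ∧ q = .b) → ¬ (p = .b ∧ q = .c) → ¬ (p = .c ∧ q = .d) →
        slotD f g h p q = 0 := by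
      intro p q h1 h2 h3
      cases p <;> cases q <;> first | rfl | simp at h1 h2 h3
    refine key _ _ ?_ ?_ ?_ <;> rintro ⟨hi, hj⟩ <;> unfold slot at hi hj <;>
      split_ifs at hi hj <;> omega
  d_comp_d' i j k _ _ := by
    generalize slot (top - i) = p
    generalize slot (top - j) = q
    generalize slot (top - k) = r
    cases p <;> cases q <;> cases r <;>
      first
        | exact Limits.zero_comp
        | exact Limits.comp_zero
        | exact ModuleCat.hom_ext (LinearMap.ext hfg)
        | exact ModuleCat.hom_ext (LinearMap.ext hgh)

end FourTerm

section Theory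

set_option linter.unusedSectionVars false

open CategoryTheory

variable {m : ℕ} {M : Type u} [TopologicalSpace M] [ChartedSpace (EuclideanSpace ℝ (Fin m)) M]
  [IsManifold (𝓡 m) ∞ M] [T2Space M] [SigmaCompactSpace M] [MeasurableSpace M] [BorelSpace M]
  {F₀ : Type w} [NormedAddCommGroup F₀] [NormedSpace ℝ F₀] [FiniteDimensional ℝ F₀]
  {V₀ : M → Type v} [TopologicalSpace (TotalSpace F₀ V₀)] [∀ x, TopologicalSpace (V₀ x)]
  [∀ x, AddCommGroup (V₀ x)] [∀ x, Module ℝ (V₀ x)] [∀ x, IsTopologicalAddGroup (V₀ x)]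
  [∀ x, ContinuousSMul ℝ (V₀ x)] [FiberBundle F₀ V₀] [VectorBundle ℝ F₀ V₀]
  [ContMDiffVectorBundle ∞ F₀ V₀ (𝓡 m)]
  {F₁ : Type w'} [NormedAddCommGroup F₁] [NormedSpace ℝ F₁] [FiniteDimensional ℝ F₁]
  {V₁ : M → Type v} [TopologicalSpace (TotalSpace F₁ V₁)] [∀ x, TopologicalSpace (V₁ x)]
  [∀ x, AddCommGroup (V₁ x)] [∀ x, Module ℝ (V₁ x)] [∀ x, IsTopologicalAddGroup (V₁ x)]
  [∀ x, ContinuousSMul ℝ (V₁ x)] [FiberBundle F₁ V₁] [VectorBundle ℝ F₁ V₁]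
  [ContMDiffVectorBundle ∞ F₁ V₁ (𝓡 m)]

/-- The inclusions of compactly supported sections, position by position. -/
noncomputable def inclSlot (S : Spacetime m M) (k : SuppKind) : ∀ i,
    slotX (sec F₁ V₁ S .c) (sec F₀ V₀ S .c) (sec F₀ V₀ S .c) (sec F₁ V₁ S .c) i →ₗ[ℝ]
      slotX (sec F₁ V₁ S k) (sec F₀ V₀ S k) (sec F₀ V₀ S k) (sec F₁ V₁ S k) i
  | .a => Submodule.inclusion (secC_le_sec S k)
  | .b => Submodule.inclusion (secC_le_sec S k)
  | .c => Submodule.inclusion (secC_le_sec S k)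
  | .d => Submodule.inclusion (secC_le_sec S k)
  | .z => 0

/-- The vertical maps `-ι, -ι, ι, ι` of the chain map `j`, position by position. -/
noncomputable def jSlot (S : Spacetime m M) (k : SuppKind) : ∀ i i',
    slotX (sec F₁ V₁ S k) (sec F₀ V₀ S k) (sec F₀ V₀ S k) (sec F₁ V₁ S k) i →ₗ[ℝ]
      slotX Cₛ^∞⟮𝓡 m; F₁, V₁⟯ Cₛ^∞⟮𝓡 m; F₀, V₀⟯ Cₛ^∞⟮𝓡 m; F₀, V₀⟯ Cₛ^∞⟮𝓡 m; F₁, V₁⟯ i'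
  | .a, .a => -(sec F₁ V₁ S k).subtype
  | .b, .b => -(sec F₀ V₀ S k).subtype
  | .c, .c => (sec F₀ V₀ S k).subtype
  | .d, .d => (sec F₁ V₁ S k).subtype
  | _, _ => 0

/-- The integration pairings of linear observables with solutions, position by position. -/
noncomputable def evalSlot (S : Spacetime m M) (h₀ : FiberMetric (m := m) F₀ V₀)
    (h₁ : FiberMetric (m := m) F₁ V₁) : ∀ i i',
    slotX (sec F₁ V₁ S .c) (sec F₀ V₀ S .c) (sec F₀ V₀ S .c) (sec F₁ V₁ S .c) i →ₗ[ℝ]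
      slotX Cₛ^∞⟮𝓡 m; F₁, V₁⟯ Cₛ^∞⟮𝓡 m; F₀, V₀⟯ Cₛ^∞⟮𝓡 m; F₀, V₀⟯ Cₛ^∞⟮𝓡 m; F₁, V₁⟯ i' →ₗ[ℝ] ℝ
  | .a, .d => pairingC S h₁
  | .b, .c => pairingC S h₀
  | .c, .b => pairingC S h₀
  | .d, .a => pairingC S h₁
  | _, _ => 0

/-- A linear gauge theory: a field complex `Q : Γ(F₁) → Γ(F₀)` (in degrees `1` and `0`) and a
formally self-adjoint equation of motion operator `P` on `Γ(F₀)` with `P Q = 0`; `Qs` is the formal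
adjoint `Q^*`. -/
structure GaugeTheory (S : Spacetime m M) (h₀ : FiberMetric (m := m) F₀ V₀)
    (h₁ : FiberMetric (m := m) F₁ V₁) where
  Q : Cₛ^∞⟮𝓡 m; F₁, V₁⟯ →ₗ[ℝ] Cₛ^∞⟮𝓡 m; F₀, V₀⟯
  Qs : Cₛ^∞⟮𝓡 m; F₀, V₀⟯ →ₗ[ℝ] Cₛ^∞⟮𝓡 m; F₁, V₁⟯
  P : Cₛ^∞⟮𝓡 m; F₀, V₀⟯ →ₗ[ℝ] Cₛ^∞⟮𝓡 m; F₀, V₀⟯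
  isDiffOp_Q : IsDiffOp Q
  isDiffOp_P : IsDiffOp P
  adjoint_Q : IsFormalAdjoint S h₁ h₀ Q Qs
  adjoint_P : IsFormalAdjoint S h₀ h₀ P P
  P_Q : ∀ s, P (Q s) = 0

namespace GaugeTheory

variable {S : Spacetime m M} {h₀ : FiberMetric (m := m) F₀ V₀} {h₁ : FiberMetric (m := m) F₁ V₁}
  (T : GaugeTheory S h₀ h₁)

theorem Qs_P (s : Cₛ^∞⟮𝓡 m; F₀, V₀⟯) : T.Qs (T.P s) = 0 := by
  refine eq_zero_of_pairing S h₁ _ fun t ht ↦ ?_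
  have hc : ∀ A : Set M, IsClosed A → IsCompact (A ∩ supp t) := fun A hA ↦ ht.inter_left hA
  rw [← T.adjoint_Q.2 t (T.P s) (hc _ isClosed_closure), ← T.adjoint_P.2 (T.Q t) s, T.P_Q]
  · simp [pairing]
  · exact (hc _ isClosed_closure).of_isClosed_subset (isClosed_closure.inter isClosed_closure)
      (Set.inter_subset_inter_right _ (T.isDiffOp_Q.supp_subset t))

/-- The solution complex `Γ(F₁) ⟵ Γ(F₀) ⟵ Γ(F₀) ⟵ Γ(F₁)` in degrees `-2, …, 1`, with
differentials `Q^*`, `P`, `Q`. -/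
noncomputable def sol : ChainComplex (ModuleCat.{max u v} ℝ) ℤ :=
  fourTerm 1 T.Q T.P T.Qs T.P_Q T.Qs_P

/-- The complex `Γ_k(F₁) ⟵ Γ_k(F₀) ⟵ Γ_k(F₀) ⟵ Γ_k(F₁)` in degrees `-1, …, 2`, with differentials
`-Q^*`, `P`, `-Q`, of sections with compact (`k = .c`), past compact (`k = .pc`) or future compact
(`k = .fc`) support. -/
noncomputable def obs (k : SuppKind) : ChainComplex (ModuleCat.{max u v} ℝ) ℤ :=
  fourTerm 2 (-T.Q.restrict (T.isDiffOp_Q.mem_sec S (k := k)))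
    (T.P.restrict (T.isDiffOp_P.mem_sec S))
    (-T.Qs.restrict (T.adjoint_Q.1.mem_sec S))
    (fun s ↦ Subtype.ext <| by
      change T.P (-T.Q s.1) = 0
      rw [map_neg, T.P_Q, neg_zero])
    (fun s ↦ Subtype.ext <| by
      change -T.Qs (T.P s.1) = 0
      rw [T.Qs_P, neg_zero])

/-- The complex of linear observables `𝔏(M)`. -/
noncomputable abbrev linObs : ChainComplex (ModuleCat.{max u v} ℝ) ℤ := T.obs .c

/-- The components of the inclusion `ι : 𝔏(M) → 𝔏_{pc/fc}(M)`. -/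
noncomputable def incl (k : SuppKind) (n : ℤ) : T.linObs.X n →ₗ[ℝ] (T.obs k).X n :=
  inclSlot S k (slot (2 - n))

/-- The components of `j_k : 𝔏_k(M) → 𝔖𝔬𝔩(M)[1]`; the component in degree `n` goes to
`𝔖𝔬𝔩(M)[1]_n = 𝔖𝔬𝔩(M)_{n-1}`, and `T.j k n n'` is zero for `n' ≠ n - 1`. -/
noncomputable def j (k : SuppKind) (n n' : ℤ) : (T.obs k).X n →ₗ[ℝ] T.sol.X n' :=
  jSlot S k (slot (2 - n)) (slot (1 - n'))

/-- A retarded trivialization: a contracting homotopy of `𝔏_pc(M)`. -/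
abbrev RetardedTrivialization := Homotopy (𝟙 (T.obs .pc)) 0

/-- An advanced trivialization: a contracting homotopy of `𝔏_fc(M)`. -/
abbrev AdvancedTrivialization := Homotopy (𝟙 (T.obs .fc)) 0

variable {T}

/-- The components `Λ : 𝔏(M)_n → 𝔖𝔬𝔩(M)_n` of `Λ = j_pc Λ⁺ ι - j_fc Λ⁻ ι`, where
`𝔖𝔬𝔩(M)[1]_{n+1} = 𝔖𝔬𝔩(M)_n`. -/
noncomputable def propagator (Λp : T.RetardedTrivialization) (Λm : T.AdvancedTrivialization)
    (n : ℤ) : T.linObs.X n →ₗ[ℝ] T.sol.X n :=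
  T.j .pc (n + 1) n ∘ₗ (Λp.hom n (n + 1)).hom ∘ₗ T.incl .pc n -
    T.j .fc (n + 1) n ∘ₗ (Λm.hom n (n + 1)).hom ∘ₗ T.incl .fc n

variable (T)

/-- The evaluation `⟨·,·⟩ : 𝔏(M) ⊗ 𝔖𝔬𝔩(M) → ℝ` given by the integration pairings of `𝔏(M)_p` with
`𝔖𝔬𝔩(M)_{-p}`; `T.eval p q` is zero for `p + q ≠ 0`. -/
noncomputable def eval (p q : ℤ) : T.linObs.X p →ₗ[ℝ] T.sol.X q →ₗ[ℝ] ℝ :=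
  evalSlot S h₀ h₁ (slot (2 - p)) (slot (1 - q))

/-- The evaluation `⟨·,·⟩ : 𝔖𝔬𝔩(M) ⊗ 𝔏(M) → ℝ`, obtained from `eval` by the symmetric braiding of
chain complexes (this Koszul sign makes it a chain map). -/
noncomputable def eval' (p q : ℤ) : T.sol.X p →ₗ[ℝ] T.linObs.X q →ₗ[ℝ] ℝ :=
  ((-1 : ℝ) ^ (p * q)) • (T.eval q p).flip

variable {T}

/-- The unshifted Poisson structure `τ(a, b) = ⟨a, Λ b⟩`. -/
noncomputable def poisson (Λp : T.RetardedTrivialization) (Λm : T.AdvancedTrivialization)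
    (p q : ℤ) : T.linObs.X p →ₗ[ℝ] T.linObs.X q →ₗ[ℝ] ℝ :=
  (T.eval p q).compl₂ (propagator Λp Λm q)

/-- A pair of retarded/advanced trivializations is compatible if `Λ` is formally skew-adjoint:
`⟨a, Λ b⟩ = -⟨Λ a, b⟩`. -/
def Compatible (Λp : T.RetardedTrivialization) (Λm : T.AdvancedTrivialization) : Prop :=
  ∀ (p q : ℤ) (a : T.linObs.X p) (b : T.linObs.X q),
    T.eval p q a (propagator Λp Λm q b) = -T.eval' p q (propagator Λp Λm p a) b

end GaugeTheory
end Theory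


section Algebra

open CategoryTheory TensorProduct

/-- A differential graded unital associative `*`-algebra over `ℂ` (homologically graded). The
involution satisfies `(a b)^* = (-1)^{|a||b|} b^* a^*`. -/
structure DGStarAlg where
  cx : ChainComplex (ModuleCat.{v} ℂ) ℤ
  one : cx.X 0
  mul : ∀ p q r : ℤ, p + q = r → (cx.X p →ₗ[ℂ] cx.X q →ₗ[ℂ] cx.X r)
  star : ∀ p : ℤ, cx.X p →ₛₗ[starRingEnd ℂ] cx.X p
  one_mul : ∀ (p : ℤ) (a : cx.X p), mul 0 p p (zero_add p) one a = a
  mul_one : ∀ (p : ℤ) (a : cx.X p), mul p 0 p (add_zero p) a one = a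
  mul_assoc : ∀ (p q r s t n : ℤ) (h₁ : p + q = s) (h₂ : s + r = n) (h₃ : q + r = t)
    (h₄ : p + t = n) (a : cx.X p) (b : cx.X q) (c : cx.X r),
    mul s r n h₂ (mul p q s h₁ a b) c = mul p t n h₄ a (mul q r t h₃ b c)
  leibniz : ∀ (p q n : ℤ) (h : p + q = n) (a : cx.X p) (b : cx.X q),
    cx.d n (n - 1) (mul p q n h a b) =
      mul (p - 1) q (n - 1) (by omega) (cx.d p (p - 1) a) b +
        ((-1 : ℂ) ^ p) • mul p (q - 1) (n - 1) (by omega) a (cx.d q (q - 1) b)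
  star_star : ∀ (p : ℤ) (a : cx.X p), star p (star p a) = a
  star_mul : ∀ (p q n : ℤ) (h : p + q = n) (a : cx.X p) (b : cx.X q),
    star n (mul p q n h a b) =
      ((-1 : ℂ) ^ (p * q)) • mul q p n (by omega) (star q b) (star p a)
  star_d : ∀ (p : ℤ) (a : cx.X p), star (p - 1) (cx.d p (p - 1) a) = cx.d p (p - 1) (star p a)

namespace DGStarAlg

/-- Morphisms of dg `*`-algebras: unital multiplicative chain maps that preserve `*`. -/
structure Hom (A B : DGStarAlg.{v}) where
  toHom : A.cx ⟶ B.cx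
  map_one : toHom.f 0 A.one = B.one
  map_mul : ∀ (p q n : ℤ) (h : p + q = n) (a : A.cx.X p) (b : A.cx.X q),
    toHom.f n (A.mul p q n h a b) = B.mul p q n h (toHom.f p a) (toHom.f q b)
  map_star : ∀ (p : ℤ) (a : A.cx.X p), toHom.f p (A.star p a) = B.star p (toHom.f p a)

/-- There is a weak equivalence `A → B`: a morphism of dg `*`-algebras which is a
quasi-isomorphism. -/
def WeakEquiv (A B : DGStarAlg.{v}) : Prop := ∃ f : Hom A B, QuasiIso f.toHom

/-- `A` and `B` are connected by a (finite) zig-zag of weak equivalences. -/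
def ZigZag : DGStarAlg.{v} → DGStarAlg.{v} → Prop := Relation.EqvGen WeakEquiv

end DGStarAlg

namespace CCR

variable (V : ChainComplex (ModuleCat.{v} ℝ) ℤ)

/-- The real tensor algebra `⨁ₙ V^{⊗ n}` of the graded vector space `V`. -/
abbrev RT : Type v := TensorAlgebra ℝ (DirectSum ℤ fun n ↦ V.X n)

/-- The generator associated with an element of `V` of degree `p`. -/
noncomputable def gen (p : ℤ) : V.X p →ₗ[ℝ] RT V :=
  TensorAlgebra.ι ℝ ∘ₗ DirectSum.lof ℝ ℤ (fun n ↦ V.X n) p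

/-- The parity automorphism, `(-1)^p` on elements of degree `p`. -/
noncomputable def parity : RT V →ₐ[ℝ] RT V :=
  TensorAlgebra.lift ℝ (DirectSum.toModule ℝ ℤ _ fun p ↦ ((-1 : ℝ) ^ p) • gen V p)

/-- The algebra map `a ↦ (parity a, d a; 0, a)`, which encodes the graded Leibniz rule. -/
noncomputable def dMat : RT V →ₐ[ℝ] Matrix (Fin 2) (Fin 2) (RT V) :=
  TensorAlgebra.lift ℝ (DirectSum.toModule ℝ ℤ _ fun p ↦
    { toFun := fun x ↦ !![((-1 : ℝ) ^ p) • gen V p x, gen V (p - 1) (V.d p (p - 1) x); 0, gen V p x]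
      map_add' := fun x y ↦ by ext i j; fin_cases i <;> fin_cases j <;> simp
      map_smul' := fun c x ↦ by
        ext i j
        fin_cases i <;> fin_cases j <;> simp [mul_comm, smul_smul] })

/-- The differential on the tensor algebra: the graded derivation that extends that of `V`. -/
noncomputable def diff : RT V →ₗ[ℝ] RT V where
  toFun a := dMat V a 0 1
  map_add' a b := by simp
  map_smul' c a := by simp

/-- The linear map `b ↦ (-1)^{p|b|} b x` for `x` of degree `p`. -/
noncomputable def signedMulRight (p : ℤ) : V.X p →ₗ[ℝ] Module.End ℝ (RT V) where
  toFun x := LinearMap.mulRight ℝ (gen V p x) ∘ₗ (if Even p then LinearMap.id else (parity V).toLinearMap)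
  map_add' x y := by ext b; simp [mul_add]
  map_smul' c x := by ext b; simp

/-- The real-linear graded reversal: `1 ↦ 1` and `x b ↦ (-1)^{p|b|} rev(b) x` for generators `x` of
degree `p`; so `rev(x) = x` and `rev(a b) = (-1)^{|a||b|} rev(b) rev(a)`. -/
noncomputable def rev : RT V →ₗ[ℝ] RT V where
  toFun a := TensorAlgebra.lift ℝ (DirectSum.toModule ℝ ℤ _ (signedMulRight V)) a 1
  map_add' a b := by simp
  map_smul' c a := by simp

/-- The elements of degree `n`: spanned by the products of generators of total degree `n`. -/
noncomputable def piece (n : ℤ) : Submodule ℝ (RT V) :=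
  Submodule.span ℝ {a | ∃ l : List (Σ p, V.X p),
    (l.map Sigma.fst).sum = n ∧ a = (l.map fun x ↦ gen V x.1 x.2).prod}

variable {V}

theorem parity_gen (p : ℤ) (x : V.X p) : parity V (gen V p x) = ((-1 : ℝ) ^ p) • gen V p x := by
  simp [parity, gen]

theorem dMat_gen (p : ℤ) (x : V.X p) : dMat V (gen V p x) =
    !![((-1 : ℝ) ^ p) • gen V p x, gen V (p - 1) (V.d p (p - 1) x); 0, gen V p x] := by
  rw [dMat, gen, LinearMap.comp_apply, TensorAlgebra.lift_ι_apply, DirectSum.toModule_lof]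
  rfl

theorem dMat_eq (a : RT V) : dMat V a = !![parity V a, diff V a; 0, a] := by
  suffices h : dMat V a 0 0 = parity V a ∧ dMat V a 1 0 = 0 ∧ dMat V a 1 1 = a by
    ext i j
    fin_cases i <;> fin_cases j
    exacts [h.1, rfl, h.2.1, h.2.2]
  induction a using TensorAlgebra.induction with
  | algebraMap r => simp [Matrix.algebraMap_matrix_apply]
  | ι x =>
    induction x using DirectSum.induction_on with
    | zero => simp
    | of p x =>
      change dMat V (gen V p x) 0 0 = parity V (gen V p x) ∧ dMat V (gen V p x) 1 0 = 0 ∧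
        dMat V (gen V p x) 1 1 = gen V p x
      rw [dMat_gen, parity_gen]
      exact ⟨rfl, rfl, rfl⟩
    | add x y hx hy => simp [hx.1, hx.2.1, hx.2.2, hy.1, hy.2.1, hy.2.2]
  | mul a b ha hb =>
    simp [Matrix.mul_apply, Fin.sum_univ_two, ha.1, ha.2.1, ha.2.2, hb.1, hb.2.1, hb.2.2]
  | add a b ha hb => simp [ha.1, ha.2.1, ha.2.2, hb.1, hb.2.1, hb.2.2]

theorem diff_mul (a b : RT V) : diff V (a * b) = diff V a * b + parity V a * diff V b := by
  change dMat V (a * b) 0 1 = _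
  rw [map_mul, Matrix.mul_apply, Fin.sum_univ_two, dMat_eq a, dMat_eq b]
  simp [add_comm]

theorem diff_gen (p : ℤ) (x : V.X p) :
    diff V (gen V p x) = gen V (p - 1) (V.d p (p - 1) x) := by
  change dMat V (gen V p x) 0 1 = _
  rw [dMat_gen]
  rfl

theorem diff_one : diff V 1 = 0 := by simp [diff]

theorem rev_one : rev V 1 = 1 := by simp [rev]

theorem rev_gen_mul_aux (p : ℤ) (x : V.X p) (b : RT V) :
    rev V (gen V p x * b) = signedMulRight V p x (rev V b) := by
  change TensorAlgebra.lift ℝ (DirectSum.toModule ℝ ℤ (Module.End ℝ (RT V)) (signedMulRight V))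
    (gen V p x * b) 1 = _
  rw [map_mul, gen, LinearMap.comp_apply, TensorAlgebra.lift_ι_apply, DirectSum.toModule_lof]
  rfl

theorem one_mem_piece : (1 : RT V) ∈ piece V 0 := Submodule.subset_span ⟨[], rfl, rfl⟩

theorem gen_mem_piece (p : ℤ) (x : V.X p) : gen V p x ∈ piece V p :=
  Submodule.subset_span ⟨[⟨p, x⟩], by simp, by simp⟩

theorem mul_mem_piece {p q n : ℤ} (h : p + q = n) {a b : RT V} (ha : a ∈ piece V p)
    (hb : b ∈ piece V q) : a * b ∈ piece V n := by
  subst h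
  refine (show piece V p * piece V q ≤ piece V (p + q) from ?_) (Submodule.mul_mem_mul ha hb)
  rw [piece, piece, Submodule.span_mul_span, Submodule.span_le]
  rintro _ ⟨_, ⟨l, hl, rfl⟩, _, ⟨l', hl', rfl⟩, rfl⟩
  exact Submodule.subset_span ⟨l ++ l', by simp [hl, hl'], by simp⟩

theorem piece_ind {P : ℤ → RT V → Prop} (h0 : ∀ n, P n 0)
    (hadd : ∀ n a b, P n a → P n b → P n (a + b)) (hsmul : ∀ n (c : ℝ) a, P n a → P n (c • a))
    (h1 : P 0 1) (hmul : ∀ p (x : V.X p) n a, a ∈ piece V n → P n a → P (p + n) (gen V p x * a))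
    {n : ℤ} {a : RT V} (ha : a ∈ piece V n) : P n a := by
  induction ha using Submodule.span_induction with
  | zero => exact h0 n
  | add a b _ _ ha hb => exact hadd n a b ha hb
  | smul c a _ ha => exact hsmul n c a ha
  | mem a ha =>
    obtain ⟨l, hl, rfl⟩ := ha
    induction l generalizing n with
    | nil =>
      obtain rfl : 0 = n := by simpa using hl
      simpa using h1
    | cons x l ih =>
      obtain rfl : x.1 + (l.map Sigma.fst).sum = n := by simpa using hl
      simpa using hmul x.1 x.2 _ _ (Submodule.subset_span ⟨l, rfl, rfl⟩) (ih rfl)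

theorem parity_piece {n : ℤ} {a : RT V} (ha : a ∈ piece V n) :
    parity V a = ((-1 : ℝ) ^ n) • a := by
  refine piece_ind (P := fun n a ↦ parity V a = ((-1 : ℝ) ^ n) • a) ?_ ?_ ?_ ?_ ?_ ha
  · simp
  · intro n a b ha hb; rw [map_add, ha, hb, smul_add]
  · intro n c a ha; rw [map_smul, ha, smul_comm]
  · simp
  · intro p x n a _ ha
    rw [map_mul, parity_gen, ha, zpow_add₀ (by norm_num), smul_mul_smul_comm]

theorem sgn_congr {m n : ℤ} (h : Even (m - n)) : (-1 : ℝ) ^ m = (-1 : ℝ) ^ n := by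
  obtain ⟨k, hk⟩ := h
  rw [show m = n + (k + k) by omega, zpow_add₀ (by norm_num), Even.neg_one_zpow ⟨k, rfl⟩, mul_one]

theorem rev_gen_mul {p n : ℤ} (x : V.X p) {a : RT V} (ha : rev V a ∈ piece V n) :
    rev V (gen V p x * a) = ((-1 : ℝ) ^ (p * n)) • (rev V a * gen V p x) := by
  rw [rev_gen_mul_aux]
  change (if Even p then LinearMap.id else (parity V).toLinearMap) (rev V a) * gen V p x = _
  split_ifs with hp
  · rw [Even.neg_one_zpow (hp.mul_right n), one_smul]
    rfl
  · have : parity V (rev V a) = ((-1 : ℝ) ^ (p * n)) • rev V a := by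
      rw [parity_piece ha]
      obtain ⟨k, rfl⟩ := Int.not_even_iff_odd.1 hp
      rw [sgn_congr (m := (2 * k + 1) * n) (n := n) ⟨k * n, by ring⟩]
    rw [← smul_mul_assoc, ← this]
    rfl

theorem rev_mem_piece {n : ℤ} {a : RT V} (ha : a ∈ piece V n) : rev V a ∈ piece V n := by
  refine piece_ind (P := fun n a ↦ rev V a ∈ piece V n) ?_ ?_ ?_ ?_ ?_ ha
  · intro n; rw [map_zero]; exact zero_mem _
  · intro n a b ha hb; rw [map_add]; exact add_mem ha hb
  · intro n c a ha; rw [map_smul]; exact Submodule.smul_mem _ _ ha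
  · rw [rev_one]; exact one_mem_piece
  · intro p x n a _ ha
    rw [rev_gen_mul x ha]
    exact Submodule.smul_mem _ _ (mul_mem_piece (add_comm n p) ha (gen_mem_piece p x))

theorem rev_mul {p q : ℤ} {a b : RT V} (ha : a ∈ piece V p) (hb : b ∈ piece V q) :
    rev V (a * b) = ((-1 : ℝ) ^ (p * q)) • (rev V b * rev V a) := by
  refine piece_ind (P := fun p a ↦
    rev V (a * b) = ((-1 : ℝ) ^ (p * q)) • (rev V b * rev V a)) ?_ ?_ ?_ ?_ ?_ ha
  · simp
  · intro n a a' h h'; rw [add_mul, map_add, map_add, h, h', mul_add, smul_add]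
  · intro n c a h; rw [smul_mul_assoc, map_smul, map_smul, h, mul_smul_comm, smul_comm]
  · rw [one_mul, rev_one, mul_one, zero_mul, zpow_zero, one_smul]
  · intro r x n a ha h
    rw [mul_assoc, rev_gen_mul (n := n + q) x (rev_mem_piece (mul_mem_piece rfl ha hb)), h,
      rev_gen_mul x (rev_mem_piece ha), smul_mul_assoc, mul_smul_comm, smul_smul, smul_smul,
      mul_assoc, ← zpow_add₀ (by norm_num), ← zpow_add₀ (by norm_num)]
    congr 1
    exact sgn_congr ⟨0, by ring⟩

theorem rev_gen (p : ℤ) (x : V.X p) : rev V (gen V p x) = gen V p x := by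
  have := rev_gen_mul (n := 0) x (a := 1) (by rw [rev_one]; exact one_mem_piece)
  simpa [rev_one] using this

theorem rev_rev {n : ℤ} {a : RT V} (ha : a ∈ piece V n) : rev V (rev V a) = a := by
  refine piece_ind (P := fun n a ↦ rev V (rev V a) = a) ?_ ?_ ?_ ?_ ?_ ha
  · simp
  · intro n a b ha hb; rw [map_add, map_add, ha, hb]
  · intro n c a ha; rw [map_smul, map_smul, ha]
  · rw [rev_one, rev_one]
  · intro p x n a ha h
    rw [rev_gen_mul x (rev_mem_piece ha), map_smul, rev_mul (rev_mem_piece ha) (gen_mem_piece p x),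
      h, rev_gen, smul_smul, ← zpow_add₀ (by norm_num), Even.neg_one_zpow ⟨p * n, by ring⟩,
      one_smul]

theorem diff_gen_mul (p : ℤ) (x : V.X p) (a : RT V) : diff V (gen V p x * a) =
    gen V (p - 1) (V.d p (p - 1) x) * a + ((-1 : ℝ) ^ p) • (gen V p x * diff V a) := by
  rw [diff_mul, diff_gen, parity_gen, smul_mul_assoc]

theorem diff_mem_piece {n : ℤ} {a : RT V} (ha : a ∈ piece V n) : diff V a ∈ piece V (n - 1) := by
  refine piece_ind (P := fun n a ↦ diff V a ∈ piece V (n - 1)) ?_ ?_ ?_ ?_ ?_ ha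
  · intro n; rw [map_zero]; exact zero_mem _
  · intro n a b ha hb; rw [map_add]; exact add_mem ha hb
  · intro n c a ha; rw [map_smul]; exact Submodule.smul_mem _ _ ha
  · rw [diff_one]; exact zero_mem _
  · intro p x n a ha h
    rw [diff_gen_mul]
    exact add_mem (mul_mem_piece (by ring) (gen_mem_piece _ _) ha)
      (Submodule.smul_mem _ _ (mul_mem_piece (by ring) (gen_mem_piece _ _) h))

theorem diff_diff {n : ℤ} {a : RT V} (ha : a ∈ piece V n) : diff V (diff V a) = 0 := by
  refine piece_ind (P := fun n a ↦ diff V (diff V a) = 0) ?_ ?_ ?_ ?_ ?_ ha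
  · simp
  · intro n a b ha hb; rw [map_add, map_add, ha, hb, add_zero]
  · intro n c a ha; rw [map_smul, map_smul, ha, smul_zero]
  · rw [diff_one, map_zero]
  · intro p x n a ha h
    have hd : V.d (p - 1) (p - 1 - 1) (V.d p (p - 1) x) = 0 := by
      rw [← ConcreteCategory.comp_apply, V.d_comp_d]
      rfl
    rw [diff_gen_mul, map_add, map_smul, diff_gen_mul, diff_gen_mul, h, hd, map_zero, zero_mul,
      mul_zero, smul_zero, add_zero, zero_add, ← add_smul, zpow_sub_one₀ (by norm_num)]
    norm_num

theorem rev_diff {n : ℤ} {a : RT V} (ha : a ∈ piece V n) :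
    rev V (diff V a) = diff V (rev V a) := by
  refine piece_ind (P := fun n a ↦ rev V (diff V a) = diff V (rev V a)) ?_ ?_ ?_ ?_ ?_ ha
  · simp
  · intro n a b ha hb; rw [map_add, map_add, map_add, map_add, ha, hb]
  · intro n c a ha; rw [map_smul, map_smul, map_smul, map_smul, ha]
  · rw [diff_one, rev_one, map_zero, diff_one]
  · intro p x n a ha h
    rw [diff_gen_mul, map_add, map_smul, rev_gen_mul _ (rev_mem_piece ha),
      rev_gen_mul (n := n - 1) _ (rev_mem_piece (diff_mem_piece ha)),
      rev_gen_mul _ (rev_mem_piece ha), map_smul, diff_mul, diff_gen,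
      parity_piece (rev_mem_piece ha), h, smul_add, smul_smul, smul_mul_assoc, smul_smul,
      ← zpow_add₀ (by norm_num), ← zpow_add₀ (by norm_num), add_comm]
    congr 2
    · exact sgn_congr ⟨0, by ring⟩
    · exact sgn_congr ⟨-n, by ring⟩


variable (V)

/-- The complexified tensor algebra `⨁ₙ V_ℂ^{⊗ n}`, as `ℂ ⊗ ⨁ₙ V^{⊗ n}`. -/
abbrev TC : Type v := ℂ ⊗[ℝ] RT V

/-- The elements of degree `n` of the complexified tensor algebra. -/
noncomputable def pieceC (n : ℤ) : Submodule ℂ (TC V) :=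
  Submodule.span ℂ {a | ∃ x ∈ piece V n, a = 1 ⊗ₜ x}

/-- The differential on the complexified tensor algebra. -/
noncomputable def diffC : TC V →ₗ[ℂ] TC V := (diff V).baseChange ℂ

/-- The antilinear involution on the complexified tensor algebra with `v^* = v` for `v ∈ V` and
`(a b)^* = (-1)^{|a||b|} b^* a^*`. -/
noncomputable def starC : TC V →ₛₗ[starRingEnd ℂ] TC V where
  toFun := TensorProduct.map Complex.conjLIE.toLinearEquiv.toLinearMap (rev V)
  map_add' := map_add _
  map_smul' c a := by
    induction a using TensorProduct.induction_on with
    | zero => simp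
    | tmul z x => simp [TensorProduct.smul_tmul']
    | add a b ha hb => rw [smul_add, map_add, ha, hb, map_add, smul_add]

variable {V}

theorem diffC_tmul (z : ℂ) (x : RT V) : diffC V (z ⊗ₜ x) = z ⊗ₜ diff V x := rfl

theorem starC_one_tmul (x : RT V) : starC V (1 ⊗ₜ x) = 1 ⊗ₜ rev V x := by
  change TensorProduct.map _ _ _ = _
  rw [TensorProduct.map_tmul]
  simp

theorem tmul_mem_pieceC {n : ℤ} {x : RT V} (hx : x ∈ piece V n) : (1 : ℂ) ⊗ₜ x ∈ pieceC V n :=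
  Submodule.subset_span ⟨x, hx, rfl⟩

theorem pieceC_ind {n : ℤ} {P : TC V → Prop} (h0 : P 0) (hadd : ∀ a b, P a → P b → P (a + b))
    (hsmul : ∀ (c : ℂ) a, P a → P (c • a)) (h : ∀ x ∈ piece V n, P (1 ⊗ₜ x)) {a : TC V}
    (ha : a ∈ pieceC V n) : P a := by
  induction ha using Submodule.span_induction with
  | zero => exact h0
  | add a b _ _ ha hb => exact hadd a b ha hb
  | smul c a _ ha => exact hsmul c a ha
  | mem a ha =>
    obtain ⟨x, hx, rfl⟩ := ha
    exact h x hx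

theorem one_mem_pieceC : (1 : TC V) ∈ pieceC V 0 := tmul_mem_pieceC one_mem_piece

theorem mul_mem_pieceC {p q n : ℤ} (h : p + q = n) {a b : TC V} (ha : a ∈ pieceC V p)
    (hb : b ∈ pieceC V q) : a * b ∈ pieceC V n := by
  refine (show pieceC V p * pieceC V q ≤ pieceC V n from ?_) (Submodule.mul_mem_mul ha hb)
  rw [pieceC, pieceC, Submodule.span_mul_span, Submodule.span_le]
  rintro _ ⟨_, ⟨x, hx, rfl⟩, _, ⟨y, hy, rfl⟩, rfl⟩
  simpa using tmul_mem_pieceC (mul_mem_piece h hx hy)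

theorem diffC_mem_pieceC {n : ℤ} {a : TC V} (ha : a ∈ pieceC V n) :
    diffC V a ∈ pieceC V (n - 1) := by
  refine pieceC_ind (P := fun a ↦ diffC V a ∈ pieceC V (n - 1)) ?_ ?_ ?_ ?_ ha
  · rw [map_zero]; exact zero_mem _
  · intro a b ha hb; rw [map_add]; exact add_mem ha hb
  · intro c a ha; rw [map_smul]; exact Submodule.smul_mem _ _ ha
  · intro x hx; exact tmul_mem_pieceC (diff_mem_piece hx)

theorem starC_mem_pieceC {n : ℤ} {a : TC V} (ha : a ∈ pieceC V n) : starC V a ∈ pieceC V n := by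
  refine pieceC_ind (P := fun a ↦ starC V a ∈ pieceC V n) ?_ ?_ ?_ ?_ ha
  · rw [map_zero]; exact zero_mem _
  · intro a b ha hb; rw [map_add]; exact add_mem ha hb
  · intro c a ha; rw [LinearMap.map_smulₛₗ]; exact Submodule.smul_mem _ _ ha
  · intro x hx; rw [starC_one_tmul]; exact tmul_mem_pieceC (rev_mem_piece hx)

theorem diffC_diffC {n : ℤ} {a : TC V} (ha : a ∈ pieceC V n) : diffC V (diffC V a) = 0 := by
  refine pieceC_ind (P := fun a ↦ diffC V (diffC V a) = 0) ?_ ?_ ?_ ?_ ha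
  · simp
  · intro a b ha hb; rw [map_add, map_add, ha, hb, add_zero]
  · intro c a ha; rw [map_smul, map_smul, ha, smul_zero]
  · intro x hx; rw [diffC_tmul, diffC_tmul, diff_diff hx, TensorProduct.tmul_zero]

theorem starC_starC {n : ℤ} {a : TC V} (ha : a ∈ pieceC V n) : starC V (starC V a) = a := by
  refine pieceC_ind (P := fun a ↦ starC V (starC V a) = a) ?_ ?_ ?_ ?_ ha
  · simp
  · intro a b ha hb; rw [map_add, map_add, ha, hb]
  · intro c a ha; rw [LinearMap.map_smulₛₗ, LinearMap.map_smulₛₗ, ha, Complex.conj_conj]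
  · intro x hx; rw [starC_one_tmul, starC_one_tmul, rev_rev hx]

theorem starC_diffC {n : ℤ} {a : TC V} (ha : a ∈ pieceC V n) :
    starC V (diffC V a) = diffC V (starC V a) := by
  refine pieceC_ind (P := fun a ↦ starC V (diffC V a) = diffC V (starC V a)) ?_ ?_ ?_ ?_ ha
  · simp
  · intro a b ha hb; rw [map_add, map_add, map_add, map_add, ha, hb]
  · intro c a ha
    rw [map_smul, LinearMap.map_smulₛₗ, LinearMap.map_smulₛₗ, map_smul, ha]
  · intro x hx
    rw [diffC_tmul, starC_one_tmul, starC_one_tmul, diffC_tmul, rev_diff hx]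

theorem tmul_zsmul (n : ℤ) (x : RT V) :
    (1 : ℂ) ⊗ₜ[ℝ] (((-1 : ℝ) ^ n) • x) = ((-1 : ℂ) ^ n) • ((1 : ℂ) ⊗ₜ[ℝ] x) := by
  rw [← TensorProduct.smul_tmul, TensorProduct.smul_tmul']
  congr 1
  simp

theorem diffC_mul {p q : ℤ} {a b : TC V} (ha : a ∈ pieceC V p) (hb : b ∈ pieceC V q) :
    diffC V (a * b) = diffC V a * b + ((-1 : ℂ) ^ p) • (a * diffC V b) := by
  refine pieceC_ind (P := fun a ↦
    diffC V (a * b) = diffC V a * b + ((-1 : ℂ) ^ p) • (a * diffC V b)) ?_ ?_ ?_ ?_ ha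
  · simp
  · intro a a' h h'
    rw [add_mul, map_add, map_add, h, h', add_mul, add_mul, smul_add]
    abel
  · intro c a h
    rw [smul_mul_assoc, map_smul, map_smul, h, smul_mul_assoc, smul_mul_assoc, smul_add,
      smul_comm c]
  intro x hx
  refine pieceC_ind (P := fun b ↦ diffC V ((1 ⊗ₜ x) * b) = diffC V (1 ⊗ₜ x) * b +
    ((-1 : ℂ) ^ p) • ((1 ⊗ₜ x) * diffC V b)) ?_ ?_ ?_ ?_ hb
  · simp
  · intro b b' h h'
    rw [mul_add, map_add, map_add, h, h', mul_add, mul_add, smul_add]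
    abel
  · intro c b h
    rw [mul_smul_comm, map_smul, map_smul, h, mul_smul_comm, mul_smul_comm, smul_add, smul_comm c]
  intro y hy
  rw [Algebra.TensorProduct.tmul_mul_tmul, diffC_tmul, diffC_tmul, diffC_tmul,
    Algebra.TensorProduct.tmul_mul_tmul, Algebra.TensorProduct.tmul_mul_tmul, mul_one, diff_mul,
    TensorProduct.tmul_add, parity_piece hx, smul_mul_assoc, tmul_zsmul]

theorem starC_mul {p q : ℤ} {a b : TC V} (ha : a ∈ pieceC V p) (hb : b ∈ pieceC V q) :
    starC V (a * b) = ((-1 : ℂ) ^ (p * q)) • (starC V b * starC V a) := by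
  refine pieceC_ind (P := fun a ↦
    starC V (a * b) = ((-1 : ℂ) ^ (p * q)) • (starC V b * starC V a)) ?_ ?_ ?_ ?_ ha
  · simp
  · intro a a' h h'; rw [add_mul, map_add, map_add, h, h', mul_add, smul_add]
  · intro c a h
    rw [smul_mul_assoc, LinearMap.map_smulₛₗ, LinearMap.map_smulₛₗ, h, mul_smul_comm, smul_comm]
  intro x hx
  refine pieceC_ind (P := fun b ↦ starC V ((1 ⊗ₜ x) * b) =
    ((-1 : ℂ) ^ (p * q)) • (starC V b * starC V (1 ⊗ₜ x))) ?_ ?_ ?_ ?_ hb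
  · simp
  · intro b b' h h'; rw [mul_add, map_add, map_add, h, h', add_mul, smul_add]
  · intro c b h
    rw [mul_smul_comm, LinearMap.map_smulₛₗ, LinearMap.map_smulₛₗ, h, smul_mul_assoc, smul_comm]
  intro y hy
  rw [Algebra.TensorProduct.tmul_mul_tmul, mul_one, starC_one_tmul, starC_one_tmul, starC_one_tmul,
    Algebra.TensorProduct.tmul_mul_tmul, mul_one, rev_mul hx hy, tmul_zsmul]

/-- `J` is a two-sided ideal of the complexified tensor algebra that is closed under the
differential and the involution and contains the canonical commutation relations
`v w - (-1)^{|v||w|} w v - i τ(v, w) 1`. -/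
structure IsCCRIdeal (τ : ∀ p q : ℤ, V.X p →ₗ[ℝ] V.X q →ₗ[ℝ] ℝ) (J : Submodule ℂ (TC V)) :
    Prop where
  mul_left : ∀ a, ∀ x ∈ J, a * x ∈ J
  mul_right : ∀ a, ∀ x ∈ J, x * a ∈ J
  diff : ∀ x ∈ J, diffC V x ∈ J
  star : ∀ x ∈ J, starC V x ∈ J
  ccr : ∀ (p q : ℤ) (v : V.X p) (w : V.X q),
    (1 : ℂ) ⊗ₜ[ℝ] (gen V p v * gen V q w) -
        ((-1 : ℂ) ^ (p * q)) • ((1 : ℂ) ⊗ₜ[ℝ] (gen V q w * gen V p v)) -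
      (Complex.I * (τ p q v w : ℂ)) • (1 : TC V) ∈ J

variable (τ : ∀ p q : ℤ, V.X p →ₗ[ℝ] V.X q →ₗ[ℝ] ℝ)

/-- The two-sided dg `*`-ideal generated by the canonical commutation relations. -/
noncomputable def ideal : Submodule ℂ (TC V) := sInf {J | IsCCRIdeal τ J}

theorem isCCRIdeal_ideal : IsCCRIdeal τ (ideal τ) where
  mul_left a x hx := Submodule.mem_sInf.2 fun J hJ ↦
    hJ.mul_left a x (Submodule.mem_sInf.1 hx J hJ)
  mul_right a x hx := Submodule.mem_sInf.2 fun J hJ ↦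
    hJ.mul_right a x (Submodule.mem_sInf.1 hx J hJ)
  diff x hx := Submodule.mem_sInf.2 fun J hJ ↦ hJ.diff x (Submodule.mem_sInf.1 hx J hJ)
  star x hx := Submodule.mem_sInf.2 fun J hJ ↦ hJ.star x (Submodule.mem_sInf.1 hx J hJ)
  ccr p q v w := Submodule.mem_sInf.2 fun _ hJ ↦ hJ.ccr p q v w

/-- The elements of degree `n` of the ideal. -/
noncomputable def idealPiece (n : ℤ) : Submodule ℂ (pieceC V n) :=
  (ideal τ).comap (pieceC V n).subtype

/-- The elements of degree `n` of the quotient algebra. -/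
abbrev QX (n : ℤ) : Type v := pieceC V n ⧸ idealPiece τ n

/-- The class of a homogeneous element. -/
noncomputable abbrev mk (n : ℤ) : pieceC V n →ₗ[ℂ] QX τ n := (idealPiece τ n).mkQ

variable {τ} in
theorem mk_eq {n : ℤ} {a b : pieceC V n} (h : (a : TC V) = b) : mk τ n a = mk τ n b :=
  congrArg _ (Subtype.ext h)

/-- The differential of the quotient algebra. -/
noncomputable def qd (i j : ℤ) (h : j + 1 = i) : QX τ i →ₗ[ℂ] QX τ j :=
  (idealPiece τ i).mapQ (idealPiece τ j)
    ((diffC V).restrict fun a ha ↦ by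
      obtain rfl : i - 1 = j := by omega
      exact diffC_mem_pieceC ha)
    fun a ha ↦ (isCCRIdeal_ideal τ).diff a.1 ha

/-- The involution of the quotient algebra. -/
noncomputable def qstar (n : ℤ) : QX τ n →ₛₗ[starRingEnd ℂ] QX τ n :=
  (idealPiece τ n).mapQ (idealPiece τ n)
    { toFun := fun a ↦ ⟨starC V a.1, starC_mem_pieceC a.2⟩
      map_add' := fun _ _ ↦ Subtype.ext (map_add _ _ _)
      map_smul' := fun _ _ ↦ Subtype.ext (LinearMap.map_smulₛₗ _ _ _) }
    fun a ha ↦ (isCCRIdeal_ideal τ).star a.1 ha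

/-- The product of homogeneous elements, as a class in the quotient algebra. -/
noncomputable def mulAux (p q n : ℤ) (h : p + q = n) : pieceC V p →ₗ[ℂ] pieceC V q →ₗ[ℂ] QX τ n :=
  LinearMap.mk₂ ℂ (fun a b ↦ mk τ n ⟨a.1 * b.1, mul_mem_pieceC h a.2 b.2⟩)
    (fun _ _ _ ↦ by rw [← map_add]; exact mk_eq (add_mul _ _ _))
    (fun _ _ _ ↦ by rw [← map_smul]; exact mk_eq (smul_mul_assoc _ _ _))
    (fun _ _ _ ↦ by rw [← map_add]; exact mk_eq (mul_add _ _ _))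
    (fun _ _ _ ↦ by rw [← map_smul]; exact mk_eq (mul_smul_comm _ _ _))

theorem mk_eq_zero {n : ℤ} {a : pieceC V n} (h : (a : TC V) ∈ ideal τ) : mk τ n a = 0 :=
  (Submodule.Quotient.mk_eq_zero _).2 h

/-- The product of a homogeneous element and an element of the quotient algebra. -/
noncomputable def mulAux' (p q n : ℤ) (h : p + q = n) : pieceC V p →ₗ[ℂ] QX τ q →ₗ[ℂ] QX τ n where
  toFun a := (idealPiece τ q).liftQ (mulAux τ p q n h a) fun b hb ↦
    mk_eq_zero τ ((isCCRIdeal_ideal τ).mul_left a.1 b.1 hb)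
  map_add' a a' := Submodule.linearMap_qext _ (LinearMap.ext fun b ↦
    LinearMap.map_add₂ (mulAux τ p q n h) a a' b)
  map_smul' c a := Submodule.linearMap_qext _ (LinearMap.ext fun b ↦
    LinearMap.map_smul₂ (mulAux τ p q n h) c a b)

/-- The multiplication of the quotient algebra. -/
noncomputable def qmul (p q n : ℤ) (h : p + q = n) : QX τ p →ₗ[ℂ] QX τ q →ₗ[ℂ] QX τ n :=
  (idealPiece τ p).liftQ (mulAux' τ p q n h) fun a ha ↦
    Submodule.linearMap_qext _ (LinearMap.ext fun b ↦
      mk_eq_zero τ ((isCCRIdeal_ideal τ).mul_right b.1 a.1 ha))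

theorem qmul_mk (p q n : ℤ) (h : p + q = n) (a : pieceC V p) (b : pieceC V q) :
    qmul τ p q n h (mk τ p a) (mk τ q b) = mk τ n ⟨a.1 * b.1, mul_mem_pieceC h a.2 b.2⟩ := rfl

theorem qstar_mk (n : ℤ) (a : pieceC V n) :
    qstar τ n (mk τ n a) = mk τ n ⟨starC V a.1, starC_mem_pieceC a.2⟩ := rfl

/-- The underlying chain complex of the quotient algebra. -/
noncomputable def cx : ChainComplex (ModuleCat.{v} ℂ) ℤ where
  X n := ModuleCat.of ℂ (QX τ n)
  d i j := if h : j + 1 = i then ModuleCat.ofHom (qd τ i j h) else 0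
  shape i j hij := dif_neg hij
  d_comp_d' i j k hij hjk := by
    rw [dif_pos (show j + 1 = i from hij), dif_pos (show k + 1 = j from hjk)]
    refine ModuleCat.hom_ext (LinearMap.ext fun a ↦ ?_)
    obtain ⟨a, rfl⟩ := Submodule.mkQ_surjective _ a
    refine (Submodule.Quotient.mk_eq_zero _).2 ?_
    change diffC V (diffC V a.1) ∈ ideal τ
    rw [diffC_diffC a.2]
    exact zero_mem _

theorem cx_d (n : ℤ) (a : pieceC V n) : (cx τ).d n (n - 1) (mk τ n a) =
    mk τ (n - 1) ⟨diffC V a.1, diffC_mem_pieceC a.2⟩ := by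
  have h : (cx τ).d n (n - 1) = ModuleCat.ofHom (qd τ n (n - 1) (by omega)) :=
    dif_pos (by omega)
  rw [h]
  rfl

end CCR

/-- The CCR quantization of `(V, τ)`: the quotient of the free dg `*`-algebra on `V` by the
two-sided dg `*`-ideal generated by the canonical commutation relations. -/
noncomputable def CCR (V : ChainComplex (ModuleCat.{v} ℝ) ℤ)
    (τ : ∀ p q : ℤ, V.X p →ₗ[ℝ] V.X q →ₗ[ℝ] ℝ) : DGStarAlg.{v} where
  cx := CCR.cx τ
  one := CCR.mk τ 0 ⟨1, CCR.one_mem_pieceC⟩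
  mul := CCR.qmul τ
  star := CCR.qstar τ
  one_mul p a := by
    obtain ⟨a, rfl⟩ := Submodule.mkQ_surjective _ a
    exact CCR.mk_eq (one_mul a.1)
  mul_one p a := by
    obtain ⟨a, rfl⟩ := Submodule.mkQ_surjective _ a
    exact CCR.mk_eq (mul_one a.1)
  mul_assoc p q r s t n h₁ h₂ h₃ h₄ a b c := by
    obtain ⟨a, rfl⟩ := Submodule.mkQ_surjective _ a
    obtain ⟨b, rfl⟩ := Submodule.mkQ_surjective _ b
    obtain ⟨c, rfl⟩ := Submodule.mkQ_surjective _ c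
    exact CCR.mk_eq (mul_assoc a.1 b.1 c.1)
  leibniz p q n h a b := by
    obtain ⟨a, rfl⟩ := Submodule.mkQ_surjective _ a
    obtain ⟨b, rfl⟩ := Submodule.mkQ_surjective _ b
    refine (CCR.cx_d τ n _).trans ?_
    rw [CCR.cx_d, CCR.cx_d]
    exact CCR.mk_eq (CCR.diffC_mul a.2 b.2)
  star_star p a := by
    obtain ⟨a, rfl⟩ := Submodule.mkQ_surjective _ a
    exact CCR.mk_eq (CCR.starC_starC a.2)
  star_mul p q n h a b := by
    obtain ⟨a, rfl⟩ := Submodule.mkQ_surjective _ a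
    obtain ⟨b, rfl⟩ := Submodule.mkQ_surjective _ b
    exact CCR.mk_eq (CCR.starC_mul a.2 b.2)
  star_d p a := by
    obtain ⟨a, rfl⟩ := Submodule.mkQ_surjective _ a
    rw [CCR.cx_d]
    refine Eq.trans ?_ (CCR.cx_d τ p _).symm
    exact CCR.mk_eq (CCR.starC_diffC a.2)

end Algebra
end LinGauge

/-!
Two pairs of trivializations have propagators `Λ` and `Λ̃` that differ by a boundary: with
`λ = j_pc Λ⁺ (Λ̃⁺ - Λ⁺) ι - j_fc Λ⁻ (Λ̃⁻ - Λ⁻) ι` one has `d λ + λ d = -(Λ̃ - Λ)`, because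
`Λ̃^± - Λ^±` anticommutes with the differential and `d Λ^± + Λ^± d = id`
(`GaugeTheory.d_propagatorHomotopy`). As the integration pairing is a chain map, `τ̃ = τ + ∂ρ` for
the form `ρ(a, b) = -(-1)^{|a|} ⟨a, λ b⟩` of degree one (`GaugeTheory.poisson_eq_add_boundary`),
and `ρ` can be made graded antisymmetric since `τ` and `τ̃` are.

The rest holds for any complex `V` over `ℝ`. Let `W` be the mapping cylinder of the identity of `V`,
written as `V ⊕ cone(id)` with elements `(v, x, y)`. The form `η = τ(v, v') + ∂(ρ(x, x'))` is a
Poisson structure on `W` which restricts to `τ` along `v ↦ (v, 0, 0)` and to `τ̃` along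
`v ↦ (v, v, 0)`. Both maps are inclusions of deformation retracts, with the retraction
`(v, x, y) ↦ v`, so `CCR(V, τ) → CCR(W, η) ← CCR(V, τ̃)` is the required zig-zag once such
inclusions are known to induce weak equivalences (`CCR.IsDeformationRetract.weakEquiv`).

For this, let `f : V → W` be the inclusion, `g` the retraction and `s` the homotopy. If `η` is the
pullback of `τ` along `g`, then the derivation `D` of the tensor algebra that extends `s` preserves
the ideal of commutation relations. The operator `N = d D + D d` is the derivation that extends the
projection `1 - f g` to the complement of `V`; it counts factors from this complement, so that it is
locally finite with eigenvalues `0, 1, 2, …` and with kernel the tensor algebra of `V`. Hence some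
polynomial `q` with `q(0) ≠ 0` maps a given cycle `a` by `q(N)` into the tensor algebra of `V`, and
`q(N) a - q(0) a` is a boundary modulo the ideal (`CCR.IsDeformationRetract.exists_aeval_numberOp`,
`CCR.IsDeformationRetract.exists_homologous_of_pullback`). A general `η` that only restricts to `τ`
differs from the pullback by a Poisson structure `κ` which vanishes on `V`. The operator
`exp((i/2) κ)`, where `κ` contracts pairs of factors, is an automorphism of the complex underlying
the tensor algebra; it maps the ideal of `η` onto that of the pullback and fixes the tensor algebra
of `V` (`CCR.IsPoisson.reorder_mem_ideal`, `CCR.reorder_mapC`). It is not multiplicative, but this does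
not matter for statements about homology.
-/

namespace LinGauge

open CategoryTheory TensorProduct

namespace CCR

variable {V W : ChainComplex (ModuleCat.{v} ℝ) ℤ}

/-! ### Generators of the complexified tensor algebra -/

variable (V) in
/-- The generator of the complexified tensor algebra associated with an element of degree `p`. -/
noncomputable def genC (p : ℤ) : V.X p →ₗ[ℝ] TC V := TensorProduct.mk ℝ ℂ (RT V) 1 ∘ₗ gen V p

theorem genC_mem_pieceC (p : ℤ) (x : V.X p) : genC V p x ∈ pieceC V p :=
  tmul_mem_pieceC (gen_mem_piece p x)

/-- Induction on the number of generators in a product. -/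
theorem TC_ind {P : TC V → Prop} (hadd : ∀ a b, P a → P b → P (a + b))
    (hsmul : ∀ (c : ℂ) a, P a → P (c • a)) (h1 : P 1)
    (hmul : ∀ p (x : V.X p) a, P a → P (genC V p x * a)) (a : TC V) : P a := by
  have h0 : P 0 := by simpa using hsmul 0 1 h1
  have key (x : RT V) : ∀ b, P b → P (((1 : ℂ) ⊗ₜ x) * b) := by
    induction x using TensorAlgebra.induction with
    | algebraMap r =>
      intro b hb
      have : ((1 : ℂ) ⊗ₜ[ℝ] (algebraMap ℝ (RT V) r)) * b = (r : ℂ) • b := by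
        rw [← Algebra.TensorProduct.algebraMap_apply', ← Algebra.smul_def]
        exact (algebraMap_smul ℂ r b).symm
      rw [this]
      exact hsmul _ _ hb
    | ι x =>
      induction x using DirectSum.induction_on with
      | zero => intro b _; simpa using h0
      | of p x => exact fun b hb ↦ hmul p x b hb
      | add x y hx hy =>
        intro b hb
        rw [map_add, tmul_add, add_mul]
        exact hadd _ _ (hx b hb) (hy b hb)
    | mul x y hx hy =>
      intro b hb
      rw [← mul_one (1 : ℂ), ← Algebra.TensorProduct.tmul_mul_tmul, mul_assoc]
      exact hx _ (hy b hb)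
    | add x y hx hy =>
      intro b hb
      rw [tmul_add, add_mul]
      exact hadd _ _ (hx b hb) (hy b hb)
  induction a using TensorProduct.induction_on with
  | zero => exact h0
  | tmul z x =>
    have := hsmul z _ (key x 1 h1)
    rwa [mul_one, smul_tmul', smul_eq_mul, mul_one] at this
  | add a b ha hb => exact hadd a b ha hb

/-- The version of `TC_ind` for homogeneous elements, which keeps track of the degree. -/
theorem pieceC_genC_ind {P : ℤ → TC V → Prop} (h0 : ∀ n, P n 0)
    (hadd : ∀ n a b, P n a → P n b → P n (a + b))
    (hsmul : ∀ n (c : ℂ) a, P n a → P n (c • a)) (h1 : P 0 1)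
    (hmul : ∀ p (x : V.X p) n a, a ∈ pieceC V n → P n a → P (p + n) (genC V p x * a))
    {n : ℤ} {a : TC V} (ha : a ∈ pieceC V n) : P n a := by
  refine pieceC_ind (h0 n) (hadd n) (hsmul n) (fun x hx ↦ ?_) ha
  refine piece_ind (P := fun n x ↦ P n ((1 : ℂ) ⊗ₜ[ℝ] x)) ?_ ?_ ?_ h1 ?_ hx
  · intro n; rw [tmul_zero]; exact h0 n
  · intro n a b ha hb; rw [tmul_add]; exact hadd n _ _ ha hb
  · intro n c a ha
    rw [tmul_smul, ← algebraMap_smul ℂ c ((1 : ℂ) ⊗ₜ[ℝ] a)]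
    exact hsmul n _ _ ha
  · intro p x n a ha h
    have := hmul p x n _ (tmul_mem_pieceC ha) h
    rwa [genC, LinearMap.comp_apply, TensorProduct.mk_apply,
      Algebra.TensorProduct.tmul_mul_tmul, one_mul] at this

/-- Every element of the tensor algebra is a sum of homogeneous ones. -/
theorem iSup_pieceC : ⨆ n, pieceC V n = ⊤ := by
  refine Submodule.eq_top_iff'.2 (TC_ind (fun _ _ ↦ add_mem) (fun c _ ↦ Submodule.smul_mem _ c)
    (Submodule.mem_iSup_of_mem 0 one_mem_pieceC) fun p x a ha ↦ ?_)
  induction ha using Submodule.iSup_induction' with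
  | mem n a ha => exact Submodule.mem_iSup_of_mem _ (mul_mem_pieceC rfl (genC_mem_pieceC p x) ha)
  | zero => simp
  | add a b _ _ ha hb => rw [mul_add]; exact add_mem ha hb

theorem coe_smul_TC (c : ℝ) (a : TC V) : (c : ℂ) • a = c • a := algebraMap_smul ℂ c a

/-- The algebra map on the complexified tensor algebra with given values on generators. The
values form real-linear maps for the restriction of scalars of the target. -/
noncomputable def liftC {A : Type*} [Ring A] [Algebra ℂ A] (φ : ∀ p, V.X p → A)
    (hadd : ∀ p x y, φ p (x + y) = φ p x + φ p y)
    (hsmul : ∀ p (c : ℝ) x, φ p (c • x) = (c : ℂ) • φ p x) : TC V →ₐ[ℂ] A :=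
  Algebra.TensorProduct.lift (Algebra.ofId ℂ A)
    (TensorAlgebra.lift ℝ (DirectSum.toModule ℝ ℤ A fun p ↦
      { toFun := φ p, map_add' := hadd p, map_smul' := hsmul p }))
    (by intro z _; rw [Algebra.ofId_apply]; exact Algebra.commutes z _)

theorem liftC_genC {A : Type*} [Ring A] [Algebra ℂ A] (φ : ∀ p, V.X p → A) (hadd hsmul)
    (p : ℤ) (x : V.X p) : liftC φ hadd hsmul (genC V p x) = φ p x := by
  change liftC φ hadd hsmul ((1 : ℂ) ⊗ₜ[ℝ] gen V p x) = _
  rw [liftC, Algebra.TensorProduct.lift_tmul, map_one, one_mul, gen, LinearMap.comp_apply,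
    TensorAlgebra.lift_ι_apply, DirectSum.toModule_lof]
  rfl

theorem neg_one_zpow_congr {m n : ℤ} (h : Even (m - n)) : (-1 : ℂ) ^ m = (-1 : ℂ) ^ n := by
  obtain ⟨k, hk⟩ := h
  rw [show m = n + (k + k) by omega, zpow_add₀ (by norm_num), Even.neg_one_zpow ⟨k, rfl⟩, mul_one]

theorem neg_one_zpow_mul_self (n : ℤ) : (-1 : ℂ) ^ n * (-1 : ℂ) ^ n = 1 := by
  rw [← zpow_add₀ (by norm_num), Even.neg_one_zpow ⟨n, rfl⟩]

theorem neg_one_zpow_add (m n : ℤ) : (-1 : ℂ) ^ (m + n) = (-1 : ℂ) ^ m * (-1 : ℂ) ^ n :=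
  zpow_add₀ (by norm_num) m n

theorem neg_one_zpow_sub (m n : ℤ) : (-1 : ℂ) ^ (m - n) = (-1 : ℂ) ^ m * (-1 : ℂ) ^ n := by
  rw [← neg_one_zpow_add]
  exact neg_one_zpow_congr ⟨-n, by ring⟩

/-! ### Graded derivations of the tensor algebra -/

variable (V) in
/-- The sign automorphism `(-1)^{e p}` on elements of degree `p`. -/
noncomputable def twist (e : ℤ) : TC V →ₐ[ℂ] TC V :=
  liftC (fun p x ↦ ((-1 : ℂ) ^ (e * p)) • genC V p x) (by simp)
    fun p c x ↦ by rw [map_smul, coe_smul_TC, smul_comm]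

theorem twist_genC (e p : ℤ) (x : V.X p) :
    twist V e (genC V p x) = ((-1 : ℂ) ^ (e * p)) • genC V p x := liftC_genC _ _ _ p x

/-- The algebra map `a ↦ (twist a, der a; 0, a)`, which encodes the graded Leibniz rule for a
derivation of degree `e` with the values `g` on generators. -/
noncomputable def derMat (e : ℤ) (g : ∀ p, V.X p →ₗ[ℝ] TC V) :
    TC V →ₐ[ℂ] Matrix (Fin 2) (Fin 2) (TC V) :=
  liftC (fun p x ↦ !![((-1 : ℂ) ^ (e * p)) • genC V p x, g p x; 0, genC V p x])
    (fun p x y ↦ by ext i j; fin_cases i <;> fin_cases j <;> simp)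
    fun p c x ↦ by
      ext i j
      fin_cases i <;> fin_cases j <;> simp [coe_smul_TC, -Complex.coe_smul, smul_comm c]

/-- The graded derivation of degree `e` (modulo 2) of the tensor algebra with the values `g` on
generators. -/
noncomputable def der (e : ℤ) (g : ∀ p, V.X p →ₗ[ℝ] TC V) : TC V →ₗ[ℂ] TC V where
  toFun a := derMat e g a 0 1
  map_add' a b := by simp
  map_smul' c a := by simp

variable (e : ℤ) (g : ∀ p, V.X p →ₗ[ℝ] TC V)

theorem derMat_genC (p : ℤ) (x : V.X p) : derMat e g (genC V p x) =
    !![((-1 : ℂ) ^ (e * p)) • genC V p x, g p x; 0, genC V p x] := liftC_genC _ _ _ p x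

theorem derMat_eq (a : TC V) : derMat e g a = !![twist V e a, der e g a; 0, a] := by
  suffices h : derMat e g a 0 0 = twist V e a ∧ derMat e g a 1 0 = 0 ∧ derMat e g a 1 1 = a by
    ext i j
    fin_cases i <;> fin_cases j
    exacts [h.1, rfl, h.2.1, h.2.2]
  refine TC_ind (P := fun a ↦ derMat e g a 0 0 = twist V e a ∧ derMat e g a 1 0 = 0 ∧
    derMat e g a 1 1 = a) ?_ ?_ ?_ ?_ a
  · rintro a b ⟨h1, h2, h3⟩ ⟨h1', h2', h3'⟩; simp [h1, h2, h3, h1', h2', h3']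
  · rintro c a ⟨h1, h2, h3⟩; simp [h1, h2, h3]
  · simp
  · rintro p x a ⟨h1, h2, h3⟩
    simp [Matrix.mul_apply, Fin.sum_univ_two, derMat_genC, twist_genC, h1, h2, h3]

theorem der_mul (a b : TC V) : der e g (a * b) = der e g a * b + twist V e a * der e g b := by
  change derMat e g (a * b) 0 1 = _
  rw [map_mul, Matrix.mul_apply, Fin.sum_univ_two, derMat_eq e g a, derMat_eq e g b]
  simp [add_comm]

theorem der_one : der e g 1 = 0 := by simp [der]

theorem der_genC (p : ℤ) (x : V.X p) : der e g (genC V p x) = g p x := by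
  change derMat e g (genC V p x) 0 1 = _
  rw [derMat_genC]
  rfl

theorem der_genC_mul (p : ℤ) (x : V.X p) (a : TC V) : der e g (genC V p x * a) =
    g p x * a + ((-1 : ℂ) ^ (e * p)) • (genC V p x * der e g a) := by
  rw [der_mul, der_genC, twist_genC, smul_mul_assoc]

theorem der_mem_pieceC {k : ℤ} (hg : ∀ p x, g p x ∈ pieceC V (p + k)) {n : ℤ} {a : TC V}
    (ha : a ∈ pieceC V n) : der e g a ∈ pieceC V (n + k) := by
  refine pieceC_genC_ind (P := fun n a ↦ der e g a ∈ pieceC V (n + k)) ?_ ?_ ?_ ?_ ?_ ha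
  · intro n; rw [map_zero]; exact zero_mem _
  · intro n a b ha hb; rw [map_add]; exact add_mem ha hb
  · intro n c a ha; rw [map_smul]; exact Submodule.smul_mem _ _ ha
  · rw [der_one]; exact zero_mem _
  · intro p x n a ha h
    rw [der_genC_mul]
    exact add_mem (mul_mem_pieceC (by ring) (hg p x) ha)
      (Submodule.smul_mem _ _ (mul_mem_pieceC (by ring) (genC_mem_pieceC p x) h))

theorem diffC_one : diffC V 1 = 0 := by
  rw [Algebra.TensorProduct.one_def, diffC_tmul, diff_one, tmul_zero]

theorem diffC_genC (p : ℤ) (x : V.X p) :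
    diffC V (genC V p x) = genC V (p - 1) (V.d p (p - 1) x) := by
  change (1 : ℂ) ⊗ₜ[ℝ] diff V (gen V p x) = _
  rw [diff_gen]
  rfl

theorem diffC_genC_mul (p : ℤ) (x : V.X p) (a : TC V) : diffC V (genC V p x * a) =
    genC V (p - 1) (V.d p (p - 1) x) * a + ((-1 : ℂ) ^ p) • (genC V p x * diffC V a) := by
  rw [← diffC_genC]
  have ha : a ∈ ⨆ n, pieceC V n := iSup_pieceC ▸ Submodule.mem_top
  induction ha using Submodule.iSup_induction' with
  | mem n a ha => exact diffC_mul (genC_mem_pieceC p x) ha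
  | zero => simp
  | add a b _ _ ha hb => rw [mul_add, map_add, map_add, ha, hb, mul_add, mul_add, smul_add]; abel

theorem starC_genC (p : ℤ) (x : V.X p) : starC V (genC V p x) = genC V p x := by
  change starC V ((1 : ℂ) ⊗ₜ[ℝ] gen V p x) = _
  rw [starC_one_tmul, rev_gen]
  rfl

theorem starC_one : starC V 1 = 1 := by
  rw [Algebra.TensorProduct.one_def, starC_one_tmul, rev_one]

/-! ### Functoriality of the tensor algebra -/

/-- The algebra map induced by linear maps of degree zero. -/
noncomputable def mapC (f : ∀ p, V.X p →ₗ[ℝ] W.X p) : TC V →ₐ[ℂ] TC W :=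
  liftC (fun p x ↦ genC W p (f p x)) (by simp) fun p c x ↦ by
    rw [map_smul, map_smul, coe_smul_TC]

section

variable (f : ∀ p, V.X p →ₗ[ℝ] W.X p)

theorem mapC_genC (p : ℤ) (x : V.X p) : mapC f (genC V p x) = genC W p (f p x) :=
  liftC_genC _ _ _ p x

theorem mapC_mem_pieceC {n : ℤ} {a : TC V} (ha : a ∈ pieceC V n) : mapC f a ∈ pieceC W n := by
  refine pieceC_genC_ind (P := fun n a ↦ mapC f a ∈ pieceC W n) ?_ ?_ ?_ ?_ ?_ ha
  · intro n; rw [map_zero]; exact zero_mem _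
  · intro n a b ha hb; rw [map_add]; exact add_mem ha hb
  · intro n c a ha; rw [map_smul]; exact Submodule.smul_mem _ _ ha
  · rw [map_one]; exact one_mem_pieceC
  · intro p x n a ha h
    rw [map_mul, mapC_genC]
    exact mul_mem_pieceC rfl (genC_mem_pieceC _ _) h

theorem mapC_diffC (hf : ∀ p x, f (p - 1) (V.d p (p - 1) x) = W.d p (p - 1) (f p x)) (a : TC V) :
    mapC f (diffC V a) = diffC W (mapC f a) := by
  refine TC_ind (P := fun a ↦ mapC f (diffC V a) = diffC W (mapC f a)) ?_ ?_ ?_ ?_ a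
  · intro a b ha hb; simp only [map_add, ha, hb]
  · intro c a ha; simp only [map_smul, ha]
  · rw [diffC_one, map_one, map_zero, diffC_one]
  · intro p x a ha
    rw [diffC_genC_mul, map_add, map_smul, map_mul, map_mul, map_mul, mapC_genC, mapC_genC,
      diffC_genC_mul, ha, hf]

theorem mapC_starC {n : ℤ} {a : TC V} (ha : a ∈ pieceC V n) :
    mapC f (starC V a) = starC W (mapC f a) := by
  refine pieceC_genC_ind (P := fun n a ↦ mapC f (starC V a) = starC W (mapC f a)) ?_ ?_ ?_ ?_ ?_ ha
  · simp
  · intro n a b ha hb; simp only [map_add, ha, hb]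
  · intro n c a ha; simp only [map_smul, LinearMap.map_smulₛₗ, ha]
  · rw [starC_one, map_one, starC_one]
  · intro p x n a ha h
    rw [starC_mul (genC_mem_pieceC p x) ha, starC_genC, map_smul, map_mul, map_mul, mapC_genC,
      starC_mul (genC_mem_pieceC _ _) (mapC_mem_pieceC f ha), starC_genC, h]

theorem mapC_mapC_of_leftInverse {f} {g : ∀ p, W.X p →ₗ[ℝ] V.X p} (h : ∀ p x, g p (f p x) = x)
    (a : TC V) : mapC g (mapC f a) = a := by
  refine TC_ind (P := fun a ↦ mapC g (mapC f a) = a) ?_ ?_ ?_ ?_ a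
  · intro a b ha hb; simp only [map_add, ha, hb]
  · intro c a ha; simp only [map_smul, ha]
  · simp
  · intro p x a ha; rw [map_mul, map_mul, mapC_genC, mapC_genC, h, ha]

end

end CCR

namespace CCR

variable {V W : ChainComplex (ModuleCat.{v} ℝ) ℤ}

/-! ### The canonical commutation relations -/

/-- A graded antisymmetric chain map `V ⊗ V → ℝ`. -/
structure IsPoisson (τ : ∀ p q : ℤ, V.X p →ₗ[ℝ] V.X q →ₗ[ℝ] ℝ) : Prop where
  degree : ∀ p q, p + q ≠ 0 → ∀ v w, τ p q v w = 0
  antisymm : ∀ p q v w, τ p q v w = -((-1 : ℝ) ^ (p * q) * τ q p w v)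
  chain : ∀ p q v w, τ (p - 1) q (V.d p (p - 1) v) w +
    (-1 : ℝ) ^ p * τ p (q - 1) v (V.d q (q - 1) w) = 0

section

variable {τ : ∀ p q : ℤ, V.X p →ₗ[ℝ] V.X q →ₗ[ℝ] ℝ}

theorem IsPoisson.antisymmC (h : IsPoisson τ) (p q v w) :
    (τ p q v w : ℂ) = -((-1 : ℂ) ^ (p * q) * τ q p w v) := by
  rw [h.antisymm]; push_cast; rfl

theorem IsPoisson.chainC (h : IsPoisson τ) (p q v w) :
    (τ (p - 1) q (V.d p (p - 1) v) w : ℂ) + (-1 : ℂ) ^ p * τ p (q - 1) v (V.d q (q - 1) w) = 0 := by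
  have := congrArg (Complex.ofReal) (h.chain p q v w)
  push_cast at this
  exact this

theorem IsPoisson.sub (hτ : IsPoisson τ) {τ' : ∀ p q : ℤ, V.X p →ₗ[ℝ] V.X q →ₗ[ℝ] ℝ}
    (hτ' : IsPoisson τ') : IsPoisson fun p q ↦ τ p q - τ' p q where
  degree p q hpq v w := by
    rw [LinearMap.sub_apply, LinearMap.sub_apply, hτ.degree p q hpq, hτ'.degree p q hpq, sub_zero]
  antisymm p q v w := by
    simp only [LinearMap.sub_apply]
    rw [hτ.antisymm, hτ'.antisymm]
    ring
  chain p q v w := by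
    simp only [LinearMap.sub_apply]
    linear_combination hτ.chain p q v w - hτ'.chain p q v w

variable (τ) in
/-- The canonical commutation relation `v w - (-1)^{|v||w|} w v - i τ(v, w) 1`. -/
noncomputable def rel (p q : ℤ) (v : V.X p) (w : V.X q) : TC V :=
  genC V p v * genC V q w - ((-1 : ℂ) ^ (p * q)) • (genC V q w * genC V p v) -
    (Complex.I * (τ p q v w : ℂ)) • (1 : TC V)

theorem IsPoisson.rel_mem_pieceC (h : IsPoisson τ) (p q : ℤ) (v : V.X p) (w : V.X q) :
    rel τ p q v w ∈ pieceC V (p + q) := by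
  refine sub_mem (sub_mem (mul_mem_pieceC rfl (genC_mem_pieceC _ _) (genC_mem_pieceC _ _))
    (Submodule.smul_mem _ _
      (mul_mem_pieceC (add_comm _ _) (genC_mem_pieceC _ _) (genC_mem_pieceC _ _)))) ?_
  by_cases hpq : p + q = 0
  · rw [hpq]
    exact Submodule.smul_mem _ _ one_mem_pieceC
  · rw [h.degree p q hpq, Complex.ofReal_zero, mul_zero, zero_smul]
    exact zero_mem _

theorem IsPoisson.diffC_rel (h : IsPoisson τ) (p q : ℤ) (v : V.X p) (w : V.X q) :
    diffC V (rel τ p q v w) = rel τ (p - 1) q (V.d p (p - 1) v) w +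
      ((-1 : ℂ) ^ p) • rel τ p (q - 1) v (V.d q (q - 1) w) := by
  have hc := h.chainC p q v w
  have h1 : (-1 : ℂ) ^ ((p - 1) * q) = (-1 : ℂ) ^ (p * q) * (-1 : ℂ) ^ q := by
    rw [← neg_one_zpow_sub]; ring_nf
  have h2 : (-1 : ℂ) ^ (p * (q - 1)) = (-1 : ℂ) ^ (p * q) * (-1 : ℂ) ^ p := by
    rw [← neg_one_zpow_sub]; ring_nf
  have h3 := neg_one_zpow_mul_self p
  simp only [rel, map_sub, map_smul, diffC_one, diffC_genC_mul, diffC_genC, h1, h2]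
  generalize (τ (p - 1) q (V.d p (p - 1) v) w : ℂ) = x at *
  generalize (τ p (q - 1) v (V.d q (q - 1) w) : ℂ) = y at *
  linear_combination (norm := module) (Complex.I * hc) • (1 : TC V) +
    ((-1 : ℂ) ^ (p * q) * h3) • (genC V (q - 1) (V.d q (q - 1) w) * genC V p v)

variable (τ) in
theorem starC_rel (p q : ℤ) (v : V.X p) (w : V.X q) :
    starC V (rel τ p q v w) = (-1 : ℂ) • rel τ p q v w := by
  have h3 := neg_one_zpow_mul_self (p * q)
  have hs : starRingEnd ℂ ((-1 : ℂ) ^ (p * q)) = (-1 : ℂ) ^ (p * q) := by simp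
  simp only [rel, map_sub, LinearMap.map_smulₛₗ, starC_one, hs,
    starC_mul (genC_mem_pieceC p v) (genC_mem_pieceC q w),
    starC_mul (genC_mem_pieceC q w) (genC_mem_pieceC p v), starC_genC, mul_comm q p, smul_smul, h3,
    map_mul, Complex.conj_I, Complex.conj_ofReal]
  module

theorem rel_mem_ideal (τ : ∀ p q : ℤ, V.X p →ₗ[ℝ] V.X q →ₗ[ℝ] ℝ) (p q v w) :
    rel τ p q v w ∈ ideal τ := by
  have := (isCCRIdeal_ideal τ).ccr p q v w
  simpa only [rel, genC, LinearMap.comp_apply, TensorProduct.mk_apply,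
    Algebra.TensorProduct.tmul_mul_tmul, one_mul] using this

theorem mul_mem_ideal {a : TC V} (b : TC V) (ha : a ∈ ideal τ) : a * b ∈ ideal τ :=
  (isCCRIdeal_ideal τ).mul_right _ _ ha

theorem mul_mem_ideal' (a : TC V) {b : TC V} (hb : b ∈ ideal τ) : a * b ∈ ideal τ :=
  (isCCRIdeal_ideal τ).mul_left _ _ hb

theorem diffC_mem_ideal {a : TC V} (ha : a ∈ ideal τ) : diffC V a ∈ ideal τ :=
  (isCCRIdeal_ideal τ).diff _ ha

/-- The dg `*`-ideal of the canonical commutation relations is spanned by their products with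
homogeneous elements: the relations are stable under the differential and, up to sign, under the
involution. -/
theorem IsPoisson.ideal_eq_span (h : IsPoisson τ) : ideal τ = Submodule.span ℂ
    {x | ∃ (m n p q : ℤ) (v : V.X p) (w : V.X q), ∃ a ∈ pieceC V m, ∃ b ∈ pieceC V n,
      x = a * rel τ p q v w * b} := by
  apply le_antisymm
  · refine sInf_le ⟨?_, ?_, ?_, ?_, ?_⟩
    · intro c x hx
      have hc : c ∈ ⨆ n, pieceC V n := iSup_pieceC ▸ Submodule.mem_top
      induction hc using Submodule.iSup_induction' with
      | mem k c hc =>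
        induction hx using Submodule.span_induction with
        | mem x hx =>
          obtain ⟨m, n, p, q, v, w, a, ha, b, hb, rfl⟩ := hx
          exact Submodule.subset_span ⟨_, n, p, q, v, w, c * a, mul_mem_pieceC rfl hc ha, b, hb,
            by simp only [mul_assoc]⟩
        | zero => rw [mul_zero]; exact zero_mem _
        | add x y _ _ hx hy => rw [mul_add]; exact add_mem hx hy
        | smul z x _ hx => rw [mul_smul_comm]; exact Submodule.smul_mem _ _ hx
      | zero => rw [zero_mul]; exact zero_mem _
      | add c d _ _ hc hd => rw [add_mul]; exact add_mem hc hd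
    · intro c x hx
      have hc : c ∈ ⨆ n, pieceC V n := iSup_pieceC ▸ Submodule.mem_top
      induction hc using Submodule.iSup_induction' with
      | mem k c hc =>
        induction hx using Submodule.span_induction with
        | mem x hx =>
          obtain ⟨m, n, p, q, v, w, a, ha, b, hb, rfl⟩ := hx
          exact Submodule.subset_span ⟨m, _, p, q, v, w, a, ha, b * c, mul_mem_pieceC rfl hb hc,
            by simp only [mul_assoc]⟩
        | zero => rw [zero_mul]; exact zero_mem _
        | add x y _ _ hx hy => rw [add_mul]; exact add_mem hx hy
        | smul z x _ hx => rw [smul_mul_assoc]; exact Submodule.smul_mem _ _ hx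
      | zero => rw [mul_zero]; exact zero_mem _
      | add c d _ _ hc hd => rw [mul_add]; exact add_mem hc hd
    · intro x hx
      induction hx using Submodule.span_induction with
      | mem x hx =>
        obtain ⟨m, n, p, q, v, w, a, ha, b, hb, rfl⟩ := hx
        have hr := h.rel_mem_pieceC p q v w
        rw [diffC_mul (mul_mem_pieceC rfl ha hr) hb, diffC_mul ha hr, h.diffC_rel, mul_add,
          smul_add, mul_smul_comm, add_mul, add_mul, smul_mul_assoc, smul_mul_assoc, smul_mul_assoc]
        refine add_mem (add_mem ?_ (add_mem (Submodule.smul_mem _ _ ?_) (Submodule.smul_mem _ _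
          (Submodule.smul_mem _ _ ?_)))) (Submodule.smul_mem _ _ ?_)
        · exact Submodule.subset_span ⟨_, _, p, q, v, w, _, diffC_mem_pieceC ha, b, hb, rfl⟩
        · exact Submodule.subset_span ⟨_, _, _, q, _, w, a, ha, b, hb, rfl⟩
        · exact Submodule.subset_span ⟨_, _, p, _, v, _, a, ha, b, hb, rfl⟩
        · exact Submodule.subset_span ⟨_, _, p, q, v, w, a, ha, _, diffC_mem_pieceC hb, rfl⟩
      | zero => rw [map_zero]; exact zero_mem _
      | add x y _ _ hx hy => rw [map_add]; exact add_mem hx hy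
      | smul z x _ hx => rw [map_smul]; exact Submodule.smul_mem _ _ hx
    · intro x hx
      induction hx using Submodule.span_induction with
      | mem x hx =>
        obtain ⟨m, n, p, q, v, w, a, ha, b, hb, rfl⟩ := hx
        have hr := h.rel_mem_pieceC p q v w
        rw [starC_mul (mul_mem_pieceC rfl ha hr) hb, starC_mul ha hr, starC_rel τ, mul_smul_comm,
          smul_mul_assoc, mul_smul_comm]
        refine Submodule.smul_mem _ _ (Submodule.smul_mem _ _ (Submodule.smul_mem _ _ ?_))
        exact Submodule.subset_span ⟨_, _, p, q, v, w, _, starC_mem_pieceC hb, _,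
          starC_mem_pieceC ha, by simp only [mul_assoc]⟩
      | zero => rw [map_zero]; exact zero_mem _
      | add x y _ _ hx hy => rw [map_add]; exact add_mem hx hy
      | smul z x _ hx => rw [LinearMap.map_smulₛₗ]; exact Submodule.smul_mem _ _ hx
    · intro p q v w
      refine Submodule.subset_span ⟨0, 0, p, q, v, w, 1, one_mem_pieceC, 1, one_mem_pieceC, ?_⟩
      rw [one_mul, mul_one, rel]
      simp only [genC, LinearMap.comp_apply, TensorProduct.mk_apply,
        Algebra.TensorProduct.tmul_mul_tmul, one_mul]
  · refine Submodule.span_le.2 ?_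
    rintro _ ⟨m, n, p, q, v, w, a, -, b, -, rfl⟩
    exact mul_mem_ideal _ (mul_mem_ideal' _ (rel_mem_ideal τ p q v w))

/-- The ideal is contained in any subspace which is stable under left multiplication by generators
and contains the right multiples of the relations. -/
theorem IsPoisson.ideal_le (h : IsPoisson τ) {J : Submodule ℂ (TC V)}
    (hrel : ∀ p q v w b, rel τ p q v w * b ∈ J)
    (hmul : ∀ p x, ∀ a ∈ J, genC V p x * a ∈ J) : ideal τ ≤ J := by
  rw [h.ideal_eq_span, Submodule.span_le]
  rintro _ ⟨m, n, p, q, v, w, a, -, b, -, rfl⟩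
  rw [SetLike.mem_coe, mul_assoc]
  have h1 := hrel p q v w b
  generalize rel τ p q v w * b = y at h1
  refine TC_ind (P := fun a ↦ a * y ∈ J) ?_ ?_ ?_ ?_ a
  · intro a b ha hb; rw [add_mul]; exact add_mem ha hb
  · intro c a ha; rw [smul_mul_assoc]; exact Submodule.smul_mem _ _ ha
  · rwa [one_mul]
  · intro p x a ha; rw [mul_assoc]; exact hmul p x _ ha

theorem IsPoisson.twist_mem_ideal (h : IsPoisson τ) (e : ℤ) {a : TC V} (ha : a ∈ ideal τ) :
    twist V e a ∈ ideal τ := by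
  refine h.ideal_le (J := (ideal τ).comap (twist V e).toLinearMap) ?_ ?_ ha
  · intro p q v w b
    change twist V e (rel τ p q v w * b) ∈ ideal τ
    rw [map_mul]
    refine mul_mem_ideal _ ?_
    have : twist V e (rel τ p q v w) = ((-1 : ℂ) ^ (e * (p + q))) • rel τ p q v w := by
      have h1 : (-1 : ℂ) ^ (e * p) * (-1 : ℂ) ^ (e * q) = (-1 : ℂ) ^ (e * (p + q)) := by
        rw [mul_add, neg_one_zpow_add]
      have h2 : (τ p q v w : ℂ) = (-1 : ℂ) ^ (e * (p + q)) * τ p q v w := by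
        by_cases hpq : p + q = 0
        · rw [hpq, mul_zero, zpow_zero, one_mul]
        · rw [h.degree p q hpq, Complex.ofReal_zero, mul_zero]
      simp only [rel, map_sub, map_smul, map_mul, map_one, twist_genC, smul_mul_smul_comm, h1,
        mul_comm ((-1 : ℂ) ^ (e * q))]
      linear_combination (norm := module) (-Complex.I * h2) • (1 : TC V)
    rw [this]
    exact Submodule.smul_mem _ _ (rel_mem_ideal τ p q v w)
  · intro p x a ha
    change twist V e (genC V p x * a) ∈ ideal τ
    rw [map_mul]
    exact mul_mem_ideal' _ ha

/-- A graded derivation that maps the canonical commutation relations into the ideal preserves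
the ideal. -/
theorem IsPoisson.der_mem_ideal (h : IsPoisson τ) (e : ℤ) (g : ∀ p, V.X p →ₗ[ℝ] TC V)
    (hg : ∀ p q v w, der e g (rel τ p q v w) ∈ ideal τ) {a : TC V} (ha : a ∈ ideal τ) :
    der e g a ∈ ideal τ := by
  suffices ideal τ ≤ ideal τ ⊓ (ideal τ).comap (der e g) from (this ha).2
  refine h.ideal_le ?_ ?_
  · intro p q v w b
    refine ⟨mul_mem_ideal _ (rel_mem_ideal τ p q v w), ?_⟩
    change der e g (rel τ p q v w * b) ∈ ideal τ
    rw [der_mul]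
    exact add_mem (mul_mem_ideal _ (hg p q v w))
      (mul_mem_ideal _ (h.twist_mem_ideal e (rel_mem_ideal τ p q v w)))
  · rintro p x a ⟨h1, h2⟩
    refine ⟨mul_mem_ideal' _ h1, ?_⟩
    change der e g (genC V p x * a) ∈ ideal τ
    rw [der_genC_mul]
    exact add_mem (mul_mem_ideal' _ h1) (Submodule.smul_mem _ _ (mul_mem_ideal' _ h2))

theorem mapC_mem_ideal {τ' : ∀ p q : ℤ, W.X p →ₗ[ℝ] W.X q →ₗ[ℝ] ℝ} (h : IsPoisson τ)
    (f : ∀ p, V.X p →ₗ[ℝ] W.X p) (hf : ∀ p q v w, τ' p q (f p v) (f q w) = τ p q v w)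
    {a : TC V} (ha : a ∈ ideal τ) : mapC f a ∈ ideal τ' := by
  refine h.ideal_le (J := (ideal τ').comap (mapC f).toLinearMap) ?_ ?_ ha
  · intro p q v w b
    change mapC f (rel τ p q v w * b) ∈ ideal τ'
    rw [map_mul]
    refine mul_mem_ideal _ ?_
    have := rel_mem_ideal τ' p q (f p v) (f q w)
    simpa only [rel, map_sub, map_smul, map_mul, map_one, mapC_genC, hf] using this
  · intro p x a ha
    change mapC f (genC V p x * a) ∈ ideal τ'
    rw [map_mul]
    exact mul_mem_ideal' _ ha

end

end CCR

namespace CCR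

variable {V W : ChainComplex (ModuleCat.{v} ℝ) ℤ}

/-! ### Change of the Poisson structure -/

section

variable (κ : ∀ p q : ℤ, V.X p →ₗ[ℝ] V.X q →ₗ[ℝ] ℝ)

/-- The contraction with `κ(v, ·)` for `v` of degree `p`, a graded derivation. -/
noncomputable def contract (p : ℤ) (v : V.X p) : TC V →ₗ[ℂ] TC V :=
  der p fun q ↦ (κ p q v).smulRight 1

theorem contract_one (p : ℤ) (v : V.X p) : contract κ p v 1 = 0 := der_one _ _

theorem contract_genC_mul (p q : ℤ) (v : V.X p) (w : V.X q) (a : TC V) :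
    contract κ p v (genC V q w * a) =
      (κ p q v w : ℂ) • a + ((-1 : ℂ) ^ (p * q)) • (genC V q w * contract κ p v a) := by
  rw [contract, der_genC_mul, LinearMap.smulRight_apply, ← coe_smul_TC, smul_mul_assoc, one_mul]

theorem contract_add (p : ℤ) (v w : V.X p) (a : TC V) :
    contract κ p (v + w) a = contract κ p v a + contract κ p w a := by
  refine TC_ind (P := fun a ↦ contract κ p (v + w) a = contract κ p v a + contract κ p w a)
    ?_ ?_ ?_ ?_ a
  · intro a b ha hb; simp only [map_add, ha, hb]; abel
  · intro c a ha; simp only [map_smul, ha, smul_add]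
  · simp only [contract_one, add_zero]
  · intro q x a ha
    simp only [contract_genC_mul, ha, map_add, LinearMap.add_apply, Complex.ofReal_add, mul_add]
    module

theorem contract_smul (p : ℤ) (c : ℝ) (v : V.X p) (a : TC V) :
    contract κ p (c • v) a = (c : ℂ) • contract κ p v a := by
  refine TC_ind (P := fun a ↦ contract κ p (c • v) a = (c : ℂ) • contract κ p v a) ?_ ?_ ?_ ?_ a
  · intro a b ha hb; simp only [map_add, ha, hb, smul_add]
  · intro z a ha; simp only [map_smul, ha, smul_comm z]
  · simp only [contract_one, smul_zero]
  · intro q x a ha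
    simp only [contract_genC_mul, ha, map_smul, LinearMap.smul_apply, smul_eq_mul,
      Complex.ofReal_mul, mul_smul_comm]
    module

/-- The action of the tensor algebra on itself in which a generator `v` acts by
`a ↦ v a + (i/2) κ(v, ·) ⌟ a`. -/
noncomputable def reorderEnd : TC V →ₐ[ℂ] Module.End ℂ (TC V) :=
  liftC (fun p x ↦ LinearMap.mulLeft ℂ (genC V p x) + (Complex.I / 2) • contract κ p x)
    (fun p x y ↦ by
      refine LinearMap.ext fun a ↦ ?_
      simp only [map_add, contract_add, LinearMap.add_apply, LinearMap.smul_apply,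
        LinearMap.mulLeft_apply, add_mul]
      module)
    (fun p c x ↦ by
      refine LinearMap.ext fun a ↦ ?_
      simp only [map_smul, contract_smul, LinearMap.add_apply, LinearMap.smul_apply,
        LinearMap.mulLeft_apply, ← coe_smul_TC, smul_mul_assoc]
      module)

/-- Reordering of products: the operator `exp ((i/2) κ)` on the tensor algebra, where `κ` acts by
contracting pairs of factors. It is given by `1 ↦ 1` and `v a ↦ v (reorder a) + (i/2) κ(v, ·) ⌟
(reorder a)` for generators `v`. -/
noncomputable def reorder : TC V →ₗ[ℂ] TC V where
  toFun a := reorderEnd κ a 1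
  map_add' a b := by rw [map_add, LinearMap.add_apply]
  map_smul' c a := by rw [map_smul, LinearMap.smul_apply, RingHom.id_apply]

theorem reorder_one : reorder κ 1 = 1 := by
  change reorderEnd κ 1 1 = 1
  rw [map_one (reorderEnd κ), Module.End.one_apply]

theorem reorder_genC_mul (p : ℤ) (v : V.X p) (a : TC V) : reorder κ (genC V p v * a) =
    genC V p v * reorder κ a + (Complex.I / 2) • contract κ p v (reorder κ a) := by
  change reorderEnd κ (genC V p v * a) 1 = _
  rw [map_mul, Module.End.mul_apply, reorderEnd, liftC_genC]
  rfl

theorem contract_genC (p q : ℤ) (v : V.X p) (w : V.X q) :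
    contract κ p v (genC V q w) = (κ p q v w : ℂ) • (1 : TC V) := by
  rw [contract, der_genC, LinearMap.smulRight_apply, coe_smul_TC]

variable {κ}

theorem contract_neg {κ' : ∀ p q : ℤ, V.X p →ₗ[ℝ] V.X q →ₗ[ℝ] ℝ}
    (hκ' : ∀ p q v w, κ' p q v w = -κ p q v w) (p : ℤ) (v : V.X p) (a : TC V) :
    contract κ' p v a = (-1 : ℂ) • contract κ p v a := by
  refine TC_ind (P := fun b ↦ contract κ' p v b = (-1 : ℂ) • contract κ p v b) ?_ ?_ ?_ ?_ a
  · intro a b ha hb; simp only [map_add, ha, hb, smul_add]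
  · intro z a ha; simp only [map_smul, ha, smul_comm z]
  · simp only [contract_one, smul_zero]
  · intro r x a ha
    simp only [contract_genC_mul, ha, hκ', Complex.ofReal_neg, mul_smul_comm]
    module

variable (h : IsPoisson κ)
include h

theorem IsPoisson.coe_eq_of_parity (p q : ℤ) (v : V.X p) (w : V.X q) (r : ℤ) :
    (-1 : ℂ) ^ (p * r) * (κ p q v w : ℂ) = (-1 : ℂ) ^ (q * r) * κ p q v w := by
  by_cases hpq : p + q = 0
  · congr 1
    exact neg_one_zpow_congr ⟨p * r, by obtain rfl : q = -p := by omega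
                                        ring⟩
  · rw [h.degree p q hpq, Complex.ofReal_zero, mul_zero, mul_zero]

/-- Contractions anticommute in the graded sense. -/
theorem IsPoisson.contract_contract (p q : ℤ) (v : V.X p) (w : V.X q) (a : TC V) :
    contract κ p v (contract κ q w a) =
      ((-1 : ℂ) ^ (p * q)) • contract κ q w (contract κ p v a) := by
  refine TC_ind (P := fun a ↦ contract κ p v (contract κ q w a) =
      ((-1 : ℂ) ^ (p * q)) • contract κ q w (contract κ p v a)) ?_ ?_ ?_ ?_ a
  · intro a b ha hb; simp only [map_add, ha, hb, smul_add]
  · intro z a ha; simp only [map_smul, ha, smul_comm z]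
  · simp only [contract_one, map_zero, smul_zero]
  · intro r x a ha
    have h1 := h.coe_eq_of_parity q r w x p
    have h2 := h.coe_eq_of_parity p r v x q
    have h3 := neg_one_zpow_mul_self (p * r)
    have h4 := neg_one_zpow_mul_self (p * q)
    rw [mul_comm q p] at h1
    rw [mul_comm r p] at h1
    rw [mul_comm r q] at h2
    simp only [contract_genC_mul, map_add, map_smul, ha, mul_smul_comm]
    generalize (κ q r w x : ℂ) = y at *
    generalize (κ p r v x : ℂ) = z at *
    linear_combination (norm := module) ((-1 : ℂ) ^ (p * q) * h1 - y * h4) • contract κ p v a -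
      h2 • contract κ q w a

theorem IsPoisson.contract_mem_pieceC (p : ℤ) (v : V.X p) {n : ℤ} {a : TC V}
    (ha : a ∈ pieceC V n) : contract κ p v a ∈ pieceC V (n + p) := by
  refine der_mem_pieceC _ _ (fun q x ↦ ?_) ha
  rw [LinearMap.smulRight_apply]
  by_cases hpq : p + q = 0
  · rw [add_comm q, hpq, ← coe_smul_TC]
    exact Submodule.smul_mem _ _ one_mem_pieceC
  · rw [h.degree p q hpq, zero_smul]
    exact zero_mem _

theorem IsPoisson.reorder_mem_pieceC {n : ℤ} {a : TC V} (ha : a ∈ pieceC V n) :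
    reorder κ a ∈ pieceC V n := by
  refine pieceC_genC_ind (P := fun n a ↦ reorder κ a ∈ pieceC V n) ?_ ?_ ?_ ?_ ?_ ha
  · intro n; rw [map_zero]; exact zero_mem _
  · intro n a b ha hb; rw [map_add]; exact add_mem ha hb
  · intro n c a ha; rw [map_smul]; exact Submodule.smul_mem _ _ ha
  · rw [reorder_one]; exact one_mem_pieceC
  · intro p x n a ha hr
    rw [reorder_genC_mul, add_comm p n]
    exact add_mem (mul_mem_pieceC (add_comm _ _) (genC_mem_pieceC _ _) hr)
      (Submodule.smul_mem _ _ (h.contract_mem_pieceC p x hr))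

theorem IsPoisson.diffC_contract (p : ℤ) (v : V.X p) (a : TC V) :
    diffC V (contract κ p v a) = ((-1 : ℂ) ^ p) • contract κ p v (diffC V a) +
      contract κ (p - 1) (V.d p (p - 1) v) a := by
  refine TC_ind (P := fun a ↦ diffC V (contract κ p v a) =
    ((-1 : ℂ) ^ p) • contract κ p v (diffC V a) + contract κ (p - 1) (V.d p (p - 1) v) a)
    ?_ ?_ ?_ ?_ a
  · intro a b ha hb; simp only [map_add, ha, hb, smul_add]; abel
  · intro z a ha; simp only [map_smul, ha, smul_comm z, smul_add]
  · simp only [contract_one, diffC_one, map_zero, smul_zero, add_zero]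
  · intro r x a ha
    have h1 := h.chainC p r v x
    have h2 := h.coe_eq_of_parity p r v x 1
    have h3 := neg_one_zpow_mul_self p
    have h4 : (-1 : ℂ) ^ ((p - 1) * r) = (-1 : ℂ) ^ (p * r) * (-1 : ℂ) ^ r := by
      rw [← neg_one_zpow_sub]; ring_nf
    have h5 : (-1 : ℂ) ^ (p * (r - 1)) = (-1 : ℂ) ^ (p * r) * (-1 : ℂ) ^ p := by
      rw [← neg_one_zpow_sub]; ring_nf
    rw [mul_one, mul_one] at h2
    simp only [contract_genC_mul, diffC_genC_mul, map_add, map_smul, ha, mul_smul_comm, mul_add,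
      h4, h5]
    generalize (κ (p - 1) r _ x : ℂ) = y at *
    generalize (κ p r v x : ℂ) = z at *
    generalize (κ p (r - 1) v _ : ℂ) = u at *
    linear_combination (norm := module) -h1 • a + ((-1 : ℂ) ^ p * h2) • diffC V a -
      (z * h3) • diffC V a
      - ((-1 : ℂ) ^ (p * r) * h3) • (genC V (r - 1) (V.d r (r - 1) x) * contract κ p v a)

theorem IsPoisson.diffC_reorder (a : TC V) : diffC V (reorder κ a) = reorder κ (diffC V a) := by
  refine TC_ind (P := fun a ↦ diffC V (reorder κ a) = reorder κ (diffC V a)) ?_ ?_ ?_ ?_ a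
  · intro a b ha hb; simp only [map_add, ha, hb]
  · intro z a ha; simp only [map_smul, ha]
  · rw [reorder_one, diffC_one, map_zero]
  · intro r x a ha
    simp only [reorder_genC_mul, map_add, map_smul, diffC_genC_mul, h.diffC_contract, ha]
    module

theorem IsPoisson.reorder_contract (κ' : ∀ p q : ℤ, V.X p →ₗ[ℝ] V.X q →ₗ[ℝ] ℝ)
    (hκ' : ∀ p q v w, κ' p q v w = -κ p q v w) (p : ℤ) (v : V.X p) (a : TC V) :
    reorder κ' (contract κ p v a) = contract κ p v (reorder κ' a) := by
  refine TC_ind (P := fun a ↦ reorder κ' (contract κ p v a) = contract κ p v (reorder κ' a))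
    ?_ ?_ ?_ ?_ a
  · intro a b ha hb; simp only [map_add, ha, hb]
  · intro z a ha; simp only [map_smul, ha]
  · rw [reorder_one, contract_one, map_zero]
  · intro r x a ha
    simp only [contract_genC_mul, reorder_genC_mul, map_add, map_smul, ha, contract_neg hκ',
      h.contract_contract p r v x]
    module

/-- Reordering with `κ` and then with `-κ` is the identity. -/
theorem IsPoisson.reorder_reorder (κ' : ∀ p q : ℤ, V.X p →ₗ[ℝ] V.X q →ₗ[ℝ] ℝ)
    (hκ' : ∀ p q v w, κ' p q v w = -κ p q v w) (a : TC V) : reorder κ' (reorder κ a) = a := by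
  refine TC_ind (P := fun a ↦ reorder κ' (reorder κ a) = a) ?_ ?_ ?_ ?_ a
  · intro a b ha hb; simp only [map_add, ha, hb]
  · intro z a ha; simp only [map_smul, ha]
  · rw [reorder_one, reorder_one]
  · intro r x a ha
    simp only [reorder_genC_mul, map_add, map_smul, h.reorder_contract κ' hκ', ha, contract_neg hκ']
    module

/-- Reordering with the difference of two Poisson structures identifies the ideals of their
canonical commutation relations. -/
theorem IsPoisson.reorder_mem_ideal {τ τ' : ∀ p q : ℤ, V.X p →ₗ[ℝ] V.X q →ₗ[ℝ] ℝ}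
    (hτ : IsPoisson τ) (hτ' : IsPoisson τ') (hκ : ∀ p q v w, κ p q v w = τ p q v w - τ' p q v w)
    {a : TC V} (ha : a ∈ ideal τ) : reorder κ a ∈ ideal τ' := by
  have hctr (p v) {b : TC V} (hb : b ∈ ideal τ') : contract κ p v b ∈ ideal τ' := by
    refine hτ'.der_mem_ideal _ _ (fun q r x y ↦ ?_) hb
    suffices contract κ p v (rel τ' q r x y) = 0 by
      change contract κ p v (rel τ' q r x y) ∈ _
      rw [this]
      exact zero_mem _
    have h3 := h.coe_eq_of_parity p q v x r
    have h4 := h.coe_eq_of_parity p r v y q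
    rw [mul_comm r q] at h4
    simp only [rel, map_sub, map_smul, contract_genC_mul, contract_genC, contract_one,
      mul_smul_comm, mul_one, smul_zero]
    have h5 := neg_one_zpow_mul_self (q * r)
    generalize (κ p q v x : ℂ) = s at *
    generalize (κ p r v y : ℂ) = t at *
    linear_combination (norm := module) h4 • genC V q x - ((-1 : ℂ) ^ (q * r) * h3) • genC V r y
      - (s * h5) • genC V r y
  refine hτ.ideal_le (J := (ideal τ').comap (reorder κ)) ?_ ?_ ha
  · intro p q v w b
    change reorder κ (rel τ p q v w * b) ∈ ideal τ'
    suffices reorder κ (rel τ p q v w * b) = rel τ' p q v w * reorder κ b by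
      rw [this]
      exact mul_mem_ideal _ (rel_mem_ideal τ' p q v w)
    have h1 := h.antisymmC p q v w
    have h2 := neg_one_zpow_mul_self (p * q)
    have h3 : (κ p q v w : ℂ) = τ p q v w - τ' p q v w := by rw [hκ]; push_cast; rfl
    simp only [rel, sub_mul, smul_mul_assoc, one_mul, mul_assoc, map_sub, map_smul,
      reorder_genC_mul, map_add, contract_genC_mul, mul_add, smul_add, mul_smul_comm,
      h.contract_contract p q v w, mul_comm q p]
    generalize (κ p q v w : ℂ) = s at *
    generalize (κ q p w v : ℂ) = t at *
    linear_combination (norm := module) (Complex.I * h3 - Complex.I / 2 * h1) • reorder κ b -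
      (Complex.I / 2 * h2) • (genC V p v * contract κ q w (reorder κ b))
  · intro p x a ha
    change reorder κ (genC V p x * a) ∈ ideal τ'
    rw [reorder_genC_mul]
    exact add_mem (mul_mem_ideal' _ ha) (Submodule.smul_mem _ _ (hctr p x ha))

end

/-- Reordering fixes products of elements whose pairwise contractions vanish. -/
theorem reorder_mapC (κ : ∀ p q : ℤ, W.X p →ₗ[ℝ] W.X q →ₗ[ℝ] ℝ) (f : ∀ p, V.X p →ₗ[ℝ] W.X p)
    (hf : ∀ p q v w, κ p q (f p v) (f q w) = 0) (a : TC V) :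
    reorder κ (mapC f a) = mapC f a := by
  have hctr (p v b) : contract κ p (f p v) (mapC f b) = 0 := by
    refine TC_ind (P := fun b ↦ contract κ p (f p v) (mapC f b) = 0) ?_ ?_ ?_ ?_ b
    · intro a b ha hb; simp only [map_add, ha, hb, add_zero]
    · intro z a ha; simp only [map_smul, ha, smul_zero]
    · rw [map_one, contract_one]
    · intro r x a ha
      rw [map_mul, mapC_genC, contract_genC_mul, hf, ha, Complex.ofReal_zero, zero_smul, mul_zero,
        smul_zero, add_zero]
  refine TC_ind (P := fun a ↦ reorder κ (mapC f a) = mapC f a) ?_ ?_ ?_ ?_ a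
  · intro a b ha hb; simp only [map_add, ha, hb]
  · intro z a ha; simp only [map_smul, ha]
  · rw [map_one, reorder_one]
  · intro r x a ha
    rw [map_mul, mapC_genC, reorder_genC_mul, ha, hctr, smul_zero, add_zero]

end CCR

/-! ### Polynomials in an endomorphism -/

section Polynomial

open Polynomial

variable {E : Type*} [AddCommGroup E] [Module ℂ E]

theorem aeval_apply_of_intertwines {N N' L : Module.End ℂ E} (h : ∀ x, N (L x) = L (N' x))
    (q : ℂ[X]) (x : E) : aeval N q (L x) = L (aeval N' q x) := by
  induction q using Polynomial.induction_on' generalizing x with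
  | add p q hp hq => simp only [map_add, LinearMap.add_apply, hp, hq]
  | monomial n c =>
    have hn : ∀ x, (N ^ n) (L x) = L ((N' ^ n) x) := by
      induction n with
      | zero => simp
      | succ n ih =>
        intro x
        rw [pow_succ, pow_succ, Module.End.mul_apply, Module.End.mul_apply, h, ih]
    simp only [aeval_monomial, Module.End.mul_apply, hn, Module.algebraMap_end_apply, map_smul]

theorem aeval_apply_mem {N : Module.End ℂ E} {Z : Submodule ℂ E} (h : ∀ x ∈ Z, N x ∈ Z)
    (q : ℂ[X]) {x : E} (hx : x ∈ Z) : aeval N q x ∈ Z := by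
  induction q using Polynomial.induction_on' with
  | add p q hp hq => rw [map_add]; exact add_mem hp hq
  | monomial n c =>
    have hn : (N ^ n) x ∈ Z := by
      induction n with
      | zero => exact hx
      | succ n ih => rw [pow_succ']; exact h _ ih
    rw [aeval_monomial, Module.End.mul_apply, Module.algebraMap_end_apply]
    exact Submodule.smul_mem _ _ hn

theorem aeval_apply_eq_add (N : Module.End ℂ E) (q : ℂ[X]) (x : E) :
    aeval N q x = N (aeval N q.divX x) + q.eval 0 • x := by
  conv_lhs => rw [← q.X_mul_divX_add]
  rw [map_add, map_mul, aeval_X, aeval_C, LinearMap.add_apply, Module.End.mul_apply,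
    Module.algebraMap_end_apply, coeff_zero_eq_eval_zero]

theorem aeval_apply_of_apply_eq_zero {N : Module.End ℂ E} {x : E} (h : N x = 0) (q : ℂ[X]) :
    aeval N q x = q.eval 0 • x := by
  by_cases hx : x = 0
  · rw [hx, map_zero, smul_zero]
  · exact Module.End.aeval_apply_of_hasEigenvector
      ⟨Module.End.mem_eigenspace_iff.2 (by rw [h, zero_smul]), hx⟩

end Polynomial

namespace CCR

variable {V W : ChainComplex (ModuleCat.{v} ℝ) ℤ}

/-! ### Deformation retracts -/

/-- A deformation retract of chain complexes: an inclusion `f`, a retraction `g` and a homotopy `s`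
from `f g` to the identity with `g s = 0`. Only the components `s p (p + 1)` of `s` matter. -/
structure IsDeformationRetract (f : ∀ p, V.X p →ₗ[ℝ] W.X p) (g : ∀ p, W.X p →ₗ[ℝ] V.X p)
    (s : ∀ p q, W.X p →ₗ[ℝ] W.X q) : Prop where
  f_d : ∀ p x, f (p - 1) (V.d p (p - 1) x) = W.d p (p - 1) (f p x)
  g_d : ∀ p x, g (p - 1) (W.d p (p - 1) x) = V.d p (p - 1) (g p x)
  g_f : ∀ p x, g p (f p x) = x
  g_s : ∀ p x, g (p + 1) (s p (p + 1) x) = 0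
  d_s : ∀ p x, W.d (p + 1) p (s p (p + 1) x) + s (p - 1) p (W.d p (p - 1) x) = x - f p (g p x)

/-- The derivation of degree one of the tensor algebra that extends a map of degree one. -/
noncomputable def homotopyC (s : ∀ p q, W.X p →ₗ[ℝ] W.X q) : TC W →ₗ[ℂ] TC W :=
  der 1 fun p ↦ genC W (p + 1) ∘ₗ s p (p + 1)

theorem homotopyC_genC_mul (s : ∀ p q, W.X p →ₗ[ℝ] W.X q) (p : ℤ) (x : W.X p) (a : TC W) :
    homotopyC s (genC W p x * a) = genC W (p + 1) (s p (p + 1) x) * a +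
      ((-1 : ℂ) ^ p) • (genC W p x * homotopyC s a) := by
  rw [homotopyC, der_genC_mul, one_mul]
  rfl

theorem homotopyC_one (s : ∀ p q, W.X p →ₗ[ℝ] W.X q) : homotopyC s 1 = 0 := der_one _ _

theorem homotopyC_mem_pieceC (s : ∀ p q, W.X p →ₗ[ℝ] W.X q) {n : ℤ} {a : TC W}
    (ha : a ∈ pieceC W n) : homotopyC s a ∈ pieceC W (n + 1) :=
  der_mem_pieceC _ _ (fun _ _ ↦ genC_mem_pieceC _ _) ha

/-- The anticommutator of `homotopyC s` with the differential. -/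
noncomputable def numberOp (s : ∀ p q, W.X p →ₗ[ℝ] W.X q) : Module.End ℂ (TC W) :=
  diffC W ∘ₗ homotopyC s + homotopyC s ∘ₗ diffC W

theorem numberOp_apply (s : ∀ p q, W.X p →ₗ[ℝ] W.X q) (a : TC W) :
    numberOp s a = diffC W (homotopyC s a) + homotopyC s (diffC W a) := rfl

namespace IsDeformationRetract

variable {f : ∀ p, V.X p →ₗ[ℝ] W.X p} {g : ∀ p, W.X p →ₗ[ℝ] V.X p}
  {s : ∀ p q, W.X p →ₗ[ℝ] W.X q} (h : IsDeformationRetract f g s)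
include h

/-- The operator `numberOp s` is the derivation that extends the projection to the acyclic
complement of `V` in `W`; it counts the factors from this complement. -/
theorem numberOp_genC_mul (p : ℤ) (x : W.X p) (a : TC W) : numberOp s (genC W p x * a) =
    genC W p (x - f p (g p x)) * a + genC W p x * numberOp s a := by
  have e1 : ∀ k, k = p → genC W k (W.d (p + 1) k (s p (p + 1) x)) =
    genC W p (W.d (p + 1) p (s p (p + 1) x)) := by rintro _ rfl; rfl
  have e2 : ∀ k, k = p → genC W k (s (p - 1) k (W.d p (p - 1) x)) =
    genC W p (s (p - 1) p (W.d p (p - 1) x)) := by rintro _ rfl; rfl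
  have h1 : (-1 : ℂ) ^ (p + 1) = -(-1 : ℂ) ^ p := by rw [neg_one_zpow_add, zpow_one]; ring
  have h2 : (-1 : ℂ) ^ (p - 1) = -(-1 : ℂ) ^ p := by rw [neg_one_zpow_sub, zpow_one]; ring
  have h3 := neg_one_zpow_mul_self p
  rw [← h.d_s]
  simp only [numberOp_apply, homotopyC_genC_mul, diffC_genC_mul, map_add, map_smul, h1, h2,
    e1 _ (add_sub_cancel_right p 1), e2 _ (sub_add_cancel p 1), add_mul, mul_add]
  linear_combination (norm := module) h3 • (genC W p x * diffC W (homotopyC s a)) +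
    h3 • (genC W p x * homotopyC s (diffC W a))

omit h in
theorem numberOp_one : numberOp s 1 = 0 := by
  rw [numberOp_apply, homotopyC_one, diffC_one, map_zero, map_zero, add_zero]

theorem numberOp_mapC (a : TC V) : numberOp s (mapC f a) = 0 := by
  refine TC_ind (P := fun a ↦ numberOp s (mapC f a) = 0) ?_ ?_ ?_ ?_ a
  · intro a b ha hb; simp only [map_add, ha, hb, add_zero]
  · intro z a ha; simp only [map_smul, ha, smul_zero]
  · rw [map_one, numberOp_one]
  · intro p x a ha
    rw [map_mul, mapC_genC, h.numberOp_genC_mul, ha, h.g_f, sub_self, map_zero, zero_mul, mul_zero,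
      add_zero]

open Polynomial in
/-- The number operator acts locally finitely, with eigenvalues `0, 1, 2, …` and the tensor algebra
of `V` as its kernel. The condition on the values of `q` at all `-k`, and not only at `0`, makes an
induction on the number of factors possible. -/
theorem exists_aeval_numberOp {n : ℤ} {a : TC W} (ha : a ∈ pieceC W n) :
    ∃ q : ℂ[X], (∀ k : ℕ, q.eval (-k : ℂ) ≠ 0) ∧ ∃ b ∈ pieceC V n,
      aeval (numberOp s) q a = mapC f b := by
  have hadd : ∀ (n : ℤ) (a b : TC W), (∃ q : ℂ[X], (∀ k : ℕ, q.eval (-k : ℂ) ≠ 0) ∧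
      ∃ c ∈ pieceC V n, aeval (numberOp s) q a = mapC f c) →
      (∃ q : ℂ[X], (∀ k : ℕ, q.eval (-k : ℂ) ≠ 0) ∧
      ∃ c ∈ pieceC V n, aeval (numberOp s) q b = mapC f c) →
      ∃ q : ℂ[X], (∀ k : ℕ, q.eval (-k : ℂ) ≠ 0) ∧
      ∃ c ∈ pieceC V n, aeval (numberOp s) q (a + b) = mapC f c := by
    rintro n a b ⟨q, hq, c, hc, e⟩ ⟨q', hq', c', hc', e'⟩
    refine ⟨q * q', fun k ↦ ?_, q'.eval 0 • c + q.eval 0 • c',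
      add_mem (Submodule.smul_mem _ _ hc) (Submodule.smul_mem _ _ hc'), ?_⟩
    · rw [eval_mul]; exact mul_ne_zero (hq k) (hq' k)
    · rw [map_add]
      nth_rw 1 [mul_comm q q']
      rw [map_mul, map_mul, Module.End.mul_apply, Module.End.mul_apply, e, e',
        aeval_apply_of_apply_eq_zero (h.numberOp_mapC c),
        aeval_apply_of_apply_eq_zero (h.numberOp_mapC c'), map_add, map_smul, map_smul]
  refine pieceC_genC_ind (P := fun n a ↦ ∃ q : ℂ[X], (∀ k : ℕ, q.eval (-k : ℂ) ≠ 0) ∧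
    ∃ b ∈ pieceC V n, aeval (numberOp s) q a = mapC f b) ?_ hadd ?_ ?_ ?_ ha
  · exact fun n ↦ ⟨1, by simp, 0, zero_mem _, by simp⟩
  · rintro n z a ⟨q, hq, b, hb, e⟩
    exact ⟨q, hq, z • b, Submodule.smul_mem _ _ hb, by rw [map_smul, e, map_smul]⟩
  · exact ⟨1, by simp, 1, one_mem_pieceC, by simp⟩
  · rintro p x n a ha ⟨q, hq, b, hb, e⟩
    rw [show genC W p x * a = genC W p (f p (g p x)) * a + genC W p (x - f p (g p x)) * a by
      rw [← add_mul, ← map_add, add_sub_cancel]]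
    refine hadd _ _ _ ?_ ?_
    · refine ⟨q, hq, genC V p (g p x) * b, mul_mem_pieceC rfl (genC_mem_pieceC _ _) hb, ?_⟩
      rw [map_mul (mapC f), mapC_genC, ← e]
      refine aeval_apply_of_intertwines (L := LinearMap.mulLeft ℂ (genC W p (f p (g p x))))
        (fun y ↦ ?_) q a
      rw [LinearMap.mulLeft_apply, LinearMap.mulLeft_apply, h.numberOp_genC_mul, h.g_f, sub_self,
        map_zero, zero_mul, zero_add]
    -- A factor from the complement raises the eigenvalue by one, so all roots are shifted by one
    -- and the root `1` is added for the kernel.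
    · refine ⟨(X - 1) * q.comp (X - 1), fun k ↦ ?_, 0, zero_mem _, ?_⟩
      · have := hq (k + 1)
        rw [eval_mul, eval_comp, eval_sub, eval_X, eval_one]
        refine mul_ne_zero (fun h0 ↦ ?_) ?_
        · have h1 : ((k + 1 : ℕ) : ℂ) = 0 := by push_cast; linear_combination -h0
          exact Nat.cast_ne_zero.2 (Nat.succ_ne_zero k) h1
        · rwa [show (-(k : ℂ) - 1) = -((k + 1 : ℕ) : ℂ) by push_cast; ring]
      · rw [map_zero]
        have key := aeval_apply_of_intertwines (N := numberOp s) (N' := numberOp s + 1)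
          (L := LinearMap.mulLeft ℂ (genC W p (x - f p (g p x)))) (fun y ↦ by
            rw [LinearMap.mulLeft_apply, LinearMap.mulLeft_apply, h.numberOp_genC_mul,
              LinearMap.add_apply, Module.End.one_apply, mul_add, map_sub (g p), h.g_f, sub_self,
              map_zero, sub_zero, add_comm]) ((X - 1) * q.comp (X - 1)) a
        rw [LinearMap.mulLeft_apply, LinearMap.mulLeft_apply] at key
        rw [key]
        have e2 : aeval (numberOp s + 1) ((X - 1) * q.comp (X - 1)) =
            numberOp s * aeval (numberOp s) q := by
          simp [aeval_comp]
        rw [e2, Module.End.mul_apply, e, h.numberOp_mapC, mul_zero]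

section

variable {τ : ∀ p q : ℤ, V.X p →ₗ[ℝ] V.X q →ₗ[ℝ] ℝ} {η : ∀ p q : ℤ, W.X p →ₗ[ℝ] W.X q →ₗ[ℝ] ℝ}

theorem homotopyC_mem_ideal (hη : IsPoisson η)
    (hητ : ∀ p q x y, η p q x y = τ p q (g p x) (g q y)) {a : TC W} (ha : a ∈ ideal η) :
    homotopyC s a ∈ ideal η := by
  refine hη.der_mem_ideal _ _ (fun p q v w ↦ ?_) ha
  change homotopyC s (rel η p q v w) ∈ ideal η
  suffices homotopyC s (rel η p q v w) = rel η (p + 1) q (s p (p + 1) v) w +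
      ((-1 : ℂ) ^ p) • rel η p (q + 1) v (s q (q + 1) w) by
    rw [this]
    exact add_mem (rel_mem_ideal _ _ _ _ _) (Submodule.smul_mem _ _ (rel_mem_ideal _ _ _ _ _))
  have h1 : (-1 : ℂ) ^ ((p + 1) * q) = (-1 : ℂ) ^ (p * q) * (-1 : ℂ) ^ q := by
    rw [← neg_one_zpow_add]; ring_nf
  have h2 : (-1 : ℂ) ^ (p * (q + 1)) = (-1 : ℂ) ^ (p * q) * (-1 : ℂ) ^ p := by
    rw [← neg_one_zpow_add]; ring_nf
  have h3 := neg_one_zpow_mul_self p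
  have h4 (p x) : homotopyC s (genC W p x) = genC W (p + 1) (s p (p + 1) x) := der_genC _ _ _ _
  simp only [rel, map_sub, map_smul, homotopyC_genC_mul, homotopyC_one, h4, h1, h2, hητ, h.g_s,
    map_zero, LinearMap.zero_apply, Complex.ofReal_zero]
  linear_combination (norm := module)
    ((-1 : ℂ) ^ (p * q) * h3) • (genC W (q + 1) (s q (q + 1) w) * genC W p v)

/-- If the Poisson structure on `W` is pulled back along the retraction to `V`, then every cycle of
the quantization of `W` is homologous to one from `V`. -/
theorem exists_homologous_of_pullback (hη : IsPoisson η)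
    (hητ : ∀ p q x y, η p q x y = τ p q (g p x) (g q y)) {n : ℤ} {a : TC W}
    (ha : a ∈ pieceC W n) (hda : diffC W a ∈ ideal η) :
    ∃ b ∈ pieceC V n, ∃ c ∈ pieceC W (n + 1), a - mapC f b - diffC W c ∈ ideal η := by
  obtain ⟨q, hq, b, hb, e⟩ := h.exists_aeval_numberOp ha
  let Z : Submodule ℂ (TC W) := pieceC W n ⊓ (ideal η).comap (diffC W)
  have hZ : ∀ x ∈ Z, numberOp s x ∈ Z := by
    rintro x ⟨hx, hdx : diffC W x ∈ ideal η⟩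
    have hdsx := diffC_mem_pieceC (homotopyC_mem_pieceC s hx)
    rw [add_sub_cancel_right] at hdsx
    have hsdx := homotopyC_mem_pieceC s (diffC_mem_pieceC hx)
    rw [sub_add_cancel] at hsdx
    refine ⟨add_mem hdsx hsdx, ?_⟩
    change diffC W (numberOp s x) ∈ ideal η
    rw [numberOp_apply, map_add, diffC_diffC (homotopyC_mem_pieceC s hx), zero_add]
    exact diffC_mem_ideal (h.homotopyC_mem_ideal hη hητ hdx)
  obtain ⟨hx, hdx⟩ := aeval_apply_mem hZ q.divX (x := a) ⟨ha, hda⟩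
  rw [aeval_apply_eq_add, numberOp_apply] at e
  set x := Polynomial.aeval (numberOp s) q.divX a
  have h0 : q.eval 0 ≠ 0 := by simpa using hq 0
  refine ⟨(q.eval 0)⁻¹ • b, Submodule.smul_mem _ _ hb, -(q.eval 0)⁻¹ • homotopyC s x,
    Submodule.smul_mem _ _ (homotopyC_mem_pieceC s hx), ?_⟩
  rw [map_smul, map_smul, ← e]
  have := Submodule.smul_mem (ideal η) (-(q.eval 0)⁻¹) (h.homotopyC_mem_ideal hη hητ hdx)
  convert this using 1
  have h1 := inv_mul_cancel₀ h0
  linear_combination (norm := module) -h1 • a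

theorem isPoisson_pullback (hτ : IsPoisson τ) :
    IsPoisson fun p q ↦ (τ p q).compl₁₂ (g p) (g q) where
  degree p q hpq v w := hτ.degree p q hpq _ _
  antisymm p q v w := hτ.antisymm p q _ _
  chain p q v w := by
    have := hτ.chain p q (g p v) (g q w)
    simpa only [LinearMap.compl₁₂_apply, h.g_d] using this

end

end IsDeformationRetract
end CCR

/-! ### Quasi-isomorphisms between quantizations -/

/-- A chain map of complexes of modules is a quasi-isomorphism if it is injective and surjective on
homology classes. -/
theorem quasiIso_of_cycles {C D : ChainComplex (ModuleCat.{v} ℂ) ℤ} (φ : C ⟶ D)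
    (hinj : ∀ n (x : C.X n) (y : D.X (n + 1)), C.d n (n - 1) x = 0 →
      φ.f n x = D.d (n + 1) n y → ∃ z, x = C.d (n + 1) n z)
    (hsurj : ∀ n (x : D.X n), D.d n (n - 1) x = 0 →
      ∃ y : C.X n, C.d n (n - 1) y = 0 ∧ ∃ z, x = φ.f n y + D.d (n + 1) n z) : QuasiIso φ := by
  rw [quasiIso_iff]
  intro n
  rw [quasiIsoAt_iff_isIso_homologyMap, isIso_iff_mono_and_epi,
    HomologicalComplex.mono_homologyMap_iff_up_to_refinements φ (n + 1) n (n - 1) (by simp)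
      (by simp),
    HomologicalComplex.epi_homologyMap_iff_up_to_refinements φ (n + 1) n (n - 1) (by simp)
      (by simp)]
  constructor
  · intro A x hx y hxy
    let B := LinearMap.ker (x.hom.coprod (-(C.d (n + 1) n).hom))
    refine ⟨ModuleCat.of ℂ B, ModuleCat.ofHom (LinearMap.fst ℂ _ _ ∘ₗ B.subtype), ?_,
      ModuleCat.ofHom (LinearMap.snd ℂ _ _ ∘ₗ B.subtype), ?_⟩
    · rw [ModuleCat.epi_iff_surjective]
      intro a
      obtain ⟨z, hz⟩ := hinj n (x a) (y a) (ConcreteCategory.congr_hom hx a)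
        (ConcreteCategory.congr_hom hxy a)
      exact ⟨⟨(a, z), by simp [B, hz]⟩, rfl⟩
    · refine ModuleCat.hom_ext (LinearMap.ext fun b ↦ ?_)
      have := b.2
      simp only [B, LinearMap.mem_ker, LinearMap.coprod_apply, LinearMap.neg_apply] at this
      exact add_neg_eq_zero.1 this
  · intro A x hx
    let B := LinearMap.ker (x.hom.coprod
      (((-(φ.f n).hom).coprod (-(D.d (n + 1) n).hom)))) ⊓
      LinearMap.ker ((C.d n (n - 1)).hom ∘ₗ LinearMap.fst ℂ _ _ ∘ₗ LinearMap.snd ℂ A _)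
    refine ⟨ModuleCat.of ℂ B, ModuleCat.ofHom (LinearMap.fst ℂ _ _ ∘ₗ B.subtype), ?_,
      ModuleCat.ofHom (LinearMap.fst ℂ _ _ ∘ₗ LinearMap.snd ℂ _ _ ∘ₗ B.subtype), ?_,
      ModuleCat.ofHom (LinearMap.snd ℂ _ _ ∘ₗ LinearMap.snd ℂ _ _ ∘ₗ B.subtype), ?_⟩
    · rw [ModuleCat.epi_iff_surjective]
      intro a
      obtain ⟨y, hy, z, hz⟩ := hsurj n (x a) (ConcreteCategory.congr_hom hx a)
      exact ⟨⟨(a, y, z), by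
        change x.hom a + (-(φ.f n).hom y + -(D.d (n + 1) n).hom z) = 0
        rw [← neg_add]
        exact add_neg_eq_zero.2 hz, hy⟩, rfl⟩
    · exact ModuleCat.hom_ext (LinearMap.ext fun b ↦ b.2.2)
    · refine ModuleCat.hom_ext (LinearMap.ext fun b ↦ ?_)
      have : x.hom b.1.1 + (-(φ.f n).hom b.1.2.1 + -(D.d (n + 1) n).hom b.1.2.2) = 0 := b.2.1
      rw [← neg_add] at this
      exact add_neg_eq_zero.1 this

namespace CCR

variable {V W : ChainComplex (ModuleCat.{v} ℝ) ℤ}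
  {τ : ∀ p q : ℤ, V.X p →ₗ[ℝ] V.X q →ₗ[ℝ] ℝ} {η : ∀ p q : ℤ, W.X p →ₗ[ℝ] W.X q →ₗ[ℝ] ℝ}
  {f : ∀ p, V.X p →ₗ[ℝ] W.X p}

theorem cx_d_add_one (n : ℤ) (a : pieceC V (n + 1)) (ha : diffC V a ∈ pieceC V n) :
    (cx τ).d (n + 1) n (mk τ (n + 1) a) = mk τ n ⟨diffC V a, ha⟩ := by
  have h : (cx τ).d (n + 1) n = ModuleCat.ofHom (qd τ (n + 1) n rfl) := dif_pos rfl
  rw [h]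
  rfl

theorem diffC_mem_pieceC_add_one {n : ℤ} {a : TC V} (ha : a ∈ pieceC V (n + 1)) :
    diffC V a ∈ pieceC V n := by
  simpa using diffC_mem_pieceC ha

/-- The component of degree `n` of the map of quantizations induced by a chain map. -/
noncomputable def mapQ (hτ : IsPoisson τ) (hητ : ∀ p q x y, η p q (f p x) (f q y) = τ p q x y)
    (n : ℤ) : QX τ n →ₗ[ℂ] QX η n :=
  (idealPiece τ n).mapQ (idealPiece η n)
    ((mapC f).toLinearMap.restrict fun _ ha ↦ mapC_mem_pieceC f ha)
    fun _ ha ↦ mapC_mem_ideal hτ f hητ ha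

theorem mapQ_mk (hτ : IsPoisson τ) (hητ : ∀ p q x y, η p q (f p x) (f q y) = τ p q x y)
    (n : ℤ) (a : pieceC V n) :
    mapQ hτ hητ n (mk τ n a) = mk η n ⟨mapC f a.1, mapC_mem_pieceC f a.2⟩ := rfl

theorem mapQ_qmul (hτ : IsPoisson τ) (hητ : ∀ p q x y, η p q (f p x) (f q y) = τ p q x y)
    (p q n : ℤ) (h : p + q = n) (a : QX τ p) (b : QX τ q) :
    mapQ hτ hητ n (qmul τ p q n h a b) = qmul η p q n h (mapQ hτ hητ p a) (mapQ hτ hητ q b) := by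
  obtain ⟨a, rfl⟩ := Submodule.mkQ_surjective _ a
  obtain ⟨b, rfl⟩ := Submodule.mkQ_surjective _ b
  rw [qmul_mk, mapQ_mk, mapQ_mk, mapQ_mk, qmul_mk]
  exact mk_eq (map_mul (mapC f) a.1 b.1)

theorem mapQ_qstar (hτ : IsPoisson τ) (hητ : ∀ p q x y, η p q (f p x) (f q y) = τ p q x y)
    (p : ℤ) (a : QX τ p) : mapQ hτ hητ p (qstar τ p a) = qstar η p (mapQ hτ hητ p a) := by
  obtain ⟨a, rfl⟩ := Submodule.mkQ_surjective _ a
  rw [qstar_mk, mapQ_mk, mapQ_mk, qstar_mk]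
  exact mk_eq (mapC_starC f a.2)

/-- The morphism of dg `*`-algebras between quantizations that is induced by a chain map which
preserves the Poisson structures. -/
noncomputable def mapHom (hτ : IsPoisson τ)
    (hf : ∀ p x, f (p - 1) (V.d p (p - 1) x) = W.d p (p - 1) (f p x))
    (hητ : ∀ p q x y, η p q (f p x) (f q y) = τ p q x y) :
    DGStarAlg.Hom (CCR V τ) (CCR W η) where
  toHom :=
    { f := fun n ↦ ModuleCat.ofHom (mapQ hτ hητ n)
      comm' := by
        intro i j hij
        obtain rfl : j = i - 1 := by
          have : j + 1 = i := hij
          omega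
        refine ModuleCat.hom_ext (LinearMap.ext fun a ↦ ?_)
        obtain ⟨a, rfl⟩ := Submodule.mkQ_surjective _ a
        change (cx η).d i (i - 1) (mk η i ⟨mapC f a.1, _⟩) =
          mapQ hτ hητ (i - 1) ((cx τ).d i (i - 1) (mk τ i a))
        rw [cx_d, cx_d]
        exact mk_eq (mapC_diffC f hf a.1).symm }
  map_one := mk_eq (map_one (mapC f))
  map_mul := mapQ_qmul hτ hητ
  map_star := mapQ_qstar hτ hητ

namespace IsDeformationRetract

variable {g : ∀ p, W.X p →ₗ[ℝ] V.X p} {s : ∀ p q, W.X p →ₗ[ℝ] W.X q}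
  (h : IsDeformationRetract f g s) (hτ : IsPoisson τ) (hη : IsPoisson η)
  (hητ : ∀ p q x y, η p q (f p x) (f q y) = τ p q x y)
include h hτ hη hητ

/-- For any Poisson structure on `W` that restricts to the given one on `V`, every cycle of the
quantization of `W` is homologous to a cycle from `V`: reordering reduces this to the pullback. -/
theorem exists_homologous {n : ℤ} {a : TC W} (ha : a ∈ pieceC W n) (hda : diffC W a ∈ ideal η) :
    ∃ b ∈ pieceC V n, diffC V b ∈ ideal τ ∧
      ∃ c ∈ pieceC W (n + 1), a - mapC f b - diffC W c ∈ ideal η := by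
  have hη' := h.isPoisson_pullback hτ
  set η' : ∀ p q : ℤ, W.X p →ₗ[ℝ] W.X q →ₗ[ℝ] ℝ := fun p q ↦ (τ p q).compl₁₂ (g p) (g q)
  have hκ := hη.sub hη'
  have hκ' := hη'.sub hη
  set κ : ∀ p q : ℤ, W.X p →ₗ[ℝ] W.X q →ₗ[ℝ] ℝ := fun p q ↦ η p q - η' p q
  set κ' : ∀ p q : ℤ, W.X p →ₗ[ℝ] W.X q →ₗ[ℝ] ℝ := fun p q ↦ η' p q - η p q
  have hneg : ∀ p q v w, κ' p q v w = -κ p q v w := fun p q v w ↦ by simp [κ, κ']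
  have hf0 : ∀ p q v w, κ p q (f p v) (f q w) = 0 := fun p q v w ↦ by
    simp [κ, η', hητ, h.g_f]
  obtain ⟨b, hb, c, hc, e⟩ := h.exists_homologous_of_pullback hη' (fun _ _ _ _ ↦ rfl)
    (hκ.reorder_mem_pieceC ha) (by
      rw [hκ.diffC_reorder]
      exact hκ.reorder_mem_ideal hη hη' (fun _ _ _ _ ↦ rfl) hda)
  refine ⟨b, hb, ?_, reorder κ' c, hκ'.reorder_mem_pieceC hc, ?_⟩
  · have h1 := diffC_mem_ideal e
    rw [map_sub, map_sub, diffC_diffC hc, sub_zero, hκ.diffC_reorder] at h1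
    have h2 := sub_mem (hκ.reorder_mem_ideal hη hη' (fun _ _ _ _ ↦ rfl) hda) h1
    rw [sub_sub_cancel, ← mapC_diffC f h.f_d] at h2
    have h3 := mapC_mem_ideal (τ' := τ) hη' g (fun _ _ _ _ ↦ rfl) h2
    rwa [mapC_mapC_of_leftInverse h.g_f] at h3
  · have h1 := hκ'.reorder_mem_ideal hη' hη (fun _ _ _ _ ↦ rfl) e
    rwa [map_sub, map_sub, hκ.reorder_reorder κ' hneg, ← hκ'.diffC_reorder,
      reorder_mapC κ' f fun p q v w ↦ by rw [hneg, hf0, neg_zero]] at h1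

/-- An element of the quantization of `V` that becomes a boundary in that of `W` is a boundary: `g`
induces a retraction after reordering. -/
theorem exists_boundary {n : ℤ} {a : TC V} {c : TC W} (hc : c ∈ pieceC W (n + 1))
    (hac : mapC f a - diffC W c ∈ ideal η) :
    ∃ b ∈ pieceC V (n + 1), a - diffC V b ∈ ideal τ := by
  have hη' := h.isPoisson_pullback hτ
  have hκ := hη.sub hη'
  refine ⟨mapC g (reorder _ c), mapC_mem_pieceC g (hκ.reorder_mem_pieceC hc), ?_⟩
  have h1 := hκ.reorder_mem_ideal hη hη' (fun _ _ _ _ ↦ rfl) hac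
  rw [map_sub, reorder_mapC _ f fun p q v w ↦ by simp [hητ, h.g_f], ← hκ.diffC_reorder] at h1
  have h2 := mapC_mem_ideal (τ' := τ) hη' g (fun _ _ _ _ ↦ rfl) h1
  rwa [map_sub, mapC_mapC_of_leftInverse h.g_f, mapC_diffC g h.g_d] at h2

/-- The inclusion of a deformation retract induces a weak equivalence of quantizations. -/
theorem weakEquiv : DGStarAlg.WeakEquiv (CCR V τ) (CCR W η) := by
  refine ⟨mapHom hτ h.f_d hητ, quasiIso_of_cycles _ ?_ ?_⟩
  · intro n x y _ hxy
    obtain ⟨x, rfl⟩ := Submodule.mkQ_surjective _ x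
    obtain ⟨y, rfl⟩ := Submodule.mkQ_surjective _ y
    have h1 := hxy.trans (cx_d_add_one n y (diffC_mem_pieceC_add_one y.2))
    obtain ⟨b, hb, hxb⟩ := h.exists_boundary hτ hη hητ y.2
      ((Submodule.Quotient.eq (idealPiece η n)).1 h1)
    refine ⟨CCR.mk τ (n + 1) ⟨b, hb⟩, Eq.trans ?_
      (cx_d_add_one n _ (diffC_mem_pieceC_add_one hb)).symm⟩
    exact (Submodule.Quotient.eq (idealPiece τ n)).2 hxb
  · intro n x hx
    obtain ⟨x, rfl⟩ := Submodule.mkQ_surjective _ x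
    have h1 := (cx_d η n x).symm.trans hx
    obtain ⟨b, hb, hdb, c, hc, e⟩ :=
      h.exists_homologous hτ hη hητ x.2
        ((Submodule.Quotient.mk_eq_zero (idealPiece η (n - 1))).1 h1)
    refine ⟨CCR.mk τ n ⟨b, hb⟩, (cx_d τ n _).trans (mk_eq_zero τ hdb), CCR.mk η (n + 1) ⟨c, hc⟩, ?_⟩
    have h2 := cx_d_add_one (τ := η) n ⟨c, hc⟩ (diffC_mem_pieceC_add_one hc)
    refine Eq.trans ?_ (congrArg _ h2.symm)
    refine (Submodule.Quotient.eq (idealPiece η n)).2 ?_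
    change x.1 - (mapC f b + diffC W c) ∈ ideal η
    rwa [← sub_sub]

end IsDeformationRetract
end CCR

namespace CCR

variable (V : ChainComplex (ModuleCat.{v} ℝ) ℤ)

/-! ### The mapping cylinder -/

/-- The differential `(v, x, y) ↦ (d v, d x + y, -d y)` of the mapping cylinder. -/
noncomputable def cylD (n : ℤ) : (V.X n × V.X n × V.X (n - 1)) →ₗ[ℝ]
    (V.X (n - 1) × V.X (n - 1) × V.X (n - 1 - 1)) :=
  let d := (V.d n (n - 1)).hom
  (d ∘ₗ LinearMap.fst ℝ _ _).prod
    ((d ∘ₗ LinearMap.fst ℝ _ _ ∘ₗ LinearMap.snd ℝ _ _ +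
      LinearMap.snd ℝ _ _ ∘ₗ LinearMap.snd ℝ _ _).prod
    (-(V.d (n - 1) (n - 1 - 1)).hom ∘ₗ LinearMap.snd ℝ _ _ ∘ₗ LinearMap.snd ℝ _ _))

theorem d_d_apply (n : ℤ) (x : V.X n) :
    V.d (n - 1) (n - 1 - 1) (V.d n (n - 1) x) = 0 := by
  rw [← ConcreteCategory.comp_apply, V.d_comp_d]
  rfl

theorem cylD_cylD (n : ℤ) (x : V.X n × V.X n × V.X (n - 1)) : cylD V (n - 1) (cylD V n x) = 0 := by
  obtain ⟨v, x, y⟩ := x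
  change ((V.d (n - 1) (n - 1 - 1) (V.d n (n - 1) v),
    V.d (n - 1) (n - 1 - 1) (V.d n (n - 1) x + y) + -(V.d (n - 1) (n - 1 - 1) y),
    -(V.d (n - 1 - 1) (n - 1 - 1 - 1) (-(V.d (n - 1) (n - 1 - 1) y)))) :
      V.X (n - 1 - 1) × V.X (n - 1 - 1) × V.X (n - 1 - 1 - 1)) = 0
  rw [map_add, map_neg, d_d_apply, d_d_apply, d_d_apply, zero_add, add_neg_cancel, neg_zero,
    neg_zero]
  rfl

/-- The mapping cylinder of the identity of `V`, in the form `V ⊕ cone(id)`: in degree `n` it is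
`V_n ⊕ V_n ⊕ V_{n-1}`. -/
noncomputable def cyl : ChainComplex (ModuleCat.{v} ℝ) ℤ where
  X n := ModuleCat.of ℝ (V.X n × V.X n × V.X (n - 1))
  d i j := if h : i - 1 = j then ModuleCat.ofHom (cylD V i) ≫ eqToHom (by rw [h]) else 0
  shape i j hij := dif_neg fun h ↦ hij (show j + 1 = i by omega)
  d_comp_d' i j k hij hjk := by
    have hij' : j + 1 = i := hij
    have hjk' : k + 1 = j := hjk
    obtain rfl : i - 1 = j := by omega
    obtain rfl : i - 1 - 1 = k := by omega
    rw [dif_pos rfl, dif_pos rfl, eqToHom_refl, eqToHom_refl, Category.comp_id, Category.comp_id]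
    exact ModuleCat.hom_ext (LinearMap.ext fun x ↦ cylD_cylD V i x)

theorem cyl_d (n : ℤ) : (cyl V).d n (n - 1) = ModuleCat.ofHom (cylD V n) := by
  simp [cyl]

variable {V}

theorem cyl_d_apply (n : ℤ) (v x : V.X n) (y : V.X (n - 1)) :
    (cyl V).d n (n - 1) (v, x, y) =
      ((V.d n (n - 1) v, V.d n (n - 1) x + y, -V.d (n - 1) (n - 1 - 1) y) :
        V.X (n - 1) × V.X (n - 1) × V.X (n - 1 - 1)) := by
  rw [cyl_d]
  rfl

variable (V)

/-- The identification of `V_p` with `V_{q-1}` for `p = q - 1`. -/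
noncomputable def shift (p q : ℤ) : V.X p →ₗ[ℝ] V.X (q - 1) :=
  if h : p = q - 1 then (eqToHom (by rw [h]) : V.X p ⟶ V.X (q - 1)).hom else 0

theorem shift_self (q : ℤ) (x : V.X (q - 1)) : shift V (q - 1) q x = x := by
  simp [shift]

/-- The projection of the cylinder to its first summand. -/
noncomputable def cylFst (p : ℤ) : (cyl V).X p →ₗ[ℝ] V.X p := LinearMap.fst ℝ _ _

/-- The projection of the cylinder to its second summand; it is not a chain map. -/
noncomputable def cylSnd (p : ℤ) : (cyl V).X p →ₗ[ℝ] V.X p :=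
  LinearMap.fst ℝ _ (V.X (p - 1)) ∘ₗ LinearMap.snd ℝ (V.X p) _

/-- For `c = 0` and `c = 1`, the inclusions `v ↦ (v, c v, 0)` of the two ends of the cylinder. -/
noncomputable def cylIncl (c : ℝ) (p : ℤ) : V.X p →ₗ[ℝ] (cyl V).X p :=
  LinearMap.prod LinearMap.id (LinearMap.prod (c • LinearMap.id) (0 : V.X p →ₗ[ℝ] V.X (p - 1)))

/-- The homotopy `(v, x, y) ↦ (0, 0, x - c v)`. -/
noncomputable def cylHomotopy (c : ℝ) (p q : ℤ) : (cyl V).X p →ₗ[ℝ] (cyl V).X q :=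
  LinearMap.inr ℝ (V.X q) (V.X q × V.X (q - 1)) ∘ₗ LinearMap.inr ℝ (V.X q) (V.X (q - 1)) ∘ₗ
    shift V p q ∘ₗ (cylSnd V p - c • cylFst V p)

theorem isDeformationRetract_cyl (c : ℝ) :
    IsDeformationRetract (cylIncl V c) (cylFst V) (cylHomotopy V c) where
  f_d p v := by
    refine Eq.trans ?_ (cyl_d_apply p v (c • v) 0).symm
    change ((V.d p (p - 1) v, c • V.d p (p - 1) v, 0) :
      V.X (p - 1) × V.X (p - 1) × V.X (p - 1 - 1)) = _
    rw [map_smul, add_zero, map_zero, neg_zero]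
  g_d p x := by
    obtain ⟨v, x, y⟩ := x
    exact congrArg Prod.fst (cyl_d_apply p v x y)
  g_f _ _ := rfl
  g_s _ _ := rfl
  d_s := by
    suffices ∀ m n k, m - 1 = n → n - 1 = k → ∀ x : (cyl V).X n,
        (cyl V).d m n (cylHomotopy V c n m x) + cylHomotopy V c k n ((cyl V).d n k x) =
          x - cylIncl V c n (cylFst V n x) from
      fun p x ↦ this (p + 1) p (p - 1) (by omega) rfl x
    rintro m _ _ rfl rfl ⟨v, x, y⟩
    have h1 : cylHomotopy V c (m - 1) m (v, x, y) =
        ((0, 0, x - c • v) : V.X m × V.X m × V.X (m - 1)) := by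
      change ((0, 0, shift V (m - 1) m (x - c • v)) : V.X m × V.X m × V.X (m - 1)) = _
      rw [shift_self]
    have h2 : cylHomotopy V c (m - 1 - 1) (m - 1) ((V.d (m - 1) (m - 1 - 1) v,
        V.d (m - 1) (m - 1 - 1) x + y, -V.d (m - 1 - 1) (m - 1 - 1 - 1) y) :
          V.X (m - 1 - 1) × V.X (m - 1 - 1) × V.X (m - 1 - 1 - 1)) =
        ((0, 0, V.d (m - 1) (m - 1 - 1) x + y - c • V.d (m - 1) (m - 1 - 1) v) :
          V.X (m - 1) × V.X (m - 1) × V.X (m - 1 - 1)) := by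
      change ((0, 0, shift V (m - 1 - 1) (m - 1) (V.d (m - 1) (m - 1 - 1) x + y -
        c • V.d (m - 1) (m - 1 - 1) v)) : V.X (m - 1) × V.X (m - 1) × V.X (m - 1 - 1)) = _
      rw [shift_self]
    have h3 := cyl_d_apply m (0 : V.X m) 0 (x - c • v)
    rw [map_zero, zero_add] at h3
    rw [h1]
    refine (congrArg₂ (· + ·) h3 ((congrArg _ (cyl_d_apply (m - 1) v x y)).trans h2)).trans ?_
    change ((0 + 0, x - c • v + 0, -(V.d (m - 1) (m - 1 - 1) (x - c • v)) +
      (V.d (m - 1) (m - 1 - 1) x + y - c • V.d (m - 1) (m - 1 - 1) v)) :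
        V.X (m - 1) × V.X (m - 1) × V.X (m - 1 - 1)) = (v - v, x - c • v, y - 0)
    rw [map_sub, map_smul]
    refine Prod.ext ?_ (Prod.ext ?_ ?_)
    · simp
    · simp
    · dsimp only
      abel

/-! ### Homotopic Poisson structures -/

variable {V}

/-- The boundary `(∂ρ)(a, b) = ρ(d a, b) + (-1)^{|a|} ρ(a, d b)` of a family of bilinear forms. -/
noncomputable def boundary (ρ : ∀ p q : ℤ, V.X p →ₗ[ℝ] V.X q →ₗ[ℝ] ℝ) (p q : ℤ) :
    V.X p →ₗ[ℝ] V.X q →ₗ[ℝ] ℝ :=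
  ρ (p - 1) q ∘ₗ (V.d p (p - 1)).hom +
    ((-1 : ℝ) ^ p) • (ρ p (q - 1)).compl₂ (V.d q (q - 1)).hom

theorem boundary_apply (ρ : ∀ p q : ℤ, V.X p →ₗ[ℝ] V.X q →ₗ[ℝ] ℝ) (p q : ℤ) (v : V.X p)
    (w : V.X q) : boundary ρ p q v w = ρ (p - 1) q (V.d p (p - 1) v) w +
      (-1 : ℝ) ^ p * ρ p (q - 1) v (V.d q (q - 1) w) := rfl

theorem IsPoisson.add {τ τ' : ∀ p q : ℤ, V.X p →ₗ[ℝ] V.X q →ₗ[ℝ] ℝ} (hτ : IsPoisson τ)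
    (hτ' : IsPoisson τ') : IsPoisson fun p q ↦ τ p q + τ' p q where
  degree p q hpq v w := by
    rw [LinearMap.add_apply, LinearMap.add_apply, hτ.degree p q hpq, hτ'.degree p q hpq, add_zero]
  antisymm p q v w := by
    simp only [LinearMap.add_apply]
    rw [hτ.antisymm, hτ'.antisymm]
    ring
  chain p q v w := by
    simp only [LinearMap.add_apply]
    linear_combination hτ.chain p q v w + hτ'.chain p q v w

theorem neg_one_zpow_mul_self_real (n : ℤ) : (-1 : ℝ) ^ n * (-1 : ℝ) ^ n = 1 := by
  rw [← zpow_add₀ (by norm_num), Even.neg_one_zpow ⟨n, rfl⟩]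

theorem neg_one_zpow_sub_real (m n : ℤ) : (-1 : ℝ) ^ (m - n) = (-1 : ℝ) ^ m * (-1 : ℝ) ^ n := by
  rw [← zpow_add₀ (by norm_num)]
  exact sgn_congr ⟨-n, by ring⟩

/-- The boundary of a graded antisymmetric form `ρ : V ⊗ V → ℝ` of degree one is a Poisson
structure. -/
theorem isPoisson_boundary {ρ : ∀ p q : ℤ, V.X p →ₗ[ℝ] V.X q →ₗ[ℝ] ℝ}
    (hdeg : ∀ p q, p + q ≠ -1 → ∀ v w, ρ p q v w = 0)
    (hanti : ∀ p q v w, ρ p q v w = -((-1 : ℝ) ^ (p * q) * ρ q p w v)) :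
    IsPoisson (boundary ρ) where
  degree p q hpq v w := by
    rw [boundary_apply, hdeg _ _ (by omega), hdeg _ _ (by omega), mul_zero, add_zero]
  antisymm p q v w := by
    have h1 := hanti (p - 1) q (V.d p (p - 1) v) w
    have h2 := hanti p (q - 1) v (V.d q (q - 1) w)
    have h3 : (-1 : ℝ) ^ ((p - 1) * q) = (-1 : ℝ) ^ (p * q) * (-1 : ℝ) ^ q := by
      rw [← neg_one_zpow_sub_real]; ring_nf
    have h4 : (-1 : ℝ) ^ (p * (q - 1)) = (-1 : ℝ) ^ (p * q) * (-1 : ℝ) ^ p := by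
      rw [← neg_one_zpow_sub_real]; ring_nf
    rw [h3] at h1
    rw [h4] at h2
    rw [boundary_apply, boundary_apply]
    linear_combination h1 + (-1 : ℝ) ^ p * h2 -
      (-1 : ℝ) ^ (p * q) * ρ (q - 1) p (V.d q (q - 1) w) v * neg_one_zpow_mul_self_real p
  chain p q v w := by
    have h1 : (-1 : ℝ) ^ (p - 1) = -(-1 : ℝ) ^ p := by
      rw [neg_one_zpow_sub_real, zpow_one, mul_neg_one]
    rw [boundary_apply, boundary_apply, d_d_apply, d_d_apply, map_zero, map_zero,
      LinearMap.zero_apply, h1]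
    ring

/-- Poisson structures that differ by the boundary of a graded antisymmetric form of degree one
have weakly equivalent quantizations: both extend to one Poisson structure on the mapping cylinder,
of which `V` is a deformation retract in two ways. -/
theorem zigZag_of_boundary {τ τ' : ∀ p q : ℤ, V.X p →ₗ[ℝ] V.X q →ₗ[ℝ] ℝ} (hτ : IsPoisson τ)
    (hτ' : IsPoisson τ') {ρ : ∀ p q : ℤ, V.X p →ₗ[ℝ] V.X q →ₗ[ℝ] ℝ}
    (hdeg : ∀ p q, p + q ≠ -1 → ∀ v w, ρ p q v w = 0)
    (hanti : ∀ p q v w, ρ p q v w = -((-1 : ℝ) ^ (p * q) * ρ q p w v))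
    (h : ∀ p q v w, τ' p q v w = τ p q v w + boundary ρ p q v w) :
    DGStarAlg.ZigZag (CCR V τ) (CCR V τ') := by
  let ρ' : ∀ p q : ℤ, (cyl V).X p →ₗ[ℝ] (cyl V).X q →ₗ[ℝ] ℝ := fun p q ↦
    (ρ p q).compl₁₂ (cylSnd V p) (cylSnd V q)
  have hη : IsPoisson fun p q ↦ (τ p q).compl₁₂ (cylFst V p) (cylFst V q) + boundary ρ' p q :=
    ((isDeformationRetract_cyl V 0).isPoisson_pullback hτ).add
      (isPoisson_boundary (fun p q hpq _ _ ↦ hdeg p q hpq _ _) fun p q _ _ ↦ hanti p q _ _)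
  have key (c : ℝ) (p q v w) : (τ p q).compl₁₂ (cylFst V p) (cylFst V q) (cylIncl V c p v)
      (cylIncl V c q w) + boundary ρ' p q (cylIncl V c p v) (cylIncl V c q w) =
      τ p q v w + c * c * boundary ρ p q v w := by
    rw [boundary_apply, boundary_apply, ← (isDeformationRetract_cyl V c).f_d,
      ← (isDeformationRetract_cyl V c).f_d]
    have hs (p q v w) : ρ' p q (cylIncl V c p v) (cylIncl V c q w) = c * c * ρ p q v w := by
      change ρ p q (c • v) (c • w) = _
      rw [map_smul, map_smul, LinearMap.smul_apply, smul_eq_mul, smul_eq_mul, mul_assoc]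
    rw [hs, hs]
    change τ p q v w + _ = _
    ring
  have h0 := (isDeformationRetract_cyl V 0).weakEquiv hτ hη fun p q v w ↦
    (key 0 p q v w).trans (by ring)
  have h1 := (isDeformationRetract_cyl V 1).weakEquiv hτ' hη fun p q v w ↦
    (key 1 p q v w).trans (by rw [h]; ring)
  exact (Relation.EqvGen.rel _ _ h0).trans _ _ _ ((Relation.EqvGen.rel _ _ h1).symm _ _)

/-- The antisymmetry of the form in `zigZag_of_boundary` can be dropped, since the antisymmetric
part of a form has the antisymmetric part of its boundary as its boundary. -/
theorem zigZag_of_eq_add_boundary {τ τ' : ∀ p q : ℤ, V.X p →ₗ[ℝ] V.X q →ₗ[ℝ] ℝ} (hτ : IsPoisson τ)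
    (hτ' : IsPoisson τ') {ρ : ∀ p q : ℤ, V.X p →ₗ[ℝ] V.X q →ₗ[ℝ] ℝ}
    (hdeg : ∀ p q, p + q ≠ -1 → ∀ v w, ρ p q v w = 0)
    (h : ∀ p q v w, τ' p q v w = τ p q v w + boundary ρ p q v w) :
    DGStarAlg.ZigZag (CCR V τ) (CCR V τ') := by
  let ρ' : ∀ p q : ℤ, V.X p →ₗ[ℝ] V.X q →ₗ[ℝ] ℝ := fun p q ↦
    (1 / 2 : ℝ) • (ρ p q - ((-1 : ℝ) ^ (p * q)) • (ρ q p).flip)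
  have hρ' (p q v w) : ρ' p q v w = 1 / 2 * (ρ p q v w - (-1 : ℝ) ^ (p * q) * ρ q p w v) := rfl
  refine zigZag_of_boundary hτ hτ' (ρ := ρ') (fun p q hpq v w ↦ ?_) (fun p q v w ↦ ?_)
    fun p q v w ↦ ?_
  · rw [hρ', hdeg p q hpq, hdeg q p (by omega), mul_zero, sub_zero, mul_zero]
  · rw [hρ', hρ', mul_comm q p]
    linear_combination -(1 / 2 * ρ p q v w) * neg_one_zpow_mul_self_real (p * q)
  · have h1 := h p q v w
    have h2 := h q p w v
    have h3 := hτ.antisymm p q v w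
    have h4 := hτ'.antisymm p q v w
    have h5 : (-1 : ℝ) ^ ((p - 1) * q) = (-1 : ℝ) ^ (p * q) * (-1 : ℝ) ^ q := by
      rw [← neg_one_zpow_sub_real]; ring_nf
    have h6 : (-1 : ℝ) ^ (p * (q - 1)) = (-1 : ℝ) ^ (p * q) * (-1 : ℝ) ^ p := by
      rw [← neg_one_zpow_sub_real]; ring_nf
    rw [boundary_apply] at h1 h2 ⊢
    rw [hρ', hρ', h5, h6]
    linear_combination 1 / 2 * h1 - 1 / 2 * (-1 : ℝ) ^ (p * q) * h2 - 1 / 2 * h3 + 1 / 2 * h4 +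
      1 / 2 * (-1 : ℝ) ^ (p * q) * ρ (q - 1) p (V.d q (q - 1) w) v * neg_one_zpow_mul_self_real p

end CCR

/-! ### The difference of two propagators -/

/-- The relation `d Λ + Λ d = id` of a contracting homotopy, at the level of elements. -/
theorem homotopy_zero_apply {K : ChainComplex (ModuleCat.{v} ℝ) ℤ} (Λ : Homotopy (𝟙 K) 0)
    {m n t : ℤ} (hm : m = n + 1) (hn : n = t + 1) (x : K.X n) :
    K.d m n (Λ.hom n m x) + Λ.hom t n (K.d n t x) = x := by
  have h := Λ.comm n
  rw [dNext_eq Λ.hom (show (ComplexShape.down ℤ).Rel n t from hn.symm),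
    prevD_eq Λ.hom (show (ComplexShape.down ℤ).Rel m n from hm.symm)] at h
  have h1 := ConcreteCategory.congr_hom h x
  simp only [HomologicalComplex.id_f, HomologicalComplex.zero_f, add_zero] at h1
  exact (add_comm _ _).trans h1.symm

/-- The position opposite to a given one. -/
def Slot.opp : Slot → Slot
  | .a => .d
  | .b => .c
  | .c => .b
  | .d => .a
  | .z => .z

theorem slot_opp {m n : ℤ} (h : m + n = 3) : slot m = (slot n).opp := by
  unfold slot
  split_ifs <;> first | rfl | omega

theorem pairing_neg_left {m : ℕ} {M : Type*} [TopologicalSpace M]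
    [ChartedSpace (EuclideanSpace ℝ (Fin m)) M] [IsManifold (𝓡 m) ∞ M] [T2Space M]
    [SigmaCompactSpace M] [MeasurableSpace M] [BorelSpace M] {S : Spacetime m M}
    {F : Type*} [NormedAddCommGroup F] [NormedSpace ℝ F]
    {V : M → Type*} [TopologicalSpace (TotalSpace F V)] [∀ x, TopologicalSpace (V x)]
    [∀ x, AddCommGroup (V x)] [∀ x, Module ℝ (V x)] [∀ x, IsTopologicalAddGroup (V x)]
    [∀ x, ContinuousSMul ℝ (V x)] [FiberBundle F V] [VectorBundle ℝ F V]
    (h : FiberMetric (m := m) F V) (s t : Cₛ^∞⟮𝓡 m; F, V⟯) :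
    pairing S h (-s) t = -pairing S h s t := by
  simp [pairing, integral_neg]

namespace GaugeTheory

set_option linter.unusedSectionVars false

variable {m : ℕ} {M : Type u} [TopologicalSpace M] [ChartedSpace (EuclideanSpace ℝ (Fin m)) M]
  [IsManifold (𝓡 m) ∞ M] [T2Space M] [SigmaCompactSpace M] [MeasurableSpace M] [BorelSpace M]
  {F₀ : Type w} [NormedAddCommGroup F₀] [NormedSpace ℝ F₀] [FiniteDimensional ℝ F₀]
  {V₀ : M → Type v} [TopologicalSpace (TotalSpace F₀ V₀)] [∀ x, TopologicalSpace (V₀ x)]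
  [∀ x, AddCommGroup (V₀ x)] [∀ x, Module ℝ (V₀ x)] [∀ x, IsTopologicalAddGroup (V₀ x)]
  [∀ x, ContinuousSMul ℝ (V₀ x)] [FiberBundle F₀ V₀] [VectorBundle ℝ F₀ V₀]
  [ContMDiffVectorBundle ∞ F₀ V₀ (𝓡 m)]
  {F₁ : Type w'} [NormedAddCommGroup F₁] [NormedSpace ℝ F₁] [FiniteDimensional ℝ F₁]
  {V₁ : M → Type v} [TopologicalSpace (TotalSpace F₁ V₁)] [∀ x, TopologicalSpace (V₁ x)]
  [∀ x, AddCommGroup (V₁ x)] [∀ x, Module ℝ (V₁ x)] [∀ x, IsTopologicalAddGroup (V₁ x)]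
  [∀ x, ContinuousSMul ℝ (V₁ x)] [FiberBundle F₁ V₁] [VectorBundle ℝ F₁ V₁]
  [ContMDiffVectorBundle ∞ F₁ V₁ (𝓡 m)]
  {S : Spacetime m M} {h₀ : FiberMetric (m := m) F₀ V₀} {h₁ : FiberMetric (m := m) F₁ V₁}
  (T : GaugeTheory S h₀ h₁)

/-- The differential of `𝔏_k(M)` between two positions. -/
noncomputable abbrev obsD (k : SuppKind) (i j : Slot) :=
  slotD (-T.Q.restrict (T.isDiffOp_Q.mem_sec S (k := k))) (T.P.restrict (T.isDiffOp_P.mem_sec S))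
    (-T.Qs.restrict (T.adjoint_Q.1.mem_sec S)) i j

/-- The differential of `𝔖𝔬𝔩(M)` between two positions. -/
noncomputable abbrev solD (i j : Slot) := slotD T.Q T.P T.Qs i j

theorem jSlot_eq_zero (k : SuppKind) {i j : Slot} (h : i ≠ j) :
    jSlot (F₀ := F₀) (V₀ := V₀) (F₁ := F₁) (V₁ := V₁) S k i j = 0 := by
  cases i <;> cases j <;> first | exact absurd rfl h | rfl

/-- The composite `j_k ι` does not depend on the support condition `k`. -/
theorem jSlot_inclSlot (k : SuppKind) (i : Slot)
    (x : slotX (sec F₁ V₁ S .c) (sec F₀ V₀ S .c) (sec F₀ V₀ S .c) (sec F₁ V₁ S .c) i) :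
    jSlot S k i i (inclSlot S k i x) = jSlot S .c i i x := by
  cases i with
  | a => exact congrArg Neg.neg (Submodule.coe_inclusion (secC_le_sec S k) x)
  | b => exact congrArg Neg.neg (Submodule.coe_inclusion (secC_le_sec S k) x)
  | c => exact Submodule.coe_inclusion (secC_le_sec S k) x
  | d => exact Submodule.coe_inclusion (secC_le_sec S k) x
  | z => exact LinearMap.zero_apply _

theorem inclSlot_obsD (k : SuppKind) (i j : Slot)
    (x : slotX (sec F₁ V₁ S .c) (sec F₀ V₀ S .c) (sec F₀ V₀ S .c) (sec F₁ V₁ S .c) i) :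
    inclSlot S k j (T.obsD .c i j x) = T.obsD k i j (inclSlot S k i x) := by
  have hz : ∀ i j x, (∀ k, T.obsD k i j = 0) →
      inclSlot S k j (T.obsD .c i j x) = T.obsD k i j (inclSlot S k i x) := by
    intro i j x h
    rw [h, h]
    exact map_zero _
  cases i <;> cases j <;> first | exact hz _ _ x fun _ ↦ rfl | skip
  · exact Subtype.ext rfl
  · exact Subtype.ext rfl
  · exact Subtype.ext rfl

theorem solD_jSlot (k : SuppKind) (i j : Slot)
    (x : slotX (sec F₁ V₁ S k) (sec F₀ V₀ S k) (sec F₀ V₀ S k) (sec F₁ V₁ S k) i) :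
    T.solD i j (jSlot S k i i x) = -jSlot S k j j (T.obsD k i j x) := by
  have hz : ∀ i j x, T.solD i j = 0 → T.obsD k i j = 0 →
      T.solD i j (jSlot S k i i x) = -jSlot S k j j (T.obsD k i j x) := by
    intro i j x h h'
    rw [h, h']
    exact neg_zero.symm.trans (congrArg Neg.neg (map_zero (jSlot S k j j)).symm)
  cases i <;> cases j <;> first | exact hz _ _ x rfl rfl | skip
  · change T.Q (-x.1) = -(-(-T.Q x.1))
    rw [neg_neg, map_neg]
  · change T.P (-x.1) = -T.P x.1
    rw [map_neg]
  · change T.Qs x.1 = -(-T.Qs x.1)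
    rw [neg_neg]

theorem incl_d (k : SuppKind) (n n' : ℤ) (x : T.linObs.X n) :
    T.incl k n' (T.linObs.d n n' x) = (T.obs k).d n n' (T.incl k n x) :=
  T.inclSlot_obsD k _ _ x

theorem j_incl (n n' : ℤ) (x : T.linObs.X n) :
    T.j .pc n n' (T.incl .pc n x) = T.j .fc n n' (T.incl .fc n x) := by
  have key : ∀ (i j : Slot)
      (x : slotX (sec F₁ V₁ S .c) (sec F₀ V₀ S .c) (sec F₀ V₀ S .c) (sec F₁ V₁ S .c) i),
      jSlot S .pc i j (inclSlot S .pc i x) = jSlot S .fc i j (inclSlot S .fc i x) := by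
    intro i j x
    by_cases h : i = j
    · subst h
      rw [jSlot_inclSlot, jSlot_inclSlot]
    · rw [jSlot_eq_zero _ h, jSlot_eq_zero _ h]
      rfl
  exact key _ _ x

/-- `j_k` anticommutes with the differentials, as it takes values in the shift of `𝔖𝔬𝔩(M)`. -/
theorem d_j (k : SuppKind) {n m n' m' : ℤ} (h : n = m + 1) (h' : n' = m' + 1)
    (x : (T.obs k).X n) :
    T.sol.d m m' (T.j k n m x) = -T.j k n' m' ((T.obs k).d n n' x) := by
  have key : ∀ (i i' j j' : Slot) (_ : i = i') (_ : j = j')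
      (x : slotX (sec F₁ V₁ S k) (sec F₀ V₀ S k) (sec F₀ V₀ S k) (sec F₁ V₁ S k) i),
      T.solD i' j' (jSlot S k i i' x) = -jSlot S k j j' (T.obsD k i j x) := by
    intro i i' j j' hi hj x
    subst hi hj
    exact T.solD_jSlot k i j x
  exact key (slot (2 - n)) (slot (1 - m)) (slot (2 - n')) (slot (1 - m'))
    (congrArg slot (by omega))
    (congrArg slot (by omega)) x

theorem pairing_P_left {x : Cₛ^∞⟮𝓡 m; F₀, V₀⟯} (hx : x ∈ secC F₀ V₀) (y : Cₛ^∞⟮𝓡 m; F₀, V₀⟯) :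
    pairing S h₀ (T.P x) y = pairing S h₀ x (T.P y) :=
  (T.adjoint_P.2 y x (IsCompact.inter_right hx isClosed_closure)).symm

theorem pairing_Qs_left {x : Cₛ^∞⟮𝓡 m; F₀, V₀⟯} (hx : x ∈ secC F₀ V₀) (y : Cₛ^∞⟮𝓡 m; F₁, V₁⟯) :
    pairing S h₁ (T.Qs x) y = pairing S h₀ x (T.Q y) :=
  (T.adjoint_Q.2 y x (IsCompact.inter_right hx isClosed_closure)).symm

theorem pairing_Q_left {x : Cₛ^∞⟮𝓡 m; F₁, V₁⟯} (hx : x ∈ secC F₁ V₁) (y : Cₛ^∞⟮𝓡 m; F₀, V₀⟯) :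
    pairing S h₀ (T.Q x) y = pairing S h₁ x (T.Qs y) := by
  rw [pairing_comm, T.adjoint_Q.2 x y (IsCompact.inter_left hx isClosed_closure), pairing_comm]

/-- The pairings are compatible with the differentials: `Q` and `Q^*` are formally adjoint and `P`
is formally self-adjoint. -/
theorem evalSlot_d (s : ℝ) (i j : Slot) (ha : i = .a → s = 1) (hb : i = .b → s = -1)
    (hc : i = .c → s = 1)
    (x : slotX (sec F₁ V₁ S .c) (sec F₀ V₀ S .c) (sec F₀ V₀ S .c) (sec F₁ V₁ S .c) i)
    (y : slotX Cₛ^∞⟮𝓡 m; F₁, V₁⟯ Cₛ^∞⟮𝓡 m; F₀, V₀⟯ Cₛ^∞⟮𝓡 m; F₀, V₀⟯ Cₛ^∞⟮𝓡 m; F₁, V₁⟯ j.opp) :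
    evalSlot S h₀ h₁ j j.opp (T.obsD .c i j x) y +
      s * evalSlot S h₀ h₁ i i.opp x (T.solD j.opp i.opp y) = 0 := by
  have hz : ∀ i j (x : slotX (sec F₁ V₁ S .c) (sec F₀ V₀ S .c) (sec F₀ V₀ S .c) (sec F₁ V₁ S .c) i)
    (y : slotX Cₛ^∞⟮𝓡 m; F₁, V₁⟯ Cₛ^∞⟮𝓡 m; F₀, V₀⟯ Cₛ^∞⟮𝓡 m; F₀, V₀⟯ Cₛ^∞⟮𝓡 m; F₁, V₁⟯ j.opp),
    T.obsD .c i j = 0 → T.solD j.opp i.opp = 0 →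
    evalSlot S h₀ h₁ j j.opp (T.obsD .c i j x) y +
      s * evalSlot S h₀ h₁ i i.opp x (T.solD j.opp i.opp y) = 0 := by
    intro i j x y hi hj
    rw [hi, hj]
    simp
  have hab : ∀ (x : sec F₁ V₁ S .c) (y : Cₛ^∞⟮𝓡 m; F₀, V₀⟯),
      pairing S h₀ (-T.Q x.1) y + 1 * pairing S h₁ x.1 (T.Qs y) = 0 := fun x y ↦ by
    rw [pairing_neg_left, T.pairing_Q_left x.2]
    ring
  have hbc : ∀ (x : sec F₀ V₀ S .c) (y : Cₛ^∞⟮𝓡 m; F₀, V₀⟯),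
      pairing S h₀ (T.P x.1) y + -1 * pairing S h₀ x.1 (T.P y) = 0 := fun x y ↦ by
    rw [T.pairing_P_left x.2]
    ring
  have hcd : ∀ (x : sec F₀ V₀ S .c) (y : Cₛ^∞⟮𝓡 m; F₁, V₁⟯),
      pairing S h₁ (-T.Qs x.1) y + 1 * pairing S h₀ x.1 (T.Q y) = 0 := fun x y ↦ by
    rw [pairing_neg_left, T.pairing_Qs_left x.2]
    ring
  cases i <;> cases j <;> first | exact hz _ _ x y rfl rfl | skip
  · obtain rfl := ha rfl
    exact hab x y
  · obtain rfl := hb rfl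
    exact hbc x y
  · obtain rfl := hc rfl
    exact hcd x y

theorem eval_eq_zero {p q : ℤ} (h : p + q ≠ 0) (a : T.linObs.X p) (b : T.sol.X q) :
    T.eval p q a b = 0 := by
  have key : ∀ i j : Slot, ¬ (i = .a ∧ j = .d) → ¬ (i = .b ∧ j = .c) → ¬ (i = .c ∧ j = .b) →
      ¬ (i = .d ∧ j = .a) → evalSlot S h₀ h₁ i j = 0 := by
    intro i j h1 h2 h3 h4
    cases i <;> cases j <;> first | rfl | simp at h1 h2 h3 h4
  have h0 : T.eval p q = 0 := by
    refine key _ _ ?_ ?_ ?_ ?_ <;> rintro ⟨hi, hj⟩ <;> unfold slot at hi hj <;>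
      split_ifs at hi hj <;> omega
  rw [h0]
  rfl

/-- The evaluation `𝔏(M) ⊗ 𝔖𝔬𝔩(M) → ℝ` is a chain map. -/
theorem eval_d (p q : ℤ) (a : T.linObs.X p) (y : T.sol.X q) :
    T.eval (p - 1) q (T.linObs.d p (p - 1) a) y +
      (-1 : ℝ) ^ p * T.eval p (q - 1) a (T.sol.d q (q - 1) y) = 0 := by
  by_cases h : p + q = 1
  · have key : ∀ (i i' j j' : Slot) (_ : i' = i.opp) (_ : j' = j.opp)
        (_ : i = .a → (-1 : ℝ) ^ p = 1) (_ : i = .b → (-1 : ℝ) ^ p = -1)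
        (_ : i = .c → (-1 : ℝ) ^ p = 1)
        (x : slotX (sec F₁ V₁ S .c) (sec F₀ V₀ S .c) (sec F₀ V₀ S .c) (sec F₁ V₁ S .c) i)
        (y : slotX Cₛ^∞⟮𝓡 m; F₁, V₁⟯ Cₛ^∞⟮𝓡 m; F₀, V₀⟯ Cₛ^∞⟮𝓡 m; F₀, V₀⟯
          Cₛ^∞⟮𝓡 m; F₁, V₁⟯ j'),
        evalSlot S h₀ h₁ j j' (T.obsD .c i j x) y +
          (-1 : ℝ) ^ p * evalSlot S h₀ h₁ i i' x (T.solD j' i' y) = 0 := by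
      intro i i' j j' hi hj ha hb hc x y
      subst hi hj
      exact T.evalSlot_d _ i j ha hb hc x y
    refine key (slot (2 - p)) (slot (1 - (q - 1))) (slot (2 - (p - 1))) (slot (1 - q))
      (slot_opp (by omega)) (slot_opp (by omega)) (fun hi ↦ ?_) (fun hi ↦ ?_) (fun hi ↦ ?_) a y
    · obtain rfl : p = 2 := by
        unfold slot at hi
        split_ifs at hi
        omega
      norm_num
    · obtain rfl : p = 1 := by
        unfold slot at hi
        split_ifs at hi
        omega
      norm_num
    · obtain rfl : p = 0 := by
        unfold slot at hi
        split_ifs at hi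
        omega
      norm_num
  · rw [T.eval_eq_zero (by omega), T.eval_eq_zero (by omega), mul_zero, add_zero]

variable {T}
variable (Λp Λp' : T.RetardedTrivialization) (Λm Λm' : T.AdvancedTrivialization)

/-- The propagator `Λ` is a chain map: the terms `j_pc ι` and `j_fc ι` which come from
`d Λ^± + Λ^± d = id` cancel. -/
theorem d_propagator (q : ℤ) (b : T.linObs.X q) :
    T.sol.d q (q - 1) (propagator Λp Λm q b) =
      propagator Λp Λm (q - 1) (T.linObs.d q (q - 1) b) := by
  have key : ∀ (k : SuppKind) (Λ : Homotopy (𝟙 (T.obs k)) 0) (t r : ℤ) (_ : q = t + 1)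
      (_ : r = q),
      T.sol.d q t (T.j k (q + 1) q (Λ.hom q (q + 1) (T.incl k q b))) =
        T.j k r t (Λ.hom t r (T.incl k t (T.linObs.d q t b))) - T.j k q t (T.incl k q b) := by
    rintro k Λ t r rfl rfl
    have h := homotopy_zero_apply Λ rfl rfl (T.incl k (t + 1) b)
    rw [T.d_j k rfl rfl, T.incl_d, neg_eq_iff_eq_neg, neg_sub, eq_sub_iff_add_eq, ← map_add, h]
  change T.sol.d q (q - 1) (T.j .pc (q + 1) q (Λp.hom q (q + 1) (T.incl .pc q b)) -
    T.j .fc (q + 1) q (Λm.hom q (q + 1) (T.incl .fc q b))) =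
    T.j .pc (q - 1 + 1) (q - 1) (Λp.hom (q - 1) (q - 1 + 1)
      (T.incl .pc (q - 1) (T.linObs.d q (q - 1) b))) -
    T.j .fc (q - 1 + 1) (q - 1) (Λm.hom (q - 1) (q - 1 + 1)
      (T.incl .fc (q - 1) (T.linObs.d q (q - 1) b)))
  rw [map_sub, key .pc Λp (q - 1) (q - 1 + 1) (by omega) (by omega),
    key .fc Λm (q - 1) (q - 1 + 1) (by omega) (by omega), T.j_incl]
  abel

variable {Λp Λp' Λm Λm'}

/-- Antisymmetry of `⟨a, Λ b⟩` is compatibility of the trivializations. -/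
theorem isPoisson_poisson (hΛ : Compatible Λp Λm) : CCR.IsPoisson (poisson Λp Λm) where
  degree p q h v w := T.eval_eq_zero h v _
  antisymm p q v w := hΛ p q v w
  chain p q v w := by
    have h := T.eval_d p q v (propagator Λp Λm q w)
    rw [d_propagator] at h
    exact h

variable (Λp Λp' Λm Λm')

/-- The components of the map `j_pc Λ⁺ (Λ̃⁺ - Λ⁺) ι - j_fc Λ⁻ (Λ̃⁻ - Λ⁻) ι`, whose boundary is
the difference of the two propagators. -/
noncomputable def propagatorHomotopy (q r : ℤ) : T.linObs.X q →ₗ[ℝ] T.sol.X r :=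
  T.j .pc (r + 1) r ∘ₗ (Λp.hom r (r + 1)).hom ∘ₗ (Λp'.hom q r - Λp.hom q r).hom ∘ₗ T.incl .pc q -
    T.j .fc (r + 1) r ∘ₗ (Λm.hom r (r + 1)).hom ∘ₗ (Λm'.hom q r - Λm.hom q r).hom ∘ₗ T.incl .fc q

theorem d_propagatorHomotopy (q : ℤ) (b : T.linObs.X q) :
    T.sol.d (q + 1) q (propagatorHomotopy Λp Λp' Λm Λm' q (q + 1) b) +
      propagatorHomotopy Λp Λp' Λm Λm' (q - 1) q (T.linObs.d q (q - 1) b) =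
    -(propagator Λp' Λm' q b - propagator Λp Λm q b) := by
  have key : ∀ (k : SuppKind) (Λ Λ' : Homotopy (𝟙 (T.obs k)) 0) (t : ℤ) (_ : q = t + 1),
      T.sol.d (q + 1) q (T.j k (q + 1 + 1) (q + 1) (Λ.hom (q + 1) (q + 1 + 1)
        ((Λ'.hom q (q + 1)).hom (T.incl k q b) - (Λ.hom q (q + 1)).hom (T.incl k q b)))) +
        T.j k (q + 1) q (Λ.hom q (q + 1) ((Λ'.hom t q).hom (T.incl k t (T.linObs.d q t b)) -
          (Λ.hom t q).hom (T.incl k t (T.linObs.d q t b)))) =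
      -(T.j k (q + 1) q ((Λ'.hom q (q + 1)).hom (T.incl k q b)) -
        T.j k (q + 1) q ((Λ.hom q (q + 1)).hom (T.incl k q b))) := by
    rintro k Λ Λ' t rfl
    have h := homotopy_zero_apply Λ rfl rfl (T.incl k (t + 1) b)
    have h' := homotopy_zero_apply Λ' rfl rfl (T.incl k (t + 1) b)
    rw [← T.incl_d] at h h'
    set c := T.incl k t (T.linObs.d (t + 1) t b)
    set x := T.incl k (t + 1) b
    have hx := homotopy_zero_apply Λ rfl rfl
      ((Λ'.hom (t + 1) (t + 1 + 1)).hom x - (Λ.hom (t + 1) (t + 1 + 1)).hom x)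
    have hd : (T.obs k).d (t + 1 + 1) (t + 1)
        ((Λ'.hom (t + 1) (t + 1 + 1)).hom x - (Λ.hom (t + 1) (t + 1 + 1)).hom x) =
        -((Λ'.hom t (t + 1)).hom c - (Λ.hom t (t + 1)).hom c) := by
      rw [map_sub, eq_sub_of_add_eq h, eq_sub_of_add_eq h']
      exact (sub_sub_sub_cancel_left _ _ _).trans (neg_sub _ _).symm
    rw [hd, map_neg, ← sub_eq_add_neg] at hx
    rw [T.d_j k rfl rfl, eq_add_of_sub_eq hx, map_add, map_sub]
    abel
  have hp := key .pc Λp Λp' (q - 1) (by omega)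
  have hm := key .fc Λm Λm' (q - 1) (by omega)
  refine Eq.trans ?_ ((congrArg₂ (· - ·) hp hm).trans ?_)
  · refine (congrArg (· + _) (map_sub (T.sol.d (q + 1) q).hom _ _)).trans ?_
    exact sub_add_sub_comm _ _ _ _
  · change _ = -(T.j .pc (q + 1) q (Λp'.hom q (q + 1) (T.incl .pc q b)) -
      T.j .fc (q + 1) q (Λm'.hom q (q + 1) (T.incl .fc q b)) -
      (T.j .pc (q + 1) q (Λp.hom q (q + 1) (T.incl .pc q b)) -
      T.j .fc (q + 1) q (Λm.hom q (q + 1) (T.incl .fc q b))))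
    rw [sub_sub_sub_comm]
    exact (neg_sub_neg _ _).trans (neg_sub _ _).symm

/-- The primitive `-(-1)^{|a|} ⟨a, λ b⟩` of the difference of the two Poisson structures, where `λ`
is `propagatorHomotopy`. -/
noncomputable def primitive (p q : ℤ) : T.linObs.X p →ₗ[ℝ] T.linObs.X q →ₗ[ℝ] ℝ :=
  (-(-1 : ℝ) ^ p) • (T.eval p (q + 1)).compl₂ (propagatorHomotopy Λp Λp' Λm Λm' q (q + 1))

/-- The unshifted Poisson structures of two pairs of trivializations are homologous. -/
theorem poisson_eq_add_boundary (p q : ℤ) (a b) : poisson Λp' Λm' p q a b =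
    poisson Λp Λm p q a b + CCR.boundary (primitive Λp Λp' Λm Λm') p q a b := by
  have h1 : ∀ r, q + 1 - 1 = r → T.eval (p - 1) (q + 1) (T.linObs.d p (p - 1) a)
      (propagatorHomotopy Λp Λp' Λm Λm' q (q + 1) b) + (-1 : ℝ) ^ p * T.eval p r a
        (T.sol.d (q + 1) r (propagatorHomotopy Λp Λp' Λm Λm' q (q + 1) b)) = 0 := by
    rintro _ rfl
    exact T.eval_d p (q + 1) a _
  have h2 : ∀ r, r = q → T.eval p r a
      (propagatorHomotopy Λp Λp' Λm Λm' (q - 1) r (T.linObs.d q (q - 1) b)) =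
      T.eval p q a
        (propagatorHomotopy Λp Λp' Λm Λm' (q - 1) q (T.linObs.d q (q - 1) b)) := by
    rintro r rfl
    rfl
  have h3 := congrArg (T.eval p q a) (d_propagatorHomotopy Λp Λp' Λm Λm' q b)
  rw [map_add, map_neg, map_sub] at h3
  have hs : (-1 : ℝ) ^ (p - 1) = -(-1 : ℝ) ^ p := by
    rw [zpow_sub_one₀ (by norm_num)]
    ring
  have alg : ∀ A D E τ τ' s s' : ℝ, s * s = 1 → s' = -s → A + s * E = 0 → E + D = -(τ' - τ) →
      τ' = τ + (-s' * A + s * (-s * D)) := fun A D E τ τ' s s' hs hs' hA hD ↦ by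
    rw [hs']
    linear_combination hD - s * hA + (E + D) * hs
  have h4 := alg _ _ _ _ _ _ _ (CCR.neg_one_zpow_mul_self_real p) hs
    (h1 q (by omega)) h3
  rw [← h2 (q - 1 + 1) (by omega)] at h4
  exact h4

end GaugeTheory

end LinGauge

theorem mainTheorem9 {m : ℕ} (hm : 2 ≤ m)
    {M : Type u} [TopologicalSpace M] [ChartedSpace (EuclideanSpace ℝ (Fin m)) M]
    [IsManifold (𝓡 m) ∞ M] [T2Space M] [SigmaCompactSpace M] [MeasurableSpace M] [BorelSpace M]
    {F₀ : Type w} [NormedAddCommGroup F₀] [NormedSpace ℝ F₀] [FiniteDimensional ℝ F₀]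
    {V₀ : M → Type v} [TopologicalSpace (TotalSpace F₀ V₀)] [∀ x, TopologicalSpace (V₀ x)]
    [∀ x, AddCommGroup (V₀ x)] [∀ x, Module ℝ (V₀ x)] [∀ x, IsTopologicalAddGroup (V₀ x)]
    [∀ x, ContinuousSMul ℝ (V₀ x)] [FiberBundle F₀ V₀] [VectorBundle ℝ F₀ V₀]
    [ContMDiffVectorBundle ∞ F₀ V₀ (𝓡 m)]
    {F₁ : Type w'} [NormedAddCommGroup F₁] [NormedSpace ℝ F₁] [FiniteDimensional ℝ F₁]
    {V₁ : M → Type v} [TopologicalSpace (TotalSpace F₁ V₁)] [∀ x, TopologicalSpace (V₁ x)]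
    [∀ x, AddCommGroup (V₁ x)] [∀ x, Module ℝ (V₁ x)] [∀ x, IsTopologicalAddGroup (V₁ x)]
    [∀ x, ContinuousSMul ℝ (V₁ x)] [FiberBundle F₁ V₁] [VectorBundle ℝ F₁ V₁]
    [ContMDiffVectorBundle ∞ F₁ V₁ (𝓡 m)]
    (S : LinGauge.Spacetime m M) (hS : S.IsGloballyHyperbolic)
    (h₀ : LinGauge.FiberMetric (m := m) F₀ V₀) (h₁ : LinGauge.FiberMetric (m := m) F₁ V₁)
    (T : LinGauge.GaugeTheory S h₀ h₁)
    (Λp Λp' : T.RetardedTrivialization) (Λm Λm' : T.AdvancedTrivialization)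
    (hΛ : LinGauge.GaugeTheory.Compatible Λp Λm)
    (hΛ' : LinGauge.GaugeTheory.Compatible Λp' Λm') :
    LinGauge.DGStarAlg.ZigZag
      (LinGauge.CCR T.linObs (LinGauge.GaugeTheory.poisson Λp Λm))
      (LinGauge.CCR T.linObs (LinGauge.GaugeTheory.poisson Λp' Λm')) :=
  LinGauge.CCR.zigZag_of_eq_add_boundary (LinGauge.GaugeTheory.isPoisson_poisson hΛ)
    (LinGauge.GaugeTheory.isPoisson_poisson hΛ')
    (fun p q h a b ↦ by
      change _ * T.eval p (q + 1) a _ = 0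
      rw [T.eval_eq_zero (by omega), mul_zero])
    (LinGauge.GaugeTheory.poisson_eq_add_boundary Λp Λp' Λm Λm')
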